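/- Let $d\ge 1$ and let $\eta$ be a simple point process on $\mathbb R^d$, i.e. a random element of the space of locally finite subsets of $\mathbb R^d$ (with the $\sigma$-field generated by the maps $\mu\mapsto\mu(B):=|\mu\cap B|$, $B$ Borel). Assume that $\eta$ is stationary (the law of $\eta+x$ does not depend on $x\in\mathbb R^d$), that $\mathbb E\,\eta(B)^m<\infty$ for each bounded Borel set $B$ and each $m\in\mathbb N$, and that the intensity $\gamma:=\mathbb E\,\eta([0,1]^d)$ is positive. Let $\alpha_m(\cdot):=\mathbb E\sum^{\neq}_{x_1,\dots,x_m\in\eta}\mathbf 1\{(x_1,\dots,x_m)\in\cdot\}$ (sum over $m$-tuples with pairwise different entries) be the factorial moment measures of $\eta$, and let the factorial cumulant measures $\beta_m$ be the signed measures, defined on bounded Borel sets of $(\mathbb R^d)^m$, with $$\beta_m(B_1\times\cdots\times B_m)=\sum_{\pi}(-1)^{|\pi|-1}(|\pi|-1)!\prod_{I\in\pi}\alpha_{|I|}(\times_{i\in I}B_i),$$ where $\pi$ runs over the partitions of $\{1,\dots,m\}$. For $m\ge2$ let $\beta^!_m$ be the reduced factorial cumulant measure, the locally finite signed measure on $(\mathbb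 R^d)^{m-1}$ with $\beta_m(\cdot)=\iint\mathbf 1\{(x,x_1+x,\dots,x_{m-1}+x)\in\cdot\}\,\beta^!_m(d(x_1,\dots,x_{m-1}))\,dx$, and let $|\beta^!_m|$ be its total variation measure. Assume that $$\int(1+\|x_1\|)\,|\beta^!_m|(d(x_1,\dots,x_{m-1}))<\infty\qquad\text{for every } m\ge2 .$$ Let $S(k):=1+\gamma^{-1}\int e^{-\mathrm i\langle k,x\rangle}\,\beta^!_2(dx)$, $k\in\mathbb R^d$, be the structure factor. Let $h\colon\mathbb R^d\to[0,\infty)$ be bounded, measurable and integrable, put $M_j(h):=\int h(x)^j\,dx$ and $h_r(x):=h(x/r)$ for $r>0$, and let $A_h\subset\mathbb R^d\setminus\{0\}$ satisfy $A_h=-A_h$. Assume that $r^{-d}\int h_r(x)^2e^{\mathrm i\langle k,x\rangle}dx\to0$ as $r\to\infty$ for each $k\ne0$, that $r^{-d/2}\int h_r(x)e^{\mathrm i\langle k,x\rangle}dx\to0$ as $r\to\infty$ for each $k\in A_h$, and that there are $a,b>0$ with $\int|h(x+y)-h(x)|\,dx\le a\mathbf 1\{\|y\|\le b\}\|y\|+a\mathbf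 1\{\|y\|>b\}$ for all $y\in\mathbb R^d$. Put $$T_r(k):=r^{-d/2}\sum_{x\in\eta}h_r(x)e^{-\mathrm i\langle k,x\rangle}-\mathbf 1\{k=0\}M_1(h)\,\gamma\, r^{d/2}.$$ Let $\mathbb R^{[d]}\subset\mathbb R^d$ contain exactly one element of $\{k,-k\}$ for each $k\in\mathbb R^d$ (so $0\in\mathbb R^{[d]}$), and put $\mathbb R^{\{d\}}:=(A_h\cup\{0\})\cap\mathbb R^{[d]}$. Then $\gamma M_2(h)S(k)$ is real and nonnegative for each $k\in\mathbb R^{\{d\}}$. Moreover, let $Z_k$, $k\in\mathbb R^{\{d\}}$, be independent centred complex random variables such that, for $k\neq0$, the real and imaginary parts of $Z_k$ are independent and normally distributed with variance $\gamma M_2(h)S(k)/2$, while $Z_0$ is real and normally distributed with variance $\gamma M_2(h)S(0)$ (a normal random variable with variance $0$ is almost surely constant). Then, for all $n\in\mathbb N$ and $k_1,\dots,k_n\in\mathbb R^{\{d\}}$, $$(T_r(k_1),\dots,T_r(k_n))\overset{d}{\longrightarrow}(Z_{k_1},\dots,Z_{k_n})\qquad\text{as } r\to\infty .$$ -/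

import Mathlib

open MeasureTheory ProbabilityTheory Filter Topology
open scoped NNReal ENNReal

noncomputable section

namespace PointProcess

/-- Euclidean space of dimension `d`. -/
abbrev E (d : ℕ) : Type := EuclideanSpace ℝ (Fin d)

/-- Locally finite subsets of Euclidean space. -/
structure Configuration (d : ℕ) where
  /-- the underlying set of points -/
  carrier : Set (E d)
  finite_inter : ∀ B : Set (E d), Bornology.IsBounded B → (carrier ∩ B).Finite

variable {d : ℕ}

/-- The number of points of a configuration in a set. -/
def Configuration.numPts (μ : Configuration d) (B : Set (E d)) : ℕ∞ := (μ.carrier ∩ B).encard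

/-- The smallest σ-field that makes all counting maps `μ ↦ μ(B)`, `B` Borel, measurable. -/
instance : MeasurableSpace (Configuration d) :=
  ⨆ (B : Set (E d)) (_ : MeasurableSet B),
    MeasurableSpace.comap (fun μ : Configuration d => μ.numPts B) inferInstance

/-- The translated configuration `{y + x : y ∈ μ}`. -/
def Configuration.translate (μ : Configuration d) (x : E d) : Configuration d where
  carrier := (fun y => y + x) '' μ.carrier
  finite_inter := by
    intro B hB
    have h1 : Bornology.IsBounded ((fun y => y + -x) '' B) :=
      (LipschitzWith.of_dist_le_mul (K := 1) (fun a b => by simp)).isBounded_image hB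
    refine ((μ.finite_inter _ h1).image (fun y => y + x)).subset ?_
    rintro _ ⟨⟨y, hy, rfl⟩, hyB⟩
    exact ⟨y, ⟨hy, ⟨y + x, hyB, by simp⟩⟩, rfl⟩

/-- The unit cube `[0,1]^d`. -/
def unitCube (d : ℕ) : Set (E d) := {x | ∀ i, x i ∈ Set.Icc (0 : ℝ) 1}

variable {Ω : Type*} [MeasurableSpace Ω]

/-- Stationarity: the law of `η + x` does not depend on `x`. -/
def IsStationary (P : Measure Ω) (η : Ω → Configuration d) : Prop :=
  ∀ x : E d, P.map (fun ω => (η ω).translate x) = P.map η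

/-- All moments of the number of points in any bounded Borel set are finite. -/
def HasAllMoments (P : Measure Ω) (η : Ω → Configuration d) : Prop :=
  ∀ B : Set (E d), MeasurableSet B → Bornology.IsBounded B → ∀ m : ℕ,
    ∫⁻ ω, ((η ω).numPts B : ℝ≥0∞) ^ m ∂P < ∞

/-- The intensity `γ = 𝔼 η([0,1]^d)`. -/
def intensity (P : Measure Ω) (η : Ω → Configuration d) : ℝ :=
  (∫⁻ ω, ((η ω).numPts (unitCube d) : ℝ≥0∞) ∂P).toReal

/-- The factorial moment measure of `η` on `(ℝ^d)^ι`: the expected number of tuples with pairwise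
different entries in `η` that lie in a given set. For `ι = Fin m` this is `α_m`. -/
def factorialMoment (P : Measure Ω) (η : Ω → Configuration d) (ι : Type) : Measure (ι → E d) :=
  P.bind fun ω =>
    Measure.count.restrict {x : ι → E d | Function.Injective x ∧ ∀ i, x i ∈ (η ω).carrier}

/-- For a partition `π` of `{0, …, m-1}`, the measure on `(ℝ^d)^m` that gives
`B_1 × ⋯ × B_m` the mass `∏_{I ∈ π} α_{|I|}(×_{i ∈ I} B_i)`. -/
def partitionMoment (P : Measure Ω) (η : Ω → Configuration d) {m : ℕ}
    (π : Finpartition (Finset.univ : Finset (Fin m))) : Measure (Fin m → E d) :=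
  (Measure.pi fun I : π.parts => factorialMoment P η (I : Finset (Fin m))).map
    fun y i => y ⟨π.part i, π.part_mem.2 (Finset.mem_univ i)⟩
      ⟨i, π.mem_part_self.2 (Finset.mem_univ i)⟩

/-- The terms of positive sign in the factorial cumulant measure
`β_m = ∑_π (-1)^(|π|-1) (|π|-1)! ⨂_{I ∈ π} α_{|I|}`. -/
def cumulantPlus (P : Measure Ω) (η : Ω → Configuration d) (m : ℕ) : Measure (Fin m → E d) :=
  ∑ π : Finpartition (Finset.univ : Finset (Fin m)) with Odd π.parts.card,
    (π.parts.card - 1).factorial • partitionMoment P η π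

/-- The terms of negative sign in the factorial cumulant measure, so that
`β_m = cumulantPlus m - cumulantMinus m` on bounded Borel sets. -/
def cumulantMinus (P : Measure Ω) (η : Ω → Configuration d) (m : ℕ) : Measure (Fin m → E d) :=
  ∑ π : Finpartition (Finset.univ : Finset (Fin m)) with Even π.parts.card,
    (π.parts.card - 1).factorial • partitionMoment P η π

/-- The reduction of a measure `μ` on `(ℝ^d)^(n+1)`,
`A ↦ μ {(x_0, …, x_n) : x_0 ∈ [0,1]^d, (x_1 - x_0, …, x_n - x_0) ∈ A}`.
If `μ` is locally finite and invariant under joint shifts, this is the unique measure `ν` with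
`μ = ∬ 1{(x, x_1 + x, …, x_n + x) ∈ ·} ν(d(x_1, …, x_n)) dx`. -/
def reduce {n : ℕ} (μ : Measure (Fin (n + 1) → E d)) : Measure (Fin n → E d) :=
  (μ.restrict {x | x 0 ∈ unitCube d}).map fun x i => x i.succ - x 0

/-- The positive part of the Jordan decomposition of the reduced factorial cumulant measure
`β^!_{n+1} = reduce (cumulantPlus (n+1)) - reduce (cumulantMinus (n+1))` on `(ℝ^d)^n`, which is a
locally finite signed measure. For `σ`-finite `μ`, `ν`, the difference `μ - ν` in the type of
measures, that is the least `τ` with `μ ≤ τ + ν`, is the positive part of the signed measure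
`μ - ν`. -/
def reducedCumulantPos (P : Measure Ω) (η : Ω → Configuration d) (n : ℕ) : Measure (Fin n → E d) :=
  reduce (cumulantPlus P η (n + 1)) - reduce (cumulantMinus P η (n + 1))

/-- The negative part of the Jordan decomposition of `β^!_{n+1}`. -/
def reducedCumulantNeg (P : Measure Ω) (η : Ω → Configuration d) (n : ℕ) : Measure (Fin n → E d) :=
  reduce (cumulantMinus P η (n + 1)) - reduce (cumulantPlus P η (n + 1))

/-- The total variation measure `|β^!_{n+1}|` on `(ℝ^d)^n`. -/
def reducedCumulantVar (P : Measure Ω) (η : Ω → Configuration d) (n : ℕ) : Measure (Fin n → E d) :=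
  reducedCumulantPos P η n + reducedCumulantNeg P η n

/-- The structure factor `S(k) = 1 + γ⁻¹ ∫ e^{-i⟨k,x⟩} β^!_2(dx)`. -/
def structureFactor (P : Measure Ω) (η : Ω → Configuration d) (k : E d) : ℂ :=
  1 + (intensity P η : ℂ)⁻¹ *
    (∫ x, Complex.exp (-Complex.I * (inner ℝ k (x 0) : ℝ)) ∂(reducedCumulantPos P η 1)
      - ∫ x, Complex.exp (-Complex.I * (inner ℝ k (x 0) : ℝ)) ∂(reducedCumulantNeg P η 1))

/-- `M_j(h) = ∫ h(x)^j dx`. -/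
def taperMoment (h : E d → ℝ) (j : ℕ) : ℝ := ∫ x, h x ^ j

/-- The assumptions on the taper function `h` and on the set `A` of wave vectors. -/
structure IsTaper (h : E d → ℝ) (A : Set (E d)) : Prop where
  measurable : Measurable h
  nonneg : ∀ x, 0 ≤ h x
  bounded : ∃ C, ∀ x, h x ≤ C
  integrable : Integrable h
  tendsto_sq : ∀ k : E d, k ≠ 0 → Tendsto
    (fun r : ℝ => ((r ^ d)⁻¹ : ℂ) *
      ∫ x, ((h (r⁻¹ • x) ^ 2 : ℝ) : ℂ) * Complex.exp (Complex.I * (inner ℝ k x : ℝ)))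
    atTop (𝓝 0)
  zero_notMem : (0 : E d) ∉ A
  neg_eq : ∀ k, k ∈ A ↔ -k ∈ A
  tendsto_one : ∀ k ∈ A, Tendsto
    (fun r : ℝ => ((r ^ ((d : ℝ) / 2) : ℝ) : ℂ)⁻¹ *
      ∫ x, (h (r⁻¹ • x) : ℂ) * Complex.exp (Complex.I * (inner ℝ k x : ℝ)))
    atTop (𝓝 0)
  integral_sub_le : ∃ a > 0, ∃ b > 0, ∀ y : E d,
    ∫ x, |h (x + y) - h x| ≤ if ‖y‖ ≤ b then a * ‖y‖ else a

/-- The tapered empirical Fourier transform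
`T_r(k) = r^{-d/2} ∑_{x ∈ η} h(x/r) e^{-i⟨k,x⟩} - 1{k = 0} M_1(h) γ r^{d/2}`. -/
def empiricalFourier (P : Measure Ω) (η : Ω → Configuration d) (h : E d → ℝ) (r : ℝ) (k : E d)
    (ω : Ω) : ℂ :=
  ((r ^ ((d : ℝ) / 2) : ℝ) : ℂ)⁻¹ *
      (∑' x : (η ω).carrier,
        (h (r⁻¹ • (x : E d)) : ℂ) * Complex.exp (-Complex.I * (inner ℝ k (x : E d) : ℝ)))
    - (if k = 0 then ((taperMoment h 1 * intensity P η * r ^ ((d : ℝ) / 2) : ℝ) : ℂ) else 0)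

/-- The asymptotic variance `γ M_2(h) S(k)`, as a complex number. -/
def asympVar (P : Measure Ω) (η : Ω → Configuration d) (h : E d → ℝ) (k : E d) : ℂ :=
  (intensity P η : ℂ) * (taperMoment h 2 : ℂ) * structureFactor P η k

open Classical in
/-- Variance of the real part of the limit `Z_k`: `γ M_2(h) S(k) / 2` if `k ≠ 0`, and
`γ M_2(h) S(0)` if `k = 0` (where the limit is real). -/
def varRe (P : Measure Ω) (η : Ω → Configuration d) (h : E d → ℝ) (k : E d) : ℝ≥0 :=
  if k = 0 then (asympVar P η h k).re.toNNReal else ((asympVar P η h k).re / 2).toNNReal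

open Classical in
/-- Variance of the imaginary part of the limit `Z_k`: `γ M_2(h) S(k) / 2` if `k ≠ 0`, and
`0` if `k = 0`. -/
def varIm (P : Measure Ω) (η : Ω → Configuration d) (h : E d → ℝ) (k : E d) : ℝ≥0 :=
  if k = 0 then 0 else ((asympVar P η h k).re / 2).toNNReal

end PointProcess

end

/-! Lévy's continuity theorem on `ℂⁿ` reduces the claim to the characteristic functions of `∑ j, Re
(conj (t j) * T_r (k j))`. Up to centring, this is a linear statistic `∑_{x ∈ η} g_r x` whose real
function `g_r` is `r^{-d/2} h(x/r)` times a fixed real trigonometric polynomial. Two features of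
`g_r` matter: `|g_r| ≤ δ_r` with `δ_r = O(r^{-d/2})`, and `δ_r * ‖g_r‖₁` stays bounded.

The `n`-th cumulant of the statistic is a sum, over the ways of grouping `n` copies of `g_r` into
`m` powers, of factorial cumulants `β_m(g^{p_1} ⊗ ⋯ ⊗ g^{p_m})`. Since `|β^!_m|` has finite total
mass, each of them is at most a constant times `‖g^{p_1}‖₁ * ∏_{i ≥ 2} ‖g‖_∞^{p_i} = O(δ_r^{n-2})`
(`norm_cumulant_le`, `tendsto_cumulantMean_succPow`). Hence all cumulants of order at least three
vanish in the limit. The mean is removed by the centring and by the condition on `A`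
(`tendsto_integral_mod`).

For the variance, the covariance of the statistics of `u` and `v` is `β_1(uv) + β_2(u ⊗ v)`. The
`L¹`-continuity of `h` allows `h_r(y + x)` to be replaced by `h_r(x)` under `β^!_2(dy)`. This leaves
the integral of the squared taper against a wave with vector `k + k'`, which tends to zero unless
`k' = -k` and then produces `γ M_2(h) S(k')` (`tendsto_statCov`). Because only one of `k`, `-k` is
admitted, distinct wave vectors decouple. Nonnegativity of `γ M_2(h) S(k)` follows since it is a
limit of variances.

Moments are recovered from cumulants by `m_{n+1} = ∑ C(n,p) κ_{p+1} m_{n-p}`. This recursion is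
derived on lists of functions (`mulStatIter_cons`) from the partition formula that defines the
factorial cumulants (`cumulantSum_recursion`). Convergence of the moments gives convergence of the
characteristic functions through Taylor's formula (`tendsto_integral_exp_of_moment`).

The argument runs with functions of bounded support, for which every integral is finite. A general
`h` is truncated with an `L¹` error of at most `1/r`, which changes the statistic by at most `γ/r`
in mean by Campbell's formula. -/

namespace PointProcess

/-! ### Algebra of the moment-cumulant recursion on lists -/

section Convolution

variable {M R : Type*} [CommRing R]

/-- The convolution of two functions of lists: the sum of `G l₁ * H l₂` over all ways of splitting
a list into two complementary sublists `l₁`, `l₂`. -/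
def conv : List M → (List M → R) → (List M → R) → R
  | [], G, H => G [] * H []
  | x :: l, G, H => conv l (fun t => G (x :: t)) H + conv l G (fun t => H (x :: t))

theorem conv_add_left (l : List M) (G G' H : List M → R) :
    conv l (fun t => G t + G' t) H = conv l G H + conv l G' H := by
  induction l generalizing G G' H with
  | nil => simp [conv, add_mul]
  | cons x l ih => simp only [conv, ih]; ring

theorem conv_add_right (l : List M) (G H H' : List M → R) :
    conv l G (fun t => H t + H' t) = conv l G H + conv l G H' := by
  induction l generalizing G H H' with
  | nil => simp [conv, mul_add]
  | cons x l ih => simp only [conv, ih]; ring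

variable [Mul M]

/-- The operator on functions of lists that corresponds to multiplication by the linear statistic
`∑ g - c`: either `g` is appended to the list, or some entry is multiplied by `g`. -/
def mulStat (g : M) (c : R) : List M → (List M → R) → R
  | [], F => F [g] - c * F []
  | x :: l, F => F ((g * x) :: l) + mulStat g c l (fun t => F (x :: t))

theorem mulStat_add (g : M) (c : R) (F F' : List M → R) (l : List M) :
    mulStat g c l (fun t => F t + F' t) = mulStat g c l F + mulStat g c l F' := by
  induction l generalizing F F' with
  | nil => simp only [mulStat]; ring
  | cons x l ih => simp only [mulStat, ih]; ring

theorem mulStat_mul (g : M) (c k : R) (F : List M → R) (l : List M) :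
    mulStat g c l (fun t => k * F t) = k * mulStat g c l F := by
  induction l generalizing F with
  | nil => simp only [mulStat]; ring
  | cons x l ih => simp only [mulStat, ih]; ring

theorem mulStat_sum {ι : Type*} (s : Finset ι) (g : M) (c : R) (F : ι → List M → R) (l : List M) :
    mulStat g c l (fun t => ∑ i ∈ s, F i t) = ∑ i ∈ s, mulStat g c l (F i) := by
  induction l generalizing F with
  | nil => simp only [mulStat, Finset.sum_sub_distrib, Finset.mul_sum]
  | cons x l ih => simp only [mulStat, ih, Finset.sum_add_distrib]

/-- A product rule: the new factor `g` lands in exactly one of the two sublists, either as a new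
entry or merged into an old one. The constant `c` must be subtracted only once, so it is charged to
the second factor and the first one is acted on with `c = 0`. -/
theorem mulStat_conv (g : M) (c : R) (G H : List M → R) (l : List M) :
    mulStat g c l (fun t => conv t G H)
      = conv l (fun t => mulStat g 0 t G) H + conv l G (fun t => mulStat g c t H) := by
  induction l generalizing G H with
  | nil => simp only [mulStat, conv]; ring
  | cons x l ih =>
    simp only [mulStat, conv, mulStat_add, ih, conv_add_left, conv_add_right]
    ring

/-- Iterates of `mulStat`. -/
def mulStatIter (g : M) (c : R) (F : List M → R) : ℕ → List M → R
  | 0 => F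
  | m + 1 => fun l => mulStat g c l (mulStatIter g c F m)

/-- The moment-cumulant recursion, for functions of lists. -/
theorem mulStatIter_cons (g : M) (c : R) {a b : List M → R}
    (hab : ∀ v l, a (v :: l) = conv l (fun t => b (v :: t)) a) (m : ℕ) (v : M) (l : List M) :
    mulStatIter g c a m (v :: l)
      = ∑ p ∈ Finset.HasAntidiagonal.antidiagonal m, (m.choose p.1 : R) *
          conv l (fun t => mulStatIter g 0 b p.1 (v :: t)) (mulStatIter g c a p.2) := by
  induction m generalizing v l with
  | zero => simp [mulStatIter, hab]
  | succ m ih =>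
    -- The term in which `g` is merged into the head `v` completes the action of `mulStat` on the
    -- factor `b (v :: ·)`, which always keeps `v`. So one more multiplication raises either the
    -- index of `b` or the index of `a`, and Pascal's rule finishes the induction.
    have h1 : mulStatIter g c a (m + 1) (v :: l) = ∑ p ∈ Finset.HasAntidiagonal.antidiagonal m, (m.choose p.1 : R) *
        (conv l (fun t => mulStatIter g 0 b (p.1 + 1) (v :: t)) (mulStatIter g c a p.2)
          + conv l (fun t => mulStatIter g 0 b p.1 (v :: t)) (mulStatIter g c a (p.2 + 1))) := by
      simp only [mulStatIter, mulStat]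
      rw [ih (g * v) l]
      simp only [ih v]
      rw [mulStat_sum]
      simp only [mulStat_mul, mulStat_conv]
      rw [← Finset.sum_add_distrib]
      refine Finset.sum_congr rfl fun p _ => ?_
      rw [conv_add_left]
      ring
    rw [h1]
    simp only [mul_add]
    rw [Finset.sum_add_distrib]
    have := Finset.sum_antidiagonal_choose_succ_mul (R := R) (fun i j =>
      conv l (fun t => mulStatIter g 0 b i (v :: t)) (mulStatIter g c a j)) m
    rw [this, add_comm]
    congr 1
    refine Finset.sum_congr rfl fun p hp => ?_
    rw [Nat.choose_symm_of_eq_add (Finset.HasAntidiagonal.mem_antidiagonal.1 hp).symm]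

/-- With `a` the factorial moments and `b` the factorial cumulants, `mulStatIter g 0 b p [g]` is the
ordinary cumulant of order `p + 1` of the linear statistic of `g`. The statement is then the
classical recursion for the moments of a variable centred by `c`. -/
theorem mulStatIter_succ_nil (g : M) (c : R) {a b : List M → R}
    (hab : ∀ v l, a (v :: l) = conv l (fun t => b (v :: t)) a) (m : ℕ) :
    mulStatIter g c a (m + 1) []
      = (∑ p ∈ Finset.HasAntidiagonal.antidiagonal m, (m.choose p.1 : R) *
          (mulStatIter g 0 b p.1 [g] * mulStatIter g c a p.2 []))
        - c * mulStatIter g c a m [] := by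
  have := mulStatIter_cons g c hab m g []
  simp only [conv] at this
  rw [← this]
  simp [mulStatIter, mulStat]

end Convolution

/-! ### Partition cumulants of set functions -/

section Partitions

variable {ι R : Type*} [DecidableEq ι] [CommRing R]

/-- The joint cumulant of a finite set in terms of its partitions. -/
def cumulantSum (a : Finset ι → R) (S : Finset ι) : R :=
  ∑ π : Finpartition S, (-1) ^ (π.parts.card - 1) * ((π.parts.card - 1).factorial : R) *
    ∏ I ∈ π.parts, a I

/-- The set of all families of blocks of partitions of a finite set. -/
def partFamilies (S : Finset ι) : Finset (Finset (Finset ι)) :=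
  (Finset.univ : Finset (Finpartition S)).image Finpartition.parts

theorem mem_partFamilies {S : Finset ι} {Q : Finset (Finset ι)} :
    Q ∈ partFamilies S ↔ Q.SupIndep id ∧ Q.sup id = S ∧ ∅ ∉ Q := by
  simp only [partFamilies, Finset.mem_image, Finset.mem_univ, true_and]
  constructor
  · rintro ⟨π, rfl⟩
    exact ⟨π.supIndep, π.sup_parts, π.bot_notMem⟩
  · rintro ⟨h1, h2, h3⟩
    exact ⟨⟨Q, h1, h2, h3⟩, rfl⟩

theorem sum_finpartition (S : Finset ι) (F : Finset (Finset ι) → R) :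
    ∑ π : Finpartition S, F π.parts = ∑ Q ∈ partFamilies S, F Q := by
  rw [partFamilies, Finset.sum_image]
  intro π _ π' _ h
  exact Finpartition.ext h

theorem mem_partFamilies' {S : Finset ι} {Q : Finset (Finset ι)} :
    Q ∈ partFamilies S ↔ (Q : Set (Finset ι)).PairwiseDisjoint id ∧ Q.biUnion id = S ∧ ∅ ∉ Q := by
  rw [mem_partFamilies, Finset.supIndep_iff_pairwiseDisjoint, Finset.sup_eq_biUnion]

/-- In a term with `T ≠ S`, the complement `S \ T` is added as one more block to a partition of `T`.
This is a bijection onto pairs of a partition `Q` of `S` and a block `J ∈ Q` that avoids `x`. A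
partition with `k` blocks thus arises `k - 1` times, each time with the weight `(-1)^(k-2) (k-2)!`.
This cancels its weight `(-1)^(k-1) (k-1)!` in the cumulant of `S`, unless `k = 1`. -/
theorem cumulantSum_recursion (a : Finset ι → R) (h0 : a ∅ = 1) {S : Finset ι} {x : ι}
    (hx : x ∈ S) :
    a S = ∑ T ∈ S.powerset with x ∈ T, cumulantSum a T * a (S \ T) := by
  classical
  set w : ℕ → R := fun k => (-1) ^ (k - 1) * ((k - 1).factorial : R) with hw
  have hc : ∀ T, cumulantSum a T = ∑ Q ∈ partFamilies T, w Q.card * ∏ I ∈ Q, a I := fun T =>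
    sum_finpartition T (fun Q => w Q.card * ∏ I ∈ Q, a I)
  have hS : S ∈ S.powerset.filter (x ∈ ·) := by simp [hx]
  rw [← Finset.add_sum_erase _ _ hS, Finset.sdiff_self, h0, mul_one]
  have key : ∑ T ∈ (S.powerset.filter (x ∈ ·)).erase S, cumulantSum a T * a (S \ T)
      = ∑ Q ∈ partFamilies S, ∑ J ∈ Q with x ∉ J, w (Q.card - 1) * ∏ I ∈ Q, a I := by
    simp only [hc, Finset.sum_mul]
    rw [Finset.sum_sigma', Finset.sum_sigma']
    refine Finset.sum_bij' (fun p _ => ⟨insert (S \ p.1) p.2, S \ p.1⟩)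
      (fun q _ => ⟨S \ q.2, q.1.erase q.2⟩) ?_ ?_ ?_ ?_ ?_
    · rintro ⟨T, Q⟩ h
      simp only [Finset.mem_sigma, Finset.mem_erase, Finset.mem_filter, Finset.mem_powerset,
        mem_partFamilies', ne_eq] at h ⊢
      obtain ⟨⟨hne, hTS, hxT⟩, hd, hU, he⟩ := h
      refine ⟨⟨?_, ?_, ?_⟩, Finset.mem_insert_self _ _, by simp [hxT]⟩
      · rw [Finset.coe_insert]
        refine hd.insert fun I hI _ => ?_
        have : I ⊆ T := by rw [← hU]; exact Finset.subset_biUnion_of_mem id hI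
        exact Finset.sdiff_disjoint.mono_right this
      · rw [Finset.biUnion_insert, hU]
        simp [hTS]
      · rw [Finset.mem_insert, not_or]
        refine ⟨fun h => hne ?_, he⟩
        exact Finset.Subset.antisymm hTS (Finset.sdiff_eq_empty_iff_subset.1 h.symm)
    · rintro ⟨Q, J⟩ h
      simp only [Finset.mem_sigma, Finset.mem_erase, Finset.mem_filter, Finset.mem_powerset,
        mem_partFamilies', ne_eq] at h ⊢
      obtain ⟨⟨hd, hU, he⟩, hJ, hxJ⟩ := h
      have hJS : J ⊆ S := by rw [← hU]; exact Finset.subset_biUnion_of_mem id hJ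
      refine ⟨⟨?_, Finset.sdiff_subset, by simp [hx, hxJ]⟩, ?_, ?_, ?_⟩
      · intro h
        rw [Finset.sdiff_eq_self_iff_disjoint] at h
        have : J = ∅ := Finset.disjoint_self_iff_empty J |>.1 (h.mono_left hJS)
        exact he (this ▸ hJ)
      · exact hd.subset (by simp)
      · ext y
        simp only [Finset.mem_biUnion, Finset.mem_erase, id, Finset.mem_sdiff]
        constructor
        · rintro ⟨I, ⟨hIJ, hI⟩, hy⟩
          refine ⟨?_, fun hyJ => Finset.disjoint_left.1 (hd hI hJ hIJ) hy hyJ⟩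
          rw [← hU]; exact Finset.mem_biUnion.2 ⟨I, hI, hy⟩
        · rintro ⟨hy, hyJ⟩
          rw [← hU] at hy
          obtain ⟨I, hI, hy⟩ := Finset.mem_biUnion.1 hy
          exact ⟨I, ⟨fun h => hyJ (h ▸ hy), hI⟩, hy⟩
      · exact fun h => he h.2
    · rintro ⟨T, Q⟩ h
      simp only [Finset.mem_sigma, Finset.mem_erase, Finset.mem_filter, Finset.mem_powerset,
        mem_partFamilies', ne_eq] at h
      obtain ⟨⟨hne, hTS, hxT⟩, hd, hU, he⟩ := h
      have hn : S \ T ∉ Q := by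
        intro h
        have h1 : S \ T ⊆ T := by
          conv_rhs => rw [← hU]
          exact Finset.subset_biUnion_of_mem id h
        have h2 : S \ T = ∅ := (Finset.disjoint_self_iff_empty _).1
          (Finset.sdiff_disjoint.mono_right h1)
        exact he (h2 ▸ h)
      simp [Finset.erase_insert hn, hTS]
    · rintro ⟨Q, J⟩ h
      simp only [Finset.mem_sigma, Finset.mem_filter, mem_partFamilies'] at h
      obtain ⟨⟨hd, hU, he⟩, hJ, hxJ⟩ := h
      have hJS : J ⊆ S := by rw [← hU]; exact Finset.subset_biUnion_of_mem id hJ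
      simp [hJS, Finset.insert_erase hJ]
    · rintro ⟨T, Q⟩ h
      simp only [Finset.mem_sigma, Finset.mem_erase, Finset.mem_filter, Finset.mem_powerset,
        mem_partFamilies', ne_eq] at h
      obtain ⟨⟨hne, hTS, hxT⟩, hd, hU, he⟩ := h
      have hn : S \ T ∉ Q := by
        intro h
        have h1 : S \ T ⊆ T := by
          conv_rhs => rw [← hU]
          exact Finset.subset_biUnion_of_mem id h
        have h2 : S \ T = ∅ := (Finset.disjoint_self_iff_empty _).1
          (Finset.sdiff_disjoint.mono_right h1)
        exact he (h2 ▸ h)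
      simp only [Finset.card_insert_of_notMem hn, Finset.prod_insert hn, Nat.add_sub_cancel]
      ring
  rw [key, hc, ← Finset.sum_add_distrib]
  -- Exactly one block contains `x`.
  have hcount : ∀ Q ∈ partFamilies S, (Q.filter (x ∉ ·)).card = Q.card - 1 := by
    intro Q hQ
    obtain ⟨hd, hU, he⟩ := mem_partFamilies'.1 hQ
    have hx' := hx
    rw [← hU] at hx'
    obtain ⟨I, hI, hxI⟩ := Finset.mem_biUnion.1 hx'
    rw [← Finset.card_erase_of_mem hI]
    congr 1
    ext J
    simp only [Finset.mem_filter, Finset.mem_erase]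
    constructor
    · rintro ⟨hJ, hxJ⟩; exact ⟨fun h => hxJ (h ▸ hxI), hJ⟩
    · rintro ⟨hne, hJ⟩
      exact ⟨hJ, fun hxJ => Finset.disjoint_left.1 (hd hJ hI hne) hxJ hxI⟩
  have hpos : ∀ Q ∈ partFamilies S, 1 ≤ Q.card := by
    intro Q hQ
    obtain ⟨hd, hU, he⟩ := mem_partFamilies'.1 hQ
    have hx' := hx
    rw [← hU] at hx'
    obtain ⟨I, hI, hxI⟩ := Finset.mem_biUnion.1 hx'
    exact Finset.card_pos.2 ⟨I, hI⟩
  have hSm : {S} ∈ partFamilies S := by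
    rw [mem_partFamilies']
    refine ⟨by simp, by simp, ?_⟩
    simp only [Finset.mem_singleton]
    exact fun h => by simp [← h] at hx
  rw [Finset.sum_eq_single_of_mem {S} hSm]
  · rw [Finset.sum_const, hcount _ hSm]
    simp [hw]
  · intro Q hQ hne
    rw [Finset.sum_const, hcount Q hQ]
    have h1 := hpos Q hQ
    have h2 : Q.card ≠ 1 := by
      intro h
      obtain ⟨I, rfl⟩ := Finset.card_eq_one.1 h
      have := (mem_partFamilies'.1 hQ).2.1
      simp at this
      exact hne (by rw [this])
    obtain ⟨k, hk⟩ : ∃ k, Q.card = k + 2 := ⟨Q.card - 2, by omega⟩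
    simp only [hk, hw, Nat.add_sub_cancel, show k + 2 - 1 = k + 1 by omega, nsmul_eq_mul,
      Nat.factorial_succ]
    push_cast
    ring

/-- The recursion determines the cumulants uniquely, so strong induction on `S` avoids transporting
partitions along `f`. -/
theorem cumulantSum_map {ι' : Type*} [DecidableEq ι'] (f : ι ↪ ι') (a : Finset ι → R)
    (a' : Finset ι' → R) (h0 : a ∅ = 1) (h : ∀ T, a' (T.map f) = a T) (S : Finset ι)
    (hS : S.Nonempty) : cumulantSum a' (S.map f) = cumulantSum a S := by
  classical
  induction S using Finset.strongInduction with
  | H S ih =>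
    obtain ⟨x, hx⟩ := hS
    have h0' : a' ∅ = 1 := by rw [← Finset.map_empty f, h, h0]
    have e1 := cumulantSum_recursion a h0 hx
    have e2 := cumulantSum_recursion a' h0' (Finset.mem_map_of_mem f hx)
    have hsum : ∑ T' ∈ (S.map f).powerset with f x ∈ T', cumulantSum a' T' * a' (S.map f \ T')
        = ∑ T ∈ S.powerset with x ∈ T, cumulantSum a' (T.map f) * a (S \ T) := by
      symm
      refine Finset.sum_bij (fun T _ => T.map f) ?_ ?_ ?_ ?_
      · intro T hT
        simp only [Finset.mem_filter, Finset.mem_powerset] at hT ⊢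
        exact ⟨Finset.map_subset_map.2 hT.1, Finset.mem_map_of_mem f hT.2⟩
      · intro T _ T' _ h
        exact Finset.map_injective f h
      · intro T' hT'
        simp only [Finset.mem_filter, Finset.mem_powerset] at hT'
        obtain ⟨T, hT, rfl⟩ := Finset.subset_map_iff.1 hT'.1
        refine ⟨T, ?_, rfl⟩
        simp only [Finset.mem_filter, Finset.mem_powerset]
        exact ⟨hT, (Finset.mem_map' f).1 hT'.2⟩
      · intro T hT
        rw [← h, Finset.map_sdiff]
    rw [hsum, h, e1] at e2
    have hSm : S ∈ S.powerset.filter (x ∈ ·) := by simp [hx]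
    rw [← Finset.add_sum_erase _ _ hSm, ← Finset.add_sum_erase _ _ hSm] at e2
    have e3 : ∑ T ∈ (S.powerset.filter (x ∈ ·)).erase S, cumulantSum a' (T.map f) * a (S \ T)
        = ∑ T ∈ (S.powerset.filter (x ∈ ·)).erase S, cumulantSum a T * a (S \ T) := by
      refine Finset.sum_congr rfl fun T hT => ?_
      simp only [Finset.mem_erase, Finset.mem_filter, Finset.mem_powerset] at hT
      rw [ih T (hT.2.1.ssubset_of_ne hT.1) ⟨x, hT.2.2⟩]
    rw [e3] at e2
    simpa [h0] using (add_right_cancel e2).symm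

theorem conv_toFinset (l : List ι) (hl : l.Nodup) (G H : Finset ι → R) :
    conv l (fun t => G t.toFinset) (fun t => H t.toFinset)
      = ∑ T ∈ l.toFinset.powerset, G T * H (l.toFinset \ T) := by
  induction l generalizing G H with
  | nil => simp [conv]
  | cons x l ih =>
    obtain ⟨hx, hl⟩ := List.nodup_cons.1 hl
    have hx' : x ∉ l.toFinset := by simpa using hx
    simp only [conv, List.toFinset_cons]
    rw [ih hl (fun T => G (insert x T)) H, ih hl G (fun T => H (insert x T)),
      Finset.sum_powerset_insert hx', add_comm]
    congr 1
    · refine Finset.sum_congr rfl fun T hT => ?_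
      rw [Finset.insert_sdiff_of_notMem]
      exact fun h => hx' (Finset.mem_powerset.1 hT h)
    · refine Finset.sum_congr rfl fun T hT => ?_
      rw [Finset.insert_sdiff_insert, Finset.sdiff_insert_of_notMem hx']

theorem conv_map {M M' : Type*} (p : M → M') (l : List M) (G H : List M' → R) :
    conv (l.map p) G H = conv l (fun t => G (t.map p)) (fun t => H (t.map p)) := by
  induction l generalizing G H with
  | nil => simp [conv]
  | cons x l ih => simp only [conv, List.map_cons, ih]

theorem conv_congr {M : Type*} (l : List M) {G G' H H' : List M → R}
    (hG : ∀ t, t.Sublist l → G t = G' t) (hH : ∀ t, t.Sublist l → H t = H' t) :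
    conv l G H = conv l G' H' := by
  induction l generalizing G G' H H' with
  | nil => simp [conv, hG, hH]
  | cons x l ih =>
    simp only [conv]
    rw [ih (G' := fun t => G' (x :: t)) (H' := H') (fun t ht => hG _ (ht.cons_cons x))
        (fun t ht => hH _ (ht.cons x)),
      ih (G' := G') (H' := fun t => H' (x :: t)) (fun t ht => hG _ (ht.cons x))
        (fun t ht => hH _ (ht.cons_cons x))]

end Partitions
end PointProcess

namespace PointProcess

/-! ### The method of moments for a Gaussian limit -/

section MomentMethod

/-- The derivative of the remainder of order `n + 1` is `I` times the remainder of order `n`, so the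
bound is integrated once in each induction step. -/
theorem norm_exp_I_sub_sum_le_of_nonneg (n : ℕ) {x : ℝ} (hx : 0 ≤ x) :
    ‖Complex.exp (Complex.I * x) - ∑ k ∈ Finset.range n, (Complex.I * x) ^ k / (k.factorial : ℂ)‖
      ≤ x ^ n / n.factorial := by
  induction n generalizing x with
  | zero => simp [mul_comm Complex.I, Complex.norm_exp_ofReal_mul_I]
  | succ n ih =>
    set f : ℝ → ℂ := fun y => Complex.exp (Complex.I * y)
      - ∑ k ∈ Finset.range (n + 1), (Complex.I * y) ^ k / (k.factorial : ℂ) with hf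
    have hd : ∀ y : ℝ, HasDerivAt f (Complex.I * (Complex.exp (Complex.I * y)
        - ∑ k ∈ Finset.range n, (Complex.I * y) ^ k / (k.factorial : ℂ))) y := by
      intro y
      have h0 : HasDerivAt (fun y : ℝ => Complex.I * (y : ℂ)) Complex.I y := by
        simpa using (Complex.ofRealCLM.hasDerivAt (x := y)).const_mul Complex.I
      have h1 := h0.cexp
      have h2 : ∀ k ∈ Finset.range n, HasDerivAt
          (fun y : ℝ => (Complex.I * (y : ℂ)) ^ (k + 1) / ((k + 1).factorial : ℂ))
          (Complex.I * ((Complex.I * y) ^ k / (k.factorial : ℂ))) y := by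
        intro k _
        have := (h0.pow (k + 1)).div_const ((k + 1).factorial : ℂ)
        convert! this using 1
        rw [Nat.factorial_succ]
        have h3 : (k.factorial : ℂ) ≠ 0 := by exact_mod_cast k.factorial_ne_zero
        have h4 : ((k : ℂ) + 1) ≠ 0 := by exact_mod_cast k.succ_ne_zero
        push_cast
        field_simp
      have h3 := (h1.sub (HasDerivAt.fun_sum h2)).sub_const (1 : ℂ)
      convert! h3 using 1
      · funext y
        simp only [hf, Finset.sum_range_succ', Pi.sub_apply]
        simp
        ring
      · rw [mul_sub, Finset.mul_sum]
        ring
    have hB : ∀ y : ℝ, HasDerivAt (fun y : ℝ => y ^ (n + 1) / ((n + 1).factorial : ℝ))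
        (y ^ n / n.factorial) y := by
      intro y
      have := (hasDerivAt_pow (n + 1) y).div_const ((n + 1).factorial : ℝ)
      convert! this using 1
      rw [Nat.factorial_succ]
      have h3 : (n.factorial : ℝ) ≠ 0 := by exact_mod_cast n.factorial_ne_zero
      have h4 : ((n : ℝ) + 1) ≠ 0 := by exact_mod_cast n.succ_ne_zero
      push_cast
      field_simp
    refine image_norm_le_of_norm_deriv_right_le_deriv_boundary (a := 0) (b := x)
      (f := f) (B := fun y : ℝ => y ^ (n + 1) / ((n + 1).factorial : ℝ))
      (fun y _ => (hd y).continuousAt.continuousWithinAt) (fun y _ => (hd y).hasDerivWithinAt)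
      ?_ (fun y => hB y) ?_ ⟨hx, le_rfl⟩
    · simp [hf, Finset.sum_range_succ']
    · intro y hy
      rw [norm_mul, Complex.norm_I, one_mul]
      exact ih hy.1

theorem norm_exp_I_sub_sum_le (n : ℕ) (x : ℝ) :
    ‖Complex.exp (Complex.I * x) - ∑ k ∈ Finset.range n, (Complex.I * x) ^ k / (k.factorial : ℂ)‖
      ≤ |x| ^ n / n.factorial := by
  rcases le_total 0 x with hx | hx
  · rw [abs_of_nonneg hx]
    exact norm_exp_I_sub_sum_le_of_nonneg n hx
  · rw [abs_of_nonpos hx]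
    have := norm_exp_I_sub_sum_le_of_nonneg n (neg_nonneg.2 hx)
    rw [← Complex.norm_conj] at this
    convert this using 2
    simp [← Complex.exp_conj]

/-- The moments of a centred Gaussian distribution with variance `s`. -/
def gaussMoment (s : ℝ) : ℕ → ℂ
  | 0 => 1
  | 1 => 0
  | n + 2 => (n + 1) * s * gaussMoment s n

theorem gaussMoment_even (s : ℝ) (j : ℕ) :
    gaussMoment s (2 * j) / ((2 * j).factorial : ℂ) = (s / 2) ^ j / (j.factorial : ℂ) := by
  induction j with
  | zero => simp [gaussMoment]
  | succ j ih =>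
    rw [show 2 * (j + 1) = 2 * j + 2 by ring, gaussMoment, Nat.factorial_succ, Nat.factorial_succ,
      Nat.factorial_succ, pow_succ]
    have h1 : ((2 * j).factorial : ℂ) ≠ 0 := by exact_mod_cast (2 * j).factorial_ne_zero
    have h2 : (j.factorial : ℂ) ≠ 0 := by exact_mod_cast j.factorial_ne_zero
    have h3 : ((j : ℂ) + 1) ≠ 0 := by exact_mod_cast j.succ_ne_zero
    have h4 : (2 * (j : ℂ) + 1) ≠ 0 := by exact_mod_cast (2 * j).succ_ne_zero
    have h5 : (2 * (j : ℂ) + 1 + 1) ≠ 0 := by exact_mod_cast (2 * j + 1).succ_ne_zero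
    have e : gaussMoment s (2 * j) = (s / 2) ^ j / (j.factorial : ℂ) * ((2 * j).factorial : ℂ) := by
      rw [← ih]; field_simp
    rw [e]
    push_cast
    field_simp
    ring

theorem gaussMoment_odd (s : ℝ) (j : ℕ) : gaussMoment s (2 * j + 1) = 0 := by
  induction j with
  | zero => simp [gaussMoment]
  | succ j ih =>
    rw [show 2 * (j + 1) + 1 = (2 * j + 1) + 2 by ring, gaussMoment, ih, mul_zero]

theorem sum_gaussMoment (s : ℝ) (N : ℕ) :
    ∑ k ∈ Finset.range (2 * N), Complex.I ^ k * gaussMoment s k / (k.factorial : ℂ)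
      = ∑ j ∈ Finset.range N, (-s / 2 : ℂ) ^ j / (j.factorial : ℂ) := by
  induction N with
  | zero => simp
  | succ N ih =>
    rw [show 2 * (N + 1) = 2 * N + 1 + 1 by ring, Finset.sum_range_succ, Finset.sum_range_succ, ih,
      Finset.sum_range_succ, gaussMoment_odd, mul_div_assoc, gaussMoment_even, pow_mul,
      Complex.I_sq, neg_div, neg_pow ((s : ℂ) / 2)]
    ring

/-- Here `κ r j` stands for the cumulant of order `j + 1`, so `j = 1` is the variance. In the limit
the recursion collapses to `m_{n+2} = (n + 1) s m_n`, which defines the Gaussian moments. -/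
theorem tendsto_moment_of_cumulant {α : Type*} {l : Filter α} (m κ : α → ℕ → ℂ) (s : ℝ)
    (h0 : ∀ r, m r 0 = 1)
    (hrec : ∀ r n, m r (n + 1) = ∑ p ∈ Finset.HasAntidiagonal.antidiagonal n,
      (n.choose p.1 : ℂ) * (κ r p.1 * m r p.2))
    (hκ : ∀ j, Tendsto (fun r => κ r j) l (𝓝 (if j = 1 then (s : ℂ) else 0))) (n : ℕ) :
    Tendsto (fun r => m r n) l (𝓝 (gaussMoment s n)) := by
  induction n using Nat.strongRecOn with
  | ind n ih =>
    rcases n with _ | n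
    · simpa [h0, gaussMoment] using tendsto_const_nhds
    · simp only [hrec]
      have : Tendsto (fun r => ∑ p ∈ Finset.HasAntidiagonal.antidiagonal n,
          (n.choose p.1 : ℂ) * (κ r p.1 * m r p.2)) l
          (𝓝 (∑ p ∈ Finset.HasAntidiagonal.antidiagonal n,
            (n.choose p.1 : ℂ) * ((if p.1 = 1 then (s : ℂ) else 0) * gaussMoment s p.2))) := by
        refine tendsto_finsetSum _ fun p hp => ?_
        have := Finset.HasAntidiagonal.mem_antidiagonal.1 hp
        exact ((hκ p.1).mul (ih p.2 (by omega))).const_mul _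
      convert this using 2
      rcases n with _ | n
      · simp [gaussMoment]
      · rw [Finset.sum_eq_single (1, n)]
        · simp [gaussMoment]; ring
        · rintro ⟨i, j⟩ hp hne
          have := Finset.HasAntidiagonal.mem_antidiagonal.1 hp
          have : i ≠ 1 := by
            rintro rfl
            simp only at this
            exact hne (by congr; omega)
          simp [this]
        · intro h
          exact absurd (Finset.HasAntidiagonal.mem_antidiagonal.2 (by simp; omega)) h

/-- Taylor's formula of order `2N` controls the characteristic function by the moments below `2N`,
with an error given by the moment of order `2N` over `(2N)!`. In the limit this error is `|s/2|^N /
N!`, which is small for large `N`. So `N` is fixed first and the limit along `l` is taken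
afterwards. -/
theorem tendsto_integral_exp_of_moment {α Ω : Type*} [MeasurableSpace Ω] {P : Measure Ω}
    [IsProbabilityMeasure P] {l : Filter α} (Y : α → Ω → ℝ) (s : ℝ)
    (hint : ∀ r n, Integrable (fun ω => Y r ω ^ n) P)
    (hm : ∀ n, Tendsto (fun r => ((∫ ω, Y r ω ^ n ∂P : ℝ) : ℂ)) l (𝓝 (gaussMoment s n))) :
    Tendsto (fun r => ∫ ω, Complex.exp (Complex.I * (Y r ω : ℝ)) ∂P) l
      (𝓝 (Complex.exp (-s / 2))) := by
  have hmeas : ∀ r, AEStronglyMeasurable (Y r) P := fun r => by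
    simpa using (hint r 1).aestronglyMeasurable
  -- The even order makes the absolute moment in the remainder an ordinary moment.
  have hbd : ∀ N r, ‖(∫ ω, Complex.exp (Complex.I * (Y r ω : ℝ)) ∂P)
      - ∑ k ∈ Finset.range (2 * N), Complex.I ^ k * ((∫ ω, Y r ω ^ k ∂P : ℝ) : ℂ)
        / (k.factorial : ℂ)‖ ≤ ‖((∫ ω, Y r ω ^ (2 * N) ∂P : ℝ) : ℂ) / ((2 * N).factorial : ℂ)‖ := by
    intro N r
    have hi : ∀ k, Integrable (fun ω => (Complex.I * (Y r ω : ℂ)) ^ k / (k.factorial : ℂ)) P := by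
      intro k
      have := ((hint r k).ofReal (𝕜 := ℂ)).const_mul (Complex.I ^ k / (k.factorial : ℂ))
      refine this.congr (Eventually.of_forall fun ω => ?_)
      simp only [RCLike.ofReal_pow, mul_pow]
      simp
      ring
    have hexp : Integrable (fun ω => Complex.exp (Complex.I * (Y r ω : ℝ))) P := by
      refine Integrable.of_bound (C := 1) ?_ (Eventually.of_forall fun ω => ?_)
      · have := (hmeas r).aemeasurable
        exact AEMeasurable.aestronglyMeasurable (by fun_prop)
      · rw [mul_comm, Complex.norm_exp_ofReal_mul_I]
    have e : ∑ k ∈ Finset.range (2 * N), Complex.I ^ k * ((∫ ω, Y r ω ^ k ∂P : ℝ) : ℂ)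
        / (k.factorial : ℂ)
        = ∫ ω, ∑ k ∈ Finset.range (2 * N), (Complex.I * (Y r ω : ℂ)) ^ k / (k.factorial : ℂ) ∂P := by
      rw [integral_finsetSum _ fun k _ => hi k]
      refine Finset.sum_congr rfl fun k _ => ?_
      rw [← integral_complex_ofReal, ← integral_const_mul, ← integral_div]
      refine integral_congr_ae (Eventually.of_forall fun ω => ?_)
      simp [mul_pow]
    rw [e, ← integral_sub hexp (integrable_finsetSum _ fun k _ => hi k)]
    refine (norm_integral_le_integral_norm _).trans ?_
    have h2 : ‖((∫ ω, Y r ω ^ (2 * N) ∂P : ℝ) : ℂ) / ((2 * N).factorial : ℂ)‖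
        = ∫ ω, |Y r ω| ^ (2 * N) / (2 * N).factorial ∂P := by
      rw [integral_div, norm_div, Complex.norm_real, Complex.norm_natCast, Real.norm_of_nonneg]
      · simp [pow_mul]
      · exact integral_nonneg fun ω => by simp only [pow_mul]; positivity
    rw [h2]
    refine integral_mono_of_nonneg (Eventually.of_forall fun _ => norm_nonneg _) ?_
      (Eventually.of_forall fun ω => norm_exp_I_sub_sum_le _ _)
    have := (hint r (2 * N)).div_const ((2 * N).factorial : ℝ)
    refine this.congr (Eventually.of_forall fun ω => ?_)
    simp [pow_mul]
  rw [Metric.tendsto_nhds]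
  intro ε hε
  have hE : Tendsto (fun N => ∑ j ∈ Finset.range N, (-s / 2 : ℂ) ^ j / (j.factorial : ℂ)) atTop
      (𝓝 (Complex.exp (-s / 2))) := by
    rw [Complex.exp_eq_exp_ℂ]
    exact (NormedSpace.expSeries_div_hasSum_exp (-s / 2 : ℂ)).tendsto_sum_nat
  have hZ : Tendsto (fun N => ‖((s : ℂ) / 2) ^ N / (N.factorial : ℂ)‖) atTop (𝓝 0) := by
    rw [← norm_zero (E := ℂ)]
    exact (NormedSpace.expSeries_div_summable ((s : ℂ) / 2)).tendsto_atTop_zero.norm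
  obtain ⟨N, hN1, hN2⟩ := ((Metric.tendsto_nhds.1 hE (ε / 3) (by positivity)).and
    ((tendsto_order.1 hZ).2 (ε / 3) (by positivity))).exists
  have t1 : Tendsto (fun r => ∑ k ∈ Finset.range (2 * N), Complex.I ^ k *
      ((∫ ω, Y r ω ^ k ∂P : ℝ) : ℂ) / (k.factorial : ℂ)) l
      (𝓝 (∑ j ∈ Finset.range N, (-s / 2 : ℂ) ^ j / (j.factorial : ℂ))) := by
    rw [← sum_gaussMoment]
    exact tendsto_finsetSum _ fun k _ => ((hm k).const_mul _).div_const _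
  have t2 : Tendsto (fun r => ‖((∫ ω, Y r ω ^ (2 * N) ∂P : ℝ) : ℂ) / ((2 * N).factorial : ℂ)‖) l
      (𝓝 ‖((s : ℂ) / 2) ^ N / (N.factorial : ℂ)‖) := by
    rw [← gaussMoment_even]
    exact ((hm _).div_const _).norm
  filter_upwards [Metric.tendsto_nhds.1 t1 (ε / 3) (by positivity),
    (tendsto_order.1 t2).2 (ε / 3) hN2] with r hr1 hr2
  have h1 := hbd N r
  rw [← dist_eq_norm] at h1
  calc _ ≤ _ + _ + _ := dist_triangle4 _ (∑ k ∈ Finset.range (2 * N), Complex.I ^ k *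
          ((∫ ω, Y r ω ^ k ∂P : ℝ) : ℂ) / (k.factorial : ℂ)) (∑ j ∈ Finset.range N, (-s / 2 : ℂ) ^ j / (j.factorial : ℂ)) _
    _ < ε / 3 + ε / 3 + ε / 3 := by
      gcongr
      exact h1.trans_lt hr2
    _ = ε := by ring

end MomentMethod
end PointProcess

/-! ### Measurability and stationarity of tuple measures -/

namespace PointProcess

variable {d : ℕ}

theorem Configuration.countable (μ : Configuration d) : μ.carrier.Countable := by
  have : μ.carrier = ⋃ n : ℕ, μ.carrier ∩ Metric.closedBall 0 n := by
    rw [← Set.inter_iUnion, Metric.iUnion_closedBall_nat, Set.inter_univ]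
  rw [this]
  exact Set.countable_iUnion fun n => (μ.finite_inter _ Metric.isBounded_closedBall).countable

/-- The tuples of pairwise different points of a configuration. -/
def tupleSet (ι : Type) (μ : Configuration d) : Set (ι → E d) :=
  {x | Function.Injective x ∧ ∀ i, x i ∈ μ.carrier}

/-- The counting measure on the tuples of pairwise different points of a configuration. -/
noncomputable def tupleMeasure (ι : Type) (μ : Configuration d) : Measure (ι → E d) :=
  Measure.count.restrict (tupleSet ι μ)

theorem factorialMoment_def {Ω : Type*} [MeasurableSpace Ω] (P : Measure Ω)
    (η : Ω → Configuration d) (ι : Type) :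
    factorialMoment P η ι = P.bind fun ω => tupleMeasure ι (η ω) := rfl

theorem measurable_numPts {B : Set (E d)} (hB : MeasurableSet B) :
    Measurable fun μ : Configuration d => μ.numPts B := by
  rw [measurable_iff_comap_le]
  exact le_iSup₂_of_le B hB le_rfl

theorem measurable_configuration_iff {Ω : Type*} [MeasurableSpace Ω] {f : Ω → Configuration d} :
    Measurable f ↔ ∀ B, MeasurableSet B → Measurable fun ω => (f ω).numPts B := by
  constructor
  · intro h B hB
    exact (measurable_numPts hB).comp h
  · intro h
    rw [measurable_iff_comap_le]
    change MeasurableSpace.comap f (⨆ (B : Set (E d)) (_ : MeasurableSet B),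
      MeasurableSpace.comap (fun μ : Configuration d => μ.numPts B) inferInstance) ≤ _
    simp only [MeasurableSpace.comap_iSup, MeasurableSpace.comap_comp]
    exact iSup₂_le fun B hB => (h B hB).comap_le

theorem Configuration.numPts_translate (μ : Configuration d) (x : E d) (B : Set (E d)) :
    (μ.translate x).numPts B = μ.numPts ((fun y => y + x) ⁻¹' B) := by
  simp only [Configuration.numPts, Configuration.translate]
  rw [← Set.image_inter_preimage, Function.Injective.encard_image (add_left_injective x)]

theorem measurable_translate (x : E d) :
    Measurable fun μ : Configuration d => μ.translate x := by
  rw [measurable_configuration_iff]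
  intro B hB
  simp only [Configuration.numPts_translate]
  exact measurable_numPts (measurable_add_const x hB)

theorem count_restrict_pi {α : Type*} [MeasurableSpace α] [MeasurableSingletonClass α] {ι : Type}
    [Fintype ι] {A : Set α} (hA : A.Finite) :
    Measure.pi (fun _ : ι => Measure.count.restrict A)
      = Measure.count.restrict (Set.univ.pi fun _ => A) := by
  classical
  have : IsFiniteMeasure ((Measure.count : Measure α).restrict A) :=
    ⟨by rw [Measure.restrict_apply_univ]; exact Measure.count_apply_lt_top.2 hA⟩
  refine (Measure.pi_eq fun s hs => ?_)
  rw [Measure.restrict_apply (MeasurableSet.univ_pi hs), ← Set.pi_inter_distrib]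
  have hf : ∀ i, (s i ∩ A).Finite := fun i => hA.inter_of_right _
  have h1 : (Set.univ.pi fun i => s i ∩ A) = ↑(Fintype.piFinset fun i => (hf i).toFinset) := by
    ext x; simp
  rw [h1, Measure.count_apply_finset, Fintype.card_piFinset, Nat.cast_prod]
  refine Finset.prod_congr rfl fun i _ => ?_
  rw [Measure.restrict_apply (hs i), Measure.count_apply_finite _ (hf i)]

theorem measurable_count_restrict (B : Set (E d)) (hB : MeasurableSet B) :
    Measurable fun μ : Configuration d =>
      (Measure.count : Measure (E d)).restrict (μ.carrier ∩ B) := by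
  refine Measure.measurable_of_measurable_coe _ fun s hs => ?_
  have : ∀ μ : Configuration d, (Measure.count : Measure (E d)).restrict (μ.carrier ∩ B) s
      = ((μ.numPts (s ∩ B) : ℕ∞) : ℝ≥0∞) := by
    intro μ
    rw [Measure.restrict_apply hs, Measure.count_apply]
    · congr 2
      ext x; simp; tauto
    · exact ((μ.countable.mono Set.inter_subset_left).mono Set.inter_subset_right).measurableSet
  simp only [this]
  exact (measurable_from_top (f := fun n : ℕ∞ => (n : ℝ≥0∞))).comp
    (measurable_numPts (hs.inter hB))

/-- On a bounded window the counting measure on tuples is a product of finite counting measures. Its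
measurability need only be checked on rectangles, where it is a product of point counts. -/
theorem measurable_count_restrict_pi (ι : Type) [Fintype ι] (B : Set (E d)) (hB : MeasurableSet B)
    (hB' : Bornology.IsBounded B) :
    Measurable fun μ : Configuration d =>
      (Measure.count : Measure (ι → E d)).restrict (Set.univ.pi fun _ => μ.carrier ∩ B) := by
  have h1 : ∀ μ : Configuration d, IsFiniteMeasure
      ((Measure.count : Measure (E d)).restrict (μ.carrier ∩ B)) := fun μ =>
    ⟨by rw [Measure.restrict_apply_univ]
        exact Measure.count_apply_lt_top.2 (μ.finite_inter _ hB')⟩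
  simp only [← count_restrict_pi (Configuration.finite_inter _ _ hB')]
  refine Measurable.measure_of_isPiSystem generateFrom_pi.symm isPiSystem_pi ?_ ?_
  · rintro _ ⟨s, hs, rfl⟩
    simp only [Measure.pi_pi]
    refine Finset.measurable_prod _ fun i _ => ?_
    exact (Measure.measurable_coe (show MeasurableSet (s i) from hs i (Set.mem_univ i))).comp (measurable_count_restrict B hB)
  · simp only [Measure.pi_univ]
    refine Finset.measurable_prod _ fun i _ => ?_
    exact (Measure.measurable_coe MeasurableSet.univ).comp (measurable_count_restrict B hB)

theorem measurableSet_injective (ι : Type) [Fintype ι] :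
    MeasurableSet {x : ι → E d | Function.Injective x} := by
  have : {x : ι → E d | Function.Injective x}
      = ⋂ i : ι, ⋂ j : ι, ⋂ _ : i ≠ j, {x | x i = x j}ᶜ := by
    ext x
    simp only [Function.Injective, Set.mem_ofPred_eq, Set.mem_iInter, Set.mem_compl_iff]
    constructor
    · intro h i j hij he; exact hij (h he)
    · intro h i j he; by_contra hij; exact h i j hij he
  rw [this]
  refine MeasurableSet.iInter fun i => MeasurableSet.iInter fun j => MeasurableSet.iInter fun _ => ?_
  exact (measurableSet_eq_fun (measurable_pi_apply i) (measurable_pi_apply j)).compl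

theorem tupleSet_countable (ι : Type) [Finite ι] (μ : Configuration d) :
    (tupleSet ι μ).Countable := by
  refine (Set.countable_univ_pi fun _ : ι => μ.countable).mono ?_
  rintro x ⟨-, hx⟩ i -
  exact hx i

theorem tupleSet_measurableSet (ι : Type) [Finite ι] (μ : Configuration d) :
    MeasurableSet (tupleSet ι μ) := (tupleSet_countable ι μ).measurableSet

/-- The number of tuples in `s` is the increasing limit of the number of tuples with entries in
growing balls. Distinctness of the entries is a measurable condition on the tuple alone, so it can
be absorbed into `s`. -/
theorem measurable_tupleMeasure (ι : Type) [Fintype ι] :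
    Measurable fun μ : Configuration d => tupleMeasure ι μ := by
  refine Measure.measurable_of_measurable_coe _ fun s hs => ?_
  have : ∀ μ : Configuration d, tupleMeasure ι μ s = ⨆ n : ℕ,
      (Measure.count : Measure (ι → E d)).restrict
        (Set.univ.pi fun _ => μ.carrier ∩ Metric.closedBall 0 n)
        (s ∩ {x | Function.Injective x}) := by
    intro μ
    rw [tupleMeasure, Measure.restrict_apply hs]
    have hm : ∀ n : ℕ, (Measure.count : Measure (ι → E d)).restrict
        (Set.univ.pi fun _ => μ.carrier ∩ Metric.closedBall 0 n) (s ∩ {x | Function.Injective x})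
        = Measure.count ((s ∩ {x | Function.Injective x}) ∩
          (Set.univ.pi fun _ => μ.carrier ∩ Metric.closedBall 0 n)) := fun n =>
      Measure.restrict_apply (hs.inter (measurableSet_injective ι))
    simp only [hm]
    rw [← Monotone.measure_iUnion]
    · congr 1
      ext x
      simp only [Set.mem_inter_iff, tupleSet, Set.mem_ofPred_eq, Set.mem_iUnion, Set.mem_pi,
        Set.mem_univ, forall_true_left]
      constructor
      · rintro ⟨h1, h2, h3⟩
        obtain ⟨n, hn⟩ := exists_nat_ge (∑ i, ‖x i‖)
        refine ⟨n, ⟨h1, h2⟩, fun i => ⟨h3 i, ?_⟩⟩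
        rw [mem_closedBall_zero_iff]
        exact (Finset.single_le_sum (f := fun i => ‖x i‖) (fun j _ => norm_nonneg _)
          (Finset.mem_univ i)).trans hn
      · rintro ⟨n, ⟨h1, h2⟩, h3⟩
        exact ⟨h1, h2, fun i => (h3 i).1⟩
    · intro n m hnm
      refine Set.inter_subset_inter_right _ (Set.pi_mono fun i _ => Set.inter_subset_inter_right _ ?_)
      exact Metric.closedBall_subset_closedBall (by exact_mod_cast hnm)
  simp only [this]
  refine Measurable.iSup fun n => ?_
  exact (Measure.measurable_coe (hs.inter (measurableSet_injective ι))).comp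
    (measurable_count_restrict_pi ι _ Metric.isClosed_closedBall.measurableSet
      Metric.isBounded_closedBall)

section FactorialMoments

variable {Ω : Type*} [MeasurableSpace Ω] {P : Measure Ω} {η : Ω → Configuration d}

theorem measurable_tupleMeasure_comp (hη : Measurable η) (ι : Type) [Fintype ι] :
    Measurable fun ω => tupleMeasure ι (η ω) := (measurable_tupleMeasure ι).comp hη

theorem tupleMeasure_univ_pi_le (ι : Type) [Fintype ι] (μ : Configuration d) {B : Set (E d)}
    (hB : MeasurableSet B) (hB' : Bornology.IsBounded B) :
    tupleMeasure ι μ (Set.univ.pi fun _ => B) ≤ ((μ.numPts B : ℕ∞) : ℝ≥0∞) ^ Fintype.card ι := by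
  rw [tupleMeasure, Measure.restrict_apply (MeasurableSet.univ_pi fun _ => hB)]
  have hf := μ.finite_inter B hB'
  calc _ ≤ Measure.count (Set.univ.pi fun _ : ι => μ.carrier ∩ B) := by
        refine measure_mono ?_
        rintro x ⟨h1, -, h2⟩ i -
        exact ⟨h2 i, h1 i (Set.mem_univ i)⟩
    _ = ∏ _i : ι, ((μ.numPts B : ℕ∞) : ℝ≥0∞) := by
        have := count_restrict_pi (ι := ι) hf
        have : IsFiniteMeasure ((Measure.count : Measure (E d)).restrict (μ.carrier ∩ B)) :=
          ⟨by rw [Measure.restrict_apply_univ]; exact Measure.count_apply_lt_top.2 hf⟩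
        rw [← Measure.restrict_apply_univ, ← count_restrict_pi hf, Measure.pi_univ]
        refine Finset.prod_congr rfl fun i _ => ?_
        rw [Measure.restrict_apply_univ, Measure.count_apply hf.measurableSet]
        rfl
    _ = _ := by simp

theorem factorialMoment_box_lt_top (hη : Measurable η) (hmom : HasAllMoments P η) (ι : Type)
    [Fintype ι] {B : Set (E d)} (hB : MeasurableSet B) (hB' : Bornology.IsBounded B) :
    factorialMoment P η ι (Set.univ.pi fun _ => B) < ∞ := by
  rw [factorialMoment_def, Measure.bind_apply (MeasurableSet.univ_pi fun _ => hB)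
    (measurable_tupleMeasure_comp hη ι).aemeasurable]
  exact (lintegral_mono fun ω => tupleMeasure_univ_pi_le ι (η ω) hB hB').trans_lt
    (hmom B hB hB' _)

end FactorialMoments

/-- Measures on tuples that are finite on bounded sets. -/
def BoxFinite {ι : Type*} (μ : Measure (ι → E d)) : Prop :=
  ∀ R : ℝ, μ (Set.univ.pi fun _ => Metric.closedBall 0 R) < ∞

theorem iUnion_box {ι : Type*} [Fintype ι] :
    ⋃ n : ℕ, (Set.univ.pi fun _ : ι => Metric.closedBall (0 : E d) n) = Set.univ := by
  refine Set.eq_univ_of_forall fun x => ?_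
  obtain ⟨n, hn⟩ := exists_nat_ge (∑ i, ‖x i‖)
  refine Set.mem_iUnion.2 ⟨n, fun i _ => ?_⟩
  rw [mem_closedBall_zero_iff]
  exact (Finset.single_le_sum (f := fun i => ‖x i‖) (fun j _ => norm_nonneg _)
    (Finset.mem_univ i)).trans hn

theorem BoxFinite.sigmaFinite {ι : Type*} [Fintype ι] {μ : Measure (ι → E d)} (h : BoxFinite μ) :
    SigmaFinite μ :=
  ⟨⟨⟨fun n : ℕ => Set.univ.pi fun _ => Metric.closedBall 0 n, fun _ => trivial, fun n => h n,
    iUnion_box⟩⟩⟩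

theorem measurableSet_box {ι : Type*} [Countable ι] (R : ℝ) :
    MeasurableSet (Set.univ.pi fun _ : ι => Metric.closedBall (0 : E d) R) :=
  MeasurableSet.univ_pi fun _ => Metric.isClosed_closedBall.measurableSet

/-- Shift all entries of a tuple. -/
def shift {ι : Type*} (c : E d) (x : ι → E d) : ι → E d := fun i => x i + c

theorem measurable_shift {ι : Type*} (c : E d) : Measurable (shift (ι := ι) c) :=
  measurable_pi_lambda _ fun i => by unfold shift; fun_prop

section FactorialMoments

variable {Ω : Type*} [MeasurableSpace Ω] {P : Measure Ω} {η : Ω → Configuration d}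

theorem tupleMeasure_translate (ι : Type) [Finite ι] (μ : Configuration d) (c : E d) :
    tupleMeasure ι (μ.translate c) = (tupleMeasure ι μ).map (shift c) := by
  have hinj : Function.Injective (shift (ι := ι) c) := fun x y h => by
    funext i
    exact add_right_cancel (congrFun h i)
  ext s hs
  rw [Measure.map_apply (measurable_shift c) hs, tupleMeasure, tupleMeasure,
    Measure.restrict_apply hs, Measure.restrict_apply (measurable_shift c hs),
    Measure.count_apply (hs.inter (tupleSet_measurableSet ι _)),
    Measure.count_apply ((measurable_shift c hs).inter (tupleSet_measurableSet ι _)),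
    ← hinj.encard_image (shift c ⁻¹' s ∩ _)]
  congr 2
  ext x
  constructor
  · rintro ⟨h1, h2, h3⟩
    simp only [Configuration.translate, Set.mem_image] at h3
    choose y hy1 hy2 using h3
    have : shift c y = x := funext hy2
    refine ⟨y, ⟨by rw [Set.mem_preimage, this]; exact h1, ?_, hy1⟩, this⟩
    rw [← this] at h2
    intro i j hij
    exact h2 (by simp [shift, hij])
  · rintro ⟨y, ⟨h1, h2, h3⟩, rfl⟩
    exact ⟨h1, fun i j hij => h2 (add_right_cancel hij), fun i => ⟨y i, h3 i, rfl⟩⟩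

/-- The factorial moment measure depends on `η` only through its law, and translating a
configuration shifts its tuples. -/
theorem factorialMoment_map_shift (hη : Measurable η) (hstat : IsStationary P η) (ι : Type)
    [Fintype ι] (c : E d) : (factorialMoment P η ι).map (shift c) = factorialMoment P η ι := by
  have h1 : factorialMoment P η ι = (P.map η).bind (fun μ => tupleMeasure ι μ) := by
    rw [factorialMoment_def]
    ext s hs
    rw [Measure.bind_apply hs (measurable_tupleMeasure_comp hη ι).aemeasurable,
      Measure.bind_apply hs (measurable_tupleMeasure ι).aemeasurable,
      lintegral_map (f := fun μ => tupleMeasure ι μ s)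
        ((Measure.measurable_coe hs).comp (measurable_tupleMeasure ι)) hη]
  have h2 : factorialMoment P η ι
      = (P.map (fun ω => (η ω).translate c)).bind (fun μ => tupleMeasure ι μ) := by
    rw [h1, hstat c]
  conv_rhs => rw [h2]
  ext s hs
  have hc : Measurable fun ω => (η ω).translate c := (measurable_translate c).comp hη
  rw [Measure.map_apply (measurable_shift c) hs, factorialMoment_def,
    Measure.bind_apply (measurable_shift c hs) (measurable_tupleMeasure_comp hη ι).aemeasurable,
      Measure.bind_apply hs (measurable_tupleMeasure ι).aemeasurable,
      lintegral_map (f := fun μ => tupleMeasure ι μ s)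
        ((Measure.measurable_coe hs).comp (measurable_tupleMeasure ι)) hc]
  refine lintegral_congr fun ω => ?_
  rw [tupleMeasure_translate, Measure.map_apply (measurable_shift c) hs]

theorem factorialMoment_boxFinite (hη : Measurable η) (hmom : HasAllMoments P η) (ι : Type)
    [Fintype ι] : BoxFinite (factorialMoment P η ι) := fun _ =>
  factorialMoment_box_lt_top hη hmom ι Metric.isClosed_closedBall.measurableSet
    Metric.isBounded_closedBall

end FactorialMoments

end PointProcess

namespace PointProcess

/-! ### Jordan decomposition through truncated differences of measures -/

section MeasureSub

variable {α : Type*} [MeasurableSpace α]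

/-- On each piece of a Hahn decomposition one of the two truncated differences vanishes and the
other is a genuine difference. Writing the identity with sums avoids signed measures, and so it
extends to measures that are only finite on the sets of a countable cover. -/
theorem add_sub_eq_add_sub_of_isFiniteMeasure (μ ν : Measure α) [IsFiniteMeasure μ]
    [IsFiniteMeasure ν] : μ + (ν - μ) = ν + (μ - ν) := by
  obtain ⟨s, hs⟩ := exists_isHahnDecomposition μ ν
  have key : ∀ (μ ν : Measure α) [IsFiniteMeasure μ] [IsFiniteMeasure ν] (t : Set α),
      MeasurableSet t → μ.restrict t ≤ ν.restrict t →
      (μ + (ν - μ)).restrict t = (ν + (μ - ν)).restrict t := by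
    intro μ ν _ _ t ht h
    rw [Measure.restrict_add, Measure.restrict_add,
      Measure.restrict_sub_eq_restrict_sub_restrict ht,
      Measure.restrict_sub_eq_restrict_sub_restrict ht, Measure.sub_eq_zero_of_le h, add_zero,
      add_comm, Measure.sub_add_cancel_of_le h]
  have h1 := key μ ν s hs.measurableSet hs.le_on
  have h2 := key ν μ sᶜ hs.measurableSet.compl hs.ge_on_compl
  rw [← Measure.restrict_add_restrict_compl (μ := μ + (ν - μ)) hs.measurableSet,
    ← Measure.restrict_add_restrict_compl (μ := ν + (μ - ν)) hs.measurableSet, h1, h2]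

theorem add_sub_eq_add_sub_of_iUnion (μ ν : Measure α) (s : ℕ → Set α)
    (hs : ∀ n, MeasurableSet (s n)) (hU : ⋃ n, s n = Set.univ) (hμ : ∀ n, μ (s n) < ∞)
    (hν : ∀ n, ν (s n) < ∞) : μ + (ν - μ) = ν + (μ - ν) := by
  rw [Measure.ext_iff_of_iUnion_eq_univ hU]
  intro n
  have : IsFiniteMeasure (μ.restrict (s n)) := ⟨by simpa using hμ n⟩
  have : IsFiniteMeasure (ν.restrict (s n)) := ⟨by simpa using hν n⟩
  rw [Measure.restrict_add, Measure.restrict_add,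
    Measure.restrict_sub_eq_restrict_sub_restrict (hs n),
    Measure.restrict_sub_eq_restrict_sub_restrict (hs n)]
  exact add_sub_eq_add_sub_of_isFiniteMeasure _ _

end MeasureSub

variable {d : ℕ}

section UnitCube

theorem unitCube_eq (d : ℕ) : unitCube d
    = (WithLp.ofLp : E d → Fin d → ℝ) ⁻¹' (Set.univ.pi fun _ => Set.Icc (0 : ℝ) 1) := by
  ext x
  simp [unitCube, Pi.le_def, forall_and]

theorem measurableSet_unitCube (d : ℕ) : MeasurableSet (unitCube d) := by
  rw [unitCube_eq]
  exact (PiLp.volume_preserving_ofLp (Fin d)).measurable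
    (MeasurableSet.univ_pi fun _ => measurableSet_Icc)

theorem volume_unitCube (d : ℕ) : volume (unitCube d) = 1 := by
  rw [unitCube_eq, (PiLp.volume_preserving_ofLp (Fin d)).measure_preimage
    (MeasurableSet.univ_pi fun _ => measurableSet_Icc).nullMeasurableSet, volume_pi_pi]
  simp

theorem unitCube_subset (d : ℕ) : unitCube d ⊆ Metric.closedBall 0 (d : ℝ) := by
  intro x hx
  rw [mem_closedBall_zero_iff, EuclideanSpace.norm_eq, Real.sqrt_le_left (by positivity)]
  calc ∑ i, ‖x i‖ ^ 2 ≤ ∑ _i : Fin d, (1 : ℝ) := by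
        refine Finset.sum_le_sum fun i _ => ?_
        have := hx i
        rw [Real.norm_of_nonneg this.1]
        exact pow_le_one₀ this.1 this.2
    _ = d := by simp
    _ ≤ (d : ℝ) ^ 2 := by
        have : d ≤ d ^ 2 := Nat.le_self_pow (by norm_num) d
        exact_mod_cast this

end UnitCube

/-! ### Disintegration of shift-invariant measures -/

section Reduce

variable {n : ℕ}

/-- Reconstruct a tuple from its first entry and the differences of the other entries. -/
def unreduce (p : E d × (Fin n → E d)) : Fin (n + 1) → E d :=
  Fin.cons p.1 fun i => p.2 i + p.1

theorem measurable_unreduce : Measurable (unreduce (d := d) (n := n)) := by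
  refine measurable_pi_lambda _ fun i => ?_
  refine Fin.cases ?_ (fun i => ?_) i
  · simpa [unreduce] using measurable_fst
  · simp only [unreduce, Fin.cons_succ]
    fun_prop

theorem measurable_diff : Measurable fun (x : Fin (n + 1) → E d) (i : Fin n) => x i.succ - x 0 :=
  measurable_pi_lambda _ fun i => by fun_prop

instance (μ : Measure (Fin (n + 1) → E d)) [SFinite μ] : SFinite (reduce μ) := by
  unfold reduce; infer_instance

/-- Substituting `x = w + z 0` in the integral over the base point turns the rebuilt tuple into
`shift w z`. Invariance of `μ` then moves the shift from the tuple to the cube indicator `q`, which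
becomes `q (z 0 - w)`. Its integral over `w` is the volume of the cube, namely one. -/
theorem map_unreduce (μ : Measure (Fin (n + 1) → E d)) [SFinite μ]
    (hμ : ∀ c, μ.map (shift c) = μ) :
    ((volume : Measure (E d)).prod (reduce μ)).map unreduce = μ := by
  ext s hs
  set q : E d → ℝ≥0∞ := (unitCube d).indicator 1 with hq
  set f : (Fin (n + 1) → E d) → ℝ≥0∞ := s.indicator 1 with hf
  have hqm : Measurable q := measurable_one.indicator (measurableSet_unitCube d)
  have hfm : Measurable f := measurable_one.indicator hs
  have hQ : MeasurableSet {x : Fin (n + 1) → E d | x 0 ∈ unitCube d} :=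
    measurable_pi_apply 0 (measurableSet_unitCube d)
  have hd : ∀ (w : E d) (z : Fin (n + 1) → E d),
      unreduce (w + z 0, fun i => z i.succ - z 0) = shift w z := by
    intro w z
    funext i
    refine Fin.cases ?_ (fun i => ?_) i
    · simp [unreduce, shift, add_comm]
    · simp only [unreduce, shift, Fin.cons_succ]
      abel
  calc ((volume : Measure (E d)).prod (reduce μ)).map unreduce s
      = ∫⁻ x, ∫⁻ y, f (unreduce (x, y)) ∂(reduce μ) := by
        rw [← lintegral_indicator_one hs, lintegral_map hfm measurable_unreduce,
          lintegral_prod (fun p => f (unreduce p)) (hfm.comp measurable_unreduce).aemeasurable]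
    _ = ∫⁻ x, ∫⁻ z : Fin (n + 1) → E d,
          q (z 0) * f (unreduce (x, fun i => z i.succ - z 0)) ∂μ := by
        refine lintegral_congr fun x => ?_
        rw [reduce, lintegral_map (f := fun y => f (unreduce (x, y)))
          (hfm.comp (measurable_unreduce.comp (by fun_prop))) measurable_diff,
          ← lintegral_indicator hQ]
        refine lintegral_congr fun z => ?_
        by_cases hz : z 0 ∈ unitCube d
        · rw [Set.indicator_of_mem (by exact hz), hq, Set.indicator_of_mem hz]
          simp
        · rw [Set.indicator_of_notMem (by exact hz), hq, Set.indicator_of_notMem hz]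
          simp
    _ = ∫⁻ z : Fin (n + 1) → E d, ∫⁻ x : E d,
          q (z 0) * f (unreduce (x, fun i => z i.succ - z 0)) ∂volume ∂μ := by
        refine lintegral_lintegral_swap (Measurable.aemeasurable ?_)
        refine Measurable.mul (hqm.comp (by fun_prop)) (hfm.comp (measurable_unreduce.comp ?_))
        fun_prop
    _ = ∫⁻ z : Fin (n + 1) → E d, ∫⁻ w : E d, q (z 0) * f (shift w z) ∂volume ∂μ := by
        refine lintegral_congr fun z => ?_
        rw [← lintegral_add_right_eq_self _ (z 0)]
        simp only [hd]
    _ = ∫⁻ w, ∫⁻ z : Fin (n + 1) → E d, q (z 0) * f (shift w z) ∂μ := by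
        refine lintegral_lintegral_swap (Measurable.aemeasurable ?_)
        refine Measurable.mul (hqm.comp (by fun_prop)) (hfm.comp ?_)
        unfold shift
        fun_prop
    _ = ∫⁻ w, ∫⁻ z : Fin (n + 1) → E d, q (z 0 - w) * f z ∂μ := by
        refine lintegral_congr fun w => ?_
        conv_rhs => rw [← hμ w]
        rw [lintegral_map (f := fun z => q (z 0 - w) * f z)
          (Measurable.mul (hqm.comp (by fun_prop)) hfm) (measurable_shift w)]
        simp [shift]
    _ = ∫⁻ z : Fin (n + 1) → E d, ∫⁻ w : E d, q (z 0 - w) * f z ∂volume ∂μ := by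
        refine lintegral_lintegral_swap (Measurable.aemeasurable ?_)
        exact Measurable.mul (hqm.comp (by fun_prop)) (hfm.comp (by fun_prop))
    _ = ∫⁻ z : Fin (n + 1) → E d, f z ∂μ := by
        refine lintegral_congr fun z => ?_
        rw [lintegral_mul_const (f := fun w => q (z 0 - w)) _ (hqm.comp (by fun_prop)), lintegral_sub_left_eq_self q, hq,
          lintegral_indicator_one (measurableSet_unitCube d), volume_unitCube, one_mul]
    _ = μ s := by rw [hf, lintegral_indicator_one hs]

theorem BoxFinite.reduce {μ : Measure (Fin (n + 1) → E d)} (h : BoxFinite μ) :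
    BoxFinite (reduce μ) := by
  intro R
  have hQ : MeasurableSet {x : Fin (n + 1) → E d | x 0 ∈ unitCube d} :=
    measurable_pi_apply 0 (measurableSet_unitCube d)
  rw [PointProcess.reduce, Measure.map_apply measurable_diff (measurableSet_box R),
    Measure.restrict_apply (measurable_diff (measurableSet_box R))]
  -- The cube lies in the ball of radius `d`. The absolute value covers a negative `R`, for which
  -- the first entry still has to lie in the larger box.
  refine (measure_mono ?_).trans_lt (h (d + |R|))
  rintro x ⟨h1, h2⟩ i -
  have h0 := unitCube_subset d h2
  rw [mem_closedBall_zero_iff] at h0 ⊢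
  refine Fin.cases ?_ (fun i => ?_) i
  · have := abs_nonneg R
    linarith
  · have h3 := h1 i (Set.mem_univ i)
    rw [mem_closedBall_zero_iff] at h3
    have : x i.succ = (x i.succ - x 0) + x 0 := by abel
    rw [this]
    have h4 := norm_add_le (x i.succ - x 0) (x 0)
    have := le_abs_self R
    linarith

end Reduce

/-! ### Products of factorial moment measures over partitions -/

section PartitionMoment

variable {Ω : Type*} [MeasurableSpace Ω] {P : Measure Ω} {η : Ω → Configuration d} {m : ℕ}

/-- Combine tuples that are indexed by the blocks of a partition. -/
def glue {d m : ℕ} (π : Finpartition (Finset.univ : Finset (Fin m)))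
    (y : (I : π.parts) → ↥I.1 → E d) : Fin m → E d :=
  fun i => y ⟨π.part i, π.part_mem.2 (Finset.mem_univ i)⟩
      ⟨i, π.mem_part_self.2 (Finset.mem_univ i)⟩

theorem glue_apply (π : Finpartition (Finset.univ : Finset (Fin m)))
    (y : (I : π.parts) → ↥I.1 → E d) (I : π.parts) (i : ↥I.1) :
    glue π y i = y I i := by
  obtain ⟨I, hI⟩ := I
  obtain ⟨i, hi⟩ := i
  have : π.part i = I := π.part_eq_of_mem hI hi
  subst this
  rfl

theorem measurable_glue (π : Finpartition (Finset.univ : Finset (Fin m))) :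
    Measurable (glue (d := d) π) :=
  measurable_pi_lambda _ fun i => by unfold glue; fun_prop

theorem partitionMoment_def (π : Finpartition (Finset.univ : Finset (Fin m))) :
    partitionMoment P η π
      = (Measure.pi fun I : π.parts => factorialMoment P η ↥I.1).map (glue π) :=
  rfl

theorem factorialMoment_sigmaFinite (hη : Measurable η) (hmom : HasAllMoments P η) (ι : Type)
    [Fintype ι] : SigmaFinite (factorialMoment P η ι) :=
  (factorialMoment_boxFinite hη hmom ι).sigmaFinite

theorem partitionMoment_boxFinite (hη : Measurable η) (hmom : HasAllMoments P η)
    (π : Finpartition (Finset.univ : Finset (Fin m))) : BoxFinite (partitionMoment P η π) := by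
  intro R
  have : ∀ I : π.parts, SigmaFinite (factorialMoment P η ↥I.1) := fun I =>
    factorialMoment_sigmaFinite hη hmom _
  rw [partitionMoment_def, Measure.map_apply (measurable_glue π) (measurableSet_box R)]
  refine (measure_mono (t := Set.univ.pi fun I : π.parts =>
    Set.univ.pi fun _ : ↥I.1 => Metric.closedBall (0 : E d) R) ?_).trans_lt ?_
  · intro y hy I _ i _
    have := hy i (Set.mem_univ _)
    rwa [glue_apply] at this
  · rw [Measure.pi_pi]
    exact ENNReal.prod_lt_top fun I _ => factorialMoment_boxFinite hη hmom _ R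

theorem partitionMoment_map_shift (hη : Measurable η) (hmom : HasAllMoments P η)
    (hstat : IsStationary P η) (π : Finpartition (Finset.univ : Finset (Fin m))) (c : E d) :
    (partitionMoment P η π).map (shift c) = partitionMoment P η π := by
  have hs : ∀ I : π.parts, SigmaFinite (factorialMoment P η ↥I.1) := fun I =>
    factorialMoment_sigmaFinite hη hmom _
  have hs' : ∀ I : π.parts, SigmaFinite
      ((factorialMoment P η ↥I.1).map (shift c)) := fun I => by
    rw [factorialMoment_map_shift hη hstat]
    exact hs I
  rw [partitionMoment_def, Measure.map_map (measurable_shift c) (measurable_glue π)]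
  have h1 : shift c ∘ glue π = glue (d := d) π ∘ fun y I => shift c (y I) := rfl
  have h2 : Measurable fun (y : (I : π.parts) → ↥I.1 → E d) I =>
      shift c (y I) :=
    measurable_pi_lambda _ fun I => (measurable_shift c).comp (measurable_pi_apply I)
  rw [h1, ← Measure.map_map (measurable_glue π) h2,
    Measure.pi_map_pi (fun I => (measurable_shift c).aemeasurable)]
  simp only [factorialMoment_map_shift hη hstat]

theorem integral_partitionMoment (hη : Measurable η) (hmom : HasAllMoments P η)
    (π : Finpartition (Finset.univ : Finset (Fin m))) (u : Fin m → E d → ℂ)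
    (hu : ∀ i, Measurable (u i)) :
    ∫ x, ∏ i, u i (x i) ∂(partitionMoment P η π)
      = ∏ I ∈ π.parts, ∫ x, ∏ i : I, u i (x i) ∂(factorialMoment P η I) := by
  have hs : ∀ I : π.parts, SigmaFinite (factorialMoment P η ↥I.1) := fun I =>
    factorialMoment_sigmaFinite hη hmom _
  have hm : Measurable fun x : Fin m → E d => ∏ i, u i (x i) :=
    Finset.measurable_prod _ fun i _ => (hu i).comp (measurable_pi_apply i)
  rw [partitionMoment_def, integral_map (measurable_glue π).aemeasurable hm.aestronglyMeasurable]
  have h1 : ∀ y : (I : π.parts) → ↥I.1 → E d, ∏ i, u i (glue π y i)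
      = ∏ I : π.parts, ∏ i : ↥I.1, u i (y I i) := by
    intro y
    have h0 : ∀ f : Fin m → ℂ, ∏ i, f i = ∏ I ∈ π.parts, ∏ i ∈ I, f i := fun f => by
      conv_lhs => rw [← π.biUnion_parts]
      exact Finset.prod_biUnion π.disjoint
    rw [h0, ← Finset.prod_coe_sort]
    refine Finset.prod_congr rfl fun I _ => ?_
    rw [← Finset.prod_coe_sort]
    refine Finset.prod_congr rfl fun i _ => ?_
    rw [glue_apply]
  simp only [h1]
  rw [integral_fintype_prod_eq_prod (f := fun (I : π.parts)
    (x : ↥I.1 → E d) => ∏ i : ↥I.1, u i (x i))]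
  exact Finset.prod_coe_sort π.parts
    (fun I => ∫ x, ∏ i : ↥I, u i (x i) ∂(factorialMoment P η ↥I))

theorem BoxFinite.sum {κ : Type*} (s : Finset κ) (μ : κ → Measure (Fin m → E d)) (c : κ → ℕ)
    (h : ∀ k ∈ s, BoxFinite (μ k)) : BoxFinite (∑ k ∈ s, c k • μ k) := by
  intro R
  rw [Measure.finsetSum_apply]
  refine ENNReal.sum_lt_top.2 fun k hk => ?_
  rw [Measure.smul_apply, nsmul_eq_mul]
  exact ENNReal.mul_lt_top (by simp) (h k hk R)

theorem map_shift_sum {κ : Type*} (s : Finset κ) (μ : κ → Measure (Fin m → E d)) (k : κ → ℕ)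
    (c : E d) (h : ∀ k, (μ k).map (shift c) = μ k) :
    (∑ i ∈ s, k i • μ i).map (shift c) = ∑ i ∈ s, k i • μ i := by
  rw [← Measure.mapₗ_apply_of_measurable (measurable_shift c), map_sum]
  refine Finset.sum_congr rfl fun i _ => ?_
  rw [map_nsmul, Measure.mapₗ_apply_of_measurable (measurable_shift c), h]

theorem cumulantPlus_boxFinite (hη : Measurable η) (hmom : HasAllMoments P η) (m : ℕ) :
    BoxFinite (cumulantPlus P η m) :=
  BoxFinite.sum _ _ _ fun π _ => partitionMoment_boxFinite hη hmom π

theorem cumulantMinus_boxFinite (hη : Measurable η) (hmom : HasAllMoments P η) (m : ℕ) :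
    BoxFinite (cumulantMinus P η m) :=
  BoxFinite.sum _ _ _ fun π _ => partitionMoment_boxFinite hη hmom π

theorem cumulantPlus_map_shift (hη : Measurable η) (hmom : HasAllMoments P η)
    (hstat : IsStationary P η) (m : ℕ) (c : E d) :
    (cumulantPlus P η m).map (shift c) = cumulantPlus P η m :=
  map_shift_sum _ _ _ c fun π => partitionMoment_map_shift hη hmom hstat π c

theorem cumulantMinus_map_shift (hη : Measurable η) (hmom : HasAllMoments P η)
    (hstat : IsStationary P η) (m : ℕ) (c : E d) :
    (cumulantMinus P η m).map (shift c) = cumulantMinus P η m :=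
  map_shift_sum _ _ _ c fun π => partitionMoment_map_shift hη hmom hstat π c

/-- This replaces the signed identity `β^! = β^!⁺ - β^!⁻`. It lets integrals against the positive
and negative cumulant terms be exchanged for integrals against the Jordan parts, which are the
measures assumed to be finite. -/
theorem reduce_add_reducedCumulantNeg (hη : Measurable η) (hmom : HasAllMoments P η) (n : ℕ) :
    reduce (cumulantPlus P η (n + 1)) + reducedCumulantNeg P η n
      = reduce (cumulantMinus P η (n + 1)) + reducedCumulantPos P η n :=
  add_sub_eq_add_sub_of_iUnion _ _
    (fun k : ℕ => Set.univ.pi fun _ => Metric.closedBall 0 (k : ℝ)) (fun _ => measurableSet_box _)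
    iUnion_box (fun k => (cumulantPlus_boxFinite hη hmom _).reduce k)
    (fun k => (cumulantMinus_boxFinite hη hmom _).reduce k)

end PartitionMoment
end PointProcess

/-! ### Test functions with bounded support -/

namespace PointProcess

/-- Bounded measurable functions with bounded support. -/
structure TestFn (d : ℕ) where
  /-- the underlying function -/
  toFun : E d → ℂ
  measurable' : Measurable toFun
  bounded' : ∃ C, ∀ x, ‖toFun x‖ ≤ C
  support' : ∃ R, ∀ x, R < ‖x‖ → toFun x = 0

namespace TestFn

variable {d : ℕ}

instance : CoeFun (TestFn d) fun _ => E d → ℂ := ⟨TestFn.toFun⟩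

@[fun_prop]
theorem measurable (u : TestFn d) : Measurable u := u.measurable'

instance : Mul (TestFn d) where
  mul u v :=
    { toFun := fun x => u x * v x
      measurable' := u.measurable.mul v.measurable
      bounded' := by
        obtain ⟨C, hC⟩ := u.bounded'
        obtain ⟨D, hD⟩ := v.bounded'
        refine ⟨C * D, fun x => ?_⟩
        rw [norm_mul]
        exact mul_le_mul (hC x) (hD x) (norm_nonneg _) ((norm_nonneg _).trans (hC x))
      support' := by
        obtain ⟨R, hR⟩ := u.support'
        exact ⟨R, fun x hx => by rw [hR x hx, zero_mul]⟩ }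

@[simp]
theorem mul_apply (u v : TestFn d) (x : E d) : (u * v) x = u x * v x := rfl

theorem exists_bound (u : TestFn d) : ∃ C, 0 ≤ C ∧ ∀ x, ‖u x‖ ≤ C := by
  obtain ⟨C, hC⟩ := u.bounded'
  exact ⟨C, (norm_nonneg _).trans (hC 0), hC⟩

theorem exists_common_bound {ι : Type*} [Finite ι] (u : ι → TestFn d) :
    ∃ C, 0 ≤ C ∧ ∀ i x, ‖u i x‖ ≤ C := by
  cases nonempty_fintype ι
  choose C hC0 hC using fun i => (u i).exists_bound
  refine ⟨∑ i, C i, Finset.sum_nonneg fun i _ => hC0 i, fun i x => (hC i x).trans ?_⟩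
  exact Finset.single_le_sum (f := C) (fun j _ => hC0 j) (Finset.mem_univ i)

theorem exists_common_support {ι : Type*} [Finite ι] (u : ι → TestFn d) :
    ∃ R, 0 ≤ R ∧ ∀ i x, R < ‖x‖ → u i x = 0 := by
  cases nonempty_fintype ι
  choose R hR using fun i => (u i).support'
  refine ⟨∑ i, |R i|, Finset.sum_nonneg fun i _ => abs_nonneg _, fun i x hx => hR i x ?_⟩
  refine lt_of_le_of_lt ((le_abs_self _).trans ?_) hx
  exact Finset.single_le_sum (f := fun i => |R i|) (fun j _ => abs_nonneg _) (Finset.mem_univ i)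

theorem integrable (u : TestFn d) : Integrable u := by
  obtain ⟨C, hC⟩ := u.bounded'
  obtain ⟨R, hR⟩ := u.support'
  have : IntegrableOn u (Metric.closedBall 0 R) :=
    Measure.integrableOn_of_bounded (M := C) (measure_closedBall_lt_top).ne
      u.measurable.aestronglyMeasurable (Eventually.of_forall hC)
  refine this.integrable_of_forall_notMem_eq_zero fun x hx => hR x ?_
  simpa using hx

/-- Tensor products of test functions. -/
def tensor {ι : Type*} [Fintype ι] (u : ι → TestFn d) (x : ι → E d) : ℂ := ∏ i, u i (x i)

theorem measurable_tensor {ι : Type*} [Fintype ι] (u : ι → TestFn d) : Measurable (tensor u) :=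
  Finset.measurable_prod _ fun i _ => (u i).measurable.comp (measurable_pi_apply i)

theorem integrable_tensor {ι : Type*} [Fintype ι] (u : ι → TestFn d) {μ : Measure (ι → E d)}
    (hμ : BoxFinite μ) : Integrable (tensor u) μ := by
  obtain ⟨C, hC0, hC⟩ := exists_common_bound u
  obtain ⟨R, hR0, hR⟩ := exists_common_support u
  have : IntegrableOn (tensor u) (Set.univ.pi fun _ => Metric.closedBall 0 R) μ := by
    refine Measure.integrableOn_of_bounded (M := ∏ _i : ι, C) (hμ R).ne
      (measurable_tensor u).aestronglyMeasurable (Eventually.of_forall fun x => ?_)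
    rw [tensor, norm_prod]
    exact Finset.prod_le_prod (fun i _ => norm_nonneg _) fun i _ => hC i _
  refine this.integrable_of_forall_notMem_eq_zero fun x hx => ?_
  simp only [Set.mem_pi, Set.mem_univ, forall_true_left, not_forall, mem_closedBall_zero_iff,
    not_le] at hx
  obtain ⟨i, hi⟩ := hx
  exact Finset.prod_eq_zero (Finset.mem_univ i) (hR i _ hi)

end TestFn

open TestFn

variable {d : ℕ}

/-! ### Sums over pairwise different points -/

section DistinctSum

/-- The sum over tuples of pairwise different points of a finite set of the products of the values
of the functions in a list. -/
noncomputable def distinctSum : Finset (E d) → List (TestFn d) → ℂ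
  | _, [] => 1
  | N, u :: l => by classical exact ∑ x ∈ N, u x * distinctSum (N.erase x) l

theorem distinctSum_cons [DecidableEq (E d)] (N : Finset (E d)) (u : TestFn d)
    (l : List (TestFn d)) :
    distinctSum N (u :: l) = ∑ x ∈ N, u x * distinctSum (N.erase x) l := by
  rw [distinctSum]
  refine Finset.sum_congr rfl fun x _ => ?_
  congr!

/-- A further point `x ∈ N` either coincides with one of the points already chosen, which multiplies
the corresponding function by `g`, or is new, which appends `g` to the list. This is the reason for
the definition of `mulStat`. -/
theorem mulStat_distinctSum (g : TestFn d) (c : ℂ) (N : Finset (E d)) (l : List (TestFn d)) :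
    mulStat g c l (distinctSum N) = ((∑ x ∈ N, g x) - c) * distinctSum N l := by
  classical
  induction l generalizing N c with
  | nil => simp [mulStat, distinctSum]
  | cons u l ih =>
    rw [mulStat, distinctSum_cons, distinctSum_cons]
    have h1 : (fun t => distinctSum N (u :: t))
        = fun t => ∑ x ∈ N, u x * distinctSum (N.erase x) t :=
      funext fun t => distinctSum_cons N u t
    rw [h1, mulStat_sum, ← Finset.sum_add_distrib, Finset.mul_sum]
    refine Finset.sum_congr rfl fun x hx => ?_
    rw [mulStat_mul, ih, ← Finset.add_sum_erase N _ hx, mul_apply]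
    ring

/-- The sum over all tuples of pairwise different points of a finite set of a tensor product. -/
noncomputable def injSum {ι : Type*} [Fintype ι] (N : Finset (E d)) (u : ι → TestFn d) : ℂ := by
  classical exact ∑ x ∈ (Fintype.piFinset fun _ : ι => N) with Function.Injective x, tensor u x

theorem injSum_equiv {ι ι' : Type*} [Fintype ι] [Fintype ι'] (e : ι ≃ ι') (N : Finset (E d))
    (u : ι' → TestFn d) : injSum N (u ∘ e) = injSum N u := by
  classical
  unfold injSum
  refine Finset.sum_bij' (fun x _ => x ∘ e.symm) (fun x _ => x ∘ e) ?_ ?_ ?_ ?_ ?_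
  · intro x hx
    simp only [Finset.mem_filter, Fintype.mem_piFinset] at hx ⊢
    exact ⟨fun i => hx.1 _, hx.2.comp e.symm.injective⟩
  · intro x hx
    simp only [Finset.mem_filter, Fintype.mem_piFinset] at hx ⊢
    exact ⟨fun i => hx.1 _, hx.2.comp e.injective⟩
  · intro x _; funext i; simp
  · intro x _; funext i; simp
  · intro x _
    simp only [tensor]
    exact Fintype.prod_equiv e _ _ fun i => by simp

theorem injSum_get (N : Finset (E d)) (l : List (TestFn d)) :
    injSum N (fun i : Fin l.length => l.get i) = distinctSum N l := by
  classical
  induction l generalizing N with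
  | nil =>
    simp [injSum, distinctSum, tensor, Finset.filter_true_of_mem, Function.injective_of_subsingleton]
  | cons u l ih =>
    rw [distinctSum_cons]
    simp only [← ih]
    unfold injSum
    simp only [Finset.mul_sum]
    rw [Finset.sum_sigma']
    symm
    refine Finset.sum_bij' (fun p _ => Fin.cons p.1 p.2)
      (fun x _ => ⟨x 0, fun i => x i.succ⟩) ?_ ?_ ?_ ?_ ?_
    · rintro ⟨x, y⟩ h
      simp only [Finset.mem_sigma, Finset.mem_filter, Fintype.mem_piFinset, Finset.mem_erase] at h ⊢
      refine ⟨fun i => ?_, ?_⟩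
      · refine Fin.cases ?_ (fun i => ?_) i
        · simpa using h.1
        · simpa using (h.2.1 i).2
      · rw [Fin.cons_injective_iff]
        refine ⟨?_, h.2.2⟩
        rintro ⟨i, hi⟩
        exact (h.2.1 i).1 hi
    · intro x h
      simp only [Finset.mem_sigma, Finset.mem_filter, Fintype.mem_piFinset, Finset.mem_erase] at h ⊢
      refine ⟨h.1 0, fun i => ⟨fun e => ?_, h.1 _⟩, fun i j hij => ?_⟩
      · exact Fin.succ_ne_zero i (h.2 e)
      · exact Fin.succ_injective _ (h.2 hij)
    · rintro ⟨x, y⟩ _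
      simp
    · intro x _
      exact Fin.cons_self_tail x
    · rintro ⟨x, y⟩ _
      simp [tensor, Fin.prod_univ_succ]

end DistinctSum

/-! ### Moments of linear statistics -/

section Moments

variable {Ω : Type*} [MeasurableSpace Ω] {P : Measure Ω} {η : Ω → Configuration d}

/-- The points of a configuration in a ball. -/
noncomputable def Configuration.window (μ : Configuration d) (R : ℝ) : Finset (E d) :=
  (μ.finite_inter (Metric.closedBall 0 R) Metric.isBounded_closedBall).toFinset

theorem Configuration.mem_window {μ : Configuration d} {R : ℝ} {x : E d} :
    x ∈ μ.window R ↔ x ∈ μ.carrier ∧ ‖x‖ ≤ R := by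
  simp [Configuration.window]

theorem integral_tensor_tupleMeasure {ι : Type} [Fintype ι] (μ : Configuration d) (u : ι → TestFn d)
    {R : ℝ} (hR : ∀ i x, R < ‖x‖ → u i x = 0) :
    ∫ x, tensor u x ∂(tupleMeasure ι μ) = injSum (μ.window R) u := by
  classical
  set N : Finset (ι → E d) :=
    (Fintype.piFinset fun _ : ι => μ.window R).filter Function.Injective with hN
  have h1 : ∫ x in (N : Set (ι → E d)), tensor u x ∂Measure.count
      = ∫ x in tupleSet ι μ, tensor u x ∂Measure.count := by
    symm
    refine setIntegral_eq_of_subset_of_forall_sdiff_eq_zero (tupleSet_measurableSet ι μ) ?_ ?_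
    · intro x hx
      simp only [hN, Finset.coe_filter, Fintype.mem_piFinset, Configuration.mem_window] at hx
      exact ⟨hx.2, fun i => (hx.1 i).1⟩
    · rintro x ⟨⟨hx1, hx2⟩, hx3⟩
      simp only [hN, Finset.coe_filter, Fintype.mem_piFinset, Configuration.mem_window] at hx3
      have : ∃ i, R < ‖x i‖ := by
        by_contra! h
        exact hx3 ⟨fun i => ⟨hx2 i, h i⟩, hx1⟩
      obtain ⟨i, hi⟩ := this
      exact Finset.prod_eq_zero (Finset.mem_univ i) (hR i _ hi)
  rw [tupleMeasure, ← h1, setIntegral_finset]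
  · rw [injSum]
    refine Finset.sum_congr (by rw [hN]) fun x _ => ?_
    rw [measureReal_def, Measure.count_singleton]
    simp
  · refine Measure.integrableOn_of_bounded (M := ∑ x ∈ N, ‖tensor u x‖) ?_
      (measurable_tensor u).aestronglyMeasurable ?_
    · rw [Measure.count_apply_finset]
      simp
    · rw [ae_restrict_iff' N.measurableSet]
      refine Eventually.of_forall fun x hx => ?_
      exact Finset.single_le_sum (f := fun x => ‖tensor u x‖) (fun _ _ => norm_nonneg _) hx

/-- The factorial moment measure is the composition of `P` with the kernel `ω ↦ tupleMeasure ι (η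
ω)`, so Campbell's formula is the integral formula for composed kernels. -/
theorem integrable_integral_tensor (hη : Measurable η) (hmom : HasAllMoments P η) {ι : Type}
    [Fintype ι] (u : ι → TestFn d) :
    Integrable (fun ω => ∫ x, tensor u x ∂(tupleMeasure ι (η ω))) P ∧
    ∫ x, tensor u x ∂(factorialMoment P η ι)
      = ∫ ω, ∫ x, tensor u x ∂(tupleMeasure ι (η ω)) ∂P := by
  let κ : Kernel Ω (ι → E d) := ⟨_, measurable_tupleMeasure_comp hη ι⟩
  have h1 : (κ ∘ₖ Kernel.const Unit P) () = factorialMoment P η ι := by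
    rw [Kernel.comp_apply, Kernel.const_apply]
    rfl
  have h2 : Integrable (tensor u) ((κ ∘ₖ Kernel.const Unit P) ()) := by
    rw [h1]
    exact integrable_tensor u (factorialMoment_boxFinite hη hmom ι)
  have h3 := h2.integral_comp
  have h4 := Kernel.integral_comp h2
  rw [Kernel.const_apply] at h3 h4
  rw [h1] at h4
  exact ⟨h3, h4⟩

theorem integral_factorialMoment_equiv (hη : Measurable η) (hmom : HasAllMoments P η)
    {ι ι' : Type} [Fintype ι] [Fintype ι'] (e : ι ≃ ι') (u : ι' → TestFn d) :
    ∫ x, tensor (u ∘ e) x ∂(factorialMoment P η ι)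
      = ∫ x, tensor u x ∂(factorialMoment P η ι') := by
  obtain ⟨R, -, hR⟩ := exists_common_support u
  rw [(integrable_integral_tensor hη hmom _).2, (integrable_integral_tensor hη hmom _).2]
  refine integral_congr_ae (Eventually.of_forall fun ω => ?_)
  simp only
  rw [integral_tensor_tupleMeasure (η ω) u hR,
    integral_tensor_tupleMeasure (η ω) (u ∘ e) fun i x hx => hR _ x hx, injSum_equiv]

/-- The sum over tuples of pairwise different points of a configuration. -/
noncomputable def tupleSum (μ : Configuration d) (l : List (TestFn d)) : ℂ :=
  ∫ x, tensor l.get x ∂(tupleMeasure (Fin l.length) μ)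

theorem tupleSum_eq_distinctSum (μ : Configuration d) (l : List (TestFn d)) {R : ℝ}
    (hR : ∀ u ∈ l, ∀ x, R < ‖x‖ → u x = 0) : tupleSum μ l = distinctSum (μ.window R) l := by
  rw [tupleSum, integral_tensor_tupleMeasure μ l.get (R := R) fun i x hx =>
    hR _ (l.get_mem i) x hx]
  exact injSum_get _ l

theorem tupleSum_singleton (μ : Configuration d) (u : TestFn d) {R : ℝ}
    (hR : ∀ x, R < ‖x‖ → u x = 0) : tupleSum μ [u] = ∑ x ∈ μ.window R, u x := by
  classical
  rw [tupleSum_eq_distinctSum μ [u] (R := R) (by simpa using hR), distinctSum_cons]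
  simp [distinctSum]

/-- Only lists built from `g` and the entries of `l` are ever evaluated. The predicate is used for a
common bound on supports, within which sums over tuples can be computed in one finite window. -/
theorem mulStat_congr {M R : Type*} [CommRing R] [Mul M] (p : M → Prop) {g : M} (hg : p g)
    (hmul : ∀ x, p x → p (g * x)) (c : R) (l : List M) (hl : ∀ x ∈ l, p x) {F F' : List M → R}
    (h : ∀ t, (∀ x ∈ t, p x) → F t = F' t) : mulStat g c l F = mulStat g c l F' := by
  induction l generalizing F F' with
  | nil => simp only [mulStat]; rw [h [g] (by simpa using hg), h [] (by simp)]
  | cons x l ih =>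
    simp only [List.mem_cons, forall_eq_or_imp] at hl
    simp only [mulStat]
    rw [h ((g * x) :: l) (by simpa using ⟨hmul x hl.1, hl.2⟩),
      ih hl.2 (F' := fun t => F' (x :: t)) (fun t ht => h _ (by simpa using ⟨hl.1, ht⟩))]

theorem mulStat_tupleSum (μ : Configuration d) (g : TestFn d) (c : ℂ) (l : List (TestFn d)) :
    mulStat g c l (tupleSum μ) = (tupleSum μ [g] - c) * tupleSum μ l := by
  obtain ⟨R, -, hR⟩ := exists_common_support (fun i : Fin (g :: l).length => (g :: l).get i)
  have hR' : ∀ u ∈ g :: l, ∀ x, R < ‖x‖ → u x = 0 := by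
    intro u hu
    obtain ⟨i, rfl⟩ := List.get_of_mem hu
    exact hR i
  simp only [List.mem_cons, forall_eq_or_imp] at hR'
  rw [mulStat_congr (fun u : TestFn d => ∀ x, R < ‖x‖ → u x = 0) hR'.1
    (fun u hu x hx => by simp [hu x hx]) c l hR'.2
    (fun t ht => tupleSum_eq_distinctSum μ t ht), mulStat_distinctSum,
    tupleSum_singleton μ g hR'.1, tupleSum_eq_distinctSum μ l hR'.2]

theorem mulStatIter_tupleSum (μ : Configuration d) (g : TestFn d) (c : ℂ) (m : ℕ)
    (l : List (TestFn d)) :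
    mulStatIter g c (tupleSum μ) m l = (tupleSum μ [g] - c) ^ m * tupleSum μ l := by
  induction m generalizing l with
  | zero => simp [mulStatIter]
  | succ m ih =>
    rw [mulStatIter, show mulStatIter g c (tupleSum μ) m
      = fun l => (tupleSum μ [g] - c) ^ m * tupleSum μ l from funext ih]
    simp only
    rw [mulStat_mul,
      mulStat_tupleSum]
    ring

theorem tupleSum_nil (μ : Configuration d) : tupleSum μ [] = 1 := by
  rw [tupleSum_eq_distinctSum μ [] (R := 0) (by simp), distinctSum]

theorem integral_mulStat {M : Type*} [Mul M] (g : M) (c : ℂ) (l : List M) {F : Ω → List M → ℂ}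
    (hF : ∀ l, Integrable (fun ω => F ω l) P) :
    Integrable (fun ω => mulStat g c l (F ω)) P ∧
      ∫ ω, mulStat g c l (F ω) ∂P = mulStat g c l fun t => ∫ ω, F ω t ∂P := by
  induction l generalizing F with
  | nil =>
    simp only [mulStat]
    refine ⟨(hF _).sub ((hF _).const_mul _), ?_⟩
    rw [integral_sub (hF _) ((hF _).const_mul _), integral_const_mul]
  | cons x l ih =>
    simp only [mulStat]
    obtain ⟨h1, h2⟩ := ih (F := fun ω t => F ω (x :: t)) (fun t => hF _)
    refine ⟨(hF _).add h1, ?_⟩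
    rw [integral_add (hF _) h1, h2]

theorem integral_mulStatIter {M : Type*} [Mul M] (g : M) (c : ℂ) (m : ℕ) {F : Ω → List M → ℂ}
    (hF : ∀ l, Integrable (fun ω => F ω l) P) (l : List M) :
    Integrable (fun ω => mulStatIter g c (F ω) m l) P ∧
      ∫ ω, mulStatIter g c (F ω) m l ∂P = mulStatIter g c (fun t => ∫ ω, F ω t ∂P) m l := by
  induction m generalizing l with
  | zero => exact ⟨hF l, rfl⟩
  | succ m ih =>
    simp only [mulStatIter]
    obtain ⟨h1, h2⟩ := integral_mulStat g c l (F := fun ω => mulStatIter g c (F ω) m)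
      fun l => (ih l).1
    refine ⟨h1, ?_⟩
    rw [h2]
    congr 1
    exact funext fun t => (ih t).2

/-- The expected sum over tuples of pairwise different points. -/
noncomputable def tupleMean (P : Measure Ω) (η : Ω → Configuration d) (l : List (TestFn d)) : ℂ :=
  ∫ x, tensor l.get x ∂(factorialMoment P η (Fin l.length))

theorem integrable_tupleSum (hη : Measurable η) (hmom : HasAllMoments P η) (l : List (TestFn d)) :
    Integrable (fun ω => tupleSum (η ω) l) P := (integrable_integral_tensor hη hmom l.get).1

theorem integral_tupleSum (hη : Measurable η) (hmom : HasAllMoments P η) (l : List (TestFn d)) :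
    ∫ ω, tupleSum (η ω) l ∂P = tupleMean P η l := (integrable_integral_tensor hη hmom l.get).2.symm

/-- Pointwise, applying `mulStat` multiplies by the centred statistic. As `mulStat` is a finite
linear expression in the values of its argument, it commutes with the expectation. -/
theorem integral_pow_tupleSum (hη : Measurable η) (hmom : HasAllMoments P η) (g : TestFn d) (c : ℂ)
    (m : ℕ) (l : List (TestFn d)) :
    Integrable (fun ω => (tupleSum (η ω) [g] - c) ^ m * tupleSum (η ω) l) P ∧
      ∫ ω, (tupleSum (η ω) [g] - c) ^ m * tupleSum (η ω) l ∂P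
        = mulStatIter g c (tupleMean P η) m l := by
  have := integral_mulStatIter (P := P) g c m (F := fun ω => tupleSum (η ω))
    (integrable_tupleSum hη hmom) l
  simp only [mulStatIter_tupleSum, integral_tupleSum hη hmom] at this
  exact this

end Moments

/-! ### Factorial cumulants and the moment-cumulant relation -/

section Cumulants

variable {Ω : Type*} [MeasurableSpace Ω] {P : Measure Ω} {η : Ω → Configuration d}

/-- The integral of a tensor product with respect to a factorial moment measure. -/
noncomputable def setMoment (P : Measure Ω) (η : Ω → Configuration d) {ι : Type} (p : ι → TestFn d)
    (I : Finset ι) : ℂ := ∫ x, tensor (fun i : I => p i) x ∂(factorialMoment P η I)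

theorem setMoment_map (hη : Measurable η) (hmom : HasAllMoments P η) {ι ι' : Type} (f : ι ↪ ι')
    (p : ι' → TestFn d) (I : Finset ι) : setMoment P η p (I.map f) = setMoment P η (p ∘ f) I := by
  let e : I ≃ (I.map f : Finset ι') := Equiv.ofBijective
    (fun i => ⟨f i, Finset.mem_map_of_mem f i.2⟩) (by
      constructor
      · intro i j h
        exact Subtype.ext (f.injective (congrArg Subtype.val h))
      · rintro ⟨j, hj⟩
        obtain ⟨i, hi, rfl⟩ := Finset.mem_map.1 hj
        exact ⟨⟨i, hi⟩, rfl⟩)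
  exact (integral_factorialMoment_equiv hη hmom e (fun i : (I.map f : Finset ι') => p i)).symm

theorem setMoment_univ (hη : Measurable η) (hmom : HasAllMoments P η) (l : List (TestFn d)) :
    setMoment P η l.get Finset.univ = tupleMean P η l := by
  let e : Fin l.length ≃ (Finset.univ : Finset (Fin l.length)) :=
    (Equiv.subtypeUnivEquiv fun i => Finset.mem_univ i).symm
  exact (integral_factorialMoment_equiv hη hmom e
    (fun i : (Finset.univ : Finset (Fin l.length)) => l.get i)).symm

theorem setMoment_empty [IsProbabilityMeasure P] (hη : Measurable η) (hmom : HasAllMoments P η)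
    {ι : Type} (p : ι → TestFn d) : setMoment P η p ∅ = 1 := by
  have h : setMoment P η p ∅ = tupleMean P η [] := by
    have h0 : IsEmpty (Fin ([] : List (TestFn d)).length) := Fin.isEmpty'
    let e : Fin ([] : List (TestFn d)).length ≃ (∅ : Finset ι) := Equiv.equivOfIsEmpty _ _
    have := integral_factorialMoment_equiv hη hmom e (fun i : (∅ : Finset ι) => p i)
    rw [setMoment, ← this, tupleMean]
    congr 2
  rw [h, ← integral_tupleSum hη hmom]
  simp [tupleSum_nil]

/-- The integral of a tensor product with respect to the factorial cumulant measure. -/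
noncomputable def cumulantMean (P : Measure Ω) (η : Ω → Configuration d) (l : List (TestFn d)) : ℂ :=
  ∫ x, tensor l.get x ∂(cumulantPlus P η l.length)
    - ∫ x, tensor l.get x ∂(cumulantMinus P η l.length)

theorem cumulantMean_eq (hη : Measurable η) (hmom : HasAllMoments P η) (l : List (TestFn d))
    (hl : l ≠ []) : cumulantMean P η l = cumulantSum (setMoment P η l.get) Finset.univ := by
  have hpart : ∀ π : Finpartition (Finset.univ : Finset (Fin l.length)),
      ∫ x, tensor l.get x ∂(partitionMoment P η π)
        = ∏ I ∈ π.parts, setMoment P η l.get I := fun π =>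
    integral_partitionMoment hη hmom π (fun i => l.get i) fun i => (l.get i).measurable
  have hsum : ∀ s : Finset (Finpartition (Finset.univ : Finset (Fin l.length))),
      ∫ x, tensor l.get x ∂(∑ π ∈ s, (π.parts.card - 1).factorial • partitionMoment P η π)
        = ∑ π ∈ s, ((π.parts.card - 1).factorial : ℂ) * ∏ I ∈ π.parts, setMoment P η l.get I := by
    intro s
    rw [integral_finsetSum_measure]
    · refine Finset.sum_congr rfl fun π _ => ?_
      rw [← Nat.cast_smul_eq_nsmul ℝ≥0∞, integral_smul_measure, hpart]
      simp
    · intro π _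
      rw [← Nat.cast_smul_eq_nsmul ℝ≥0∞]
      exact (integrable_tensor _ (partitionMoment_boxFinite hη hmom π)).smul_measure (by simp)
  rw [cumulantMean, cumulantPlus, cumulantMinus, hsum, hsum, cumulantSum, Finset.sum_filter,
    Finset.sum_filter, ← Finset.sum_sub_distrib]
  refine Finset.sum_congr rfl fun π _ => ?_
  -- For the empty list the only partition has no blocks and the truncated exponent `0 - 1` would
  -- give the wrong sign. Otherwise the parity of the number of blocks agrees with the sign
  -- `(-1)^(|π| - 1)`.
  have hpos : 1 ≤ π.parts.card := by
    refine Finset.card_pos.2 (π.parts_nonempty ?_)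
    have : 0 < l.length := List.length_pos_iff.2 hl
    exact (Finset.univ_nonempty_iff.2 ⟨⟨0, this⟩⟩).ne_empty
  obtain ⟨k, hk⟩ : ∃ k, π.parts.card = k + 1 := ⟨π.parts.card - 1, by omega⟩
  simp only [hk, Nat.add_sub_cancel]
  rcases Nat.even_or_odd k with h | h
  · have h1 : Odd (k + 1) := h.add_one
    rw [if_pos h1, if_neg (Nat.not_even_iff_odd.2 h1), h.neg_one_pow]
    ring
  · have h1 : Even (k + 1) := h.add_one
    rw [if_neg (Nat.not_odd_iff_even.2 h1), if_pos h1, h.neg_one_pow]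
    ring

/-- The embedding of the positions of a list without repetitions. -/
def posEmb {ι M : Type*} (p : ι → M) (s : List ι) (hs : s.Nodup) : Fin (s.map p).length ↪ ι :=
  ⟨fun i => s.get (i.cast (List.length_map p)), fun i j h => by
    have := (List.nodup_iff_injective_get.1 hs) h
    simpa using this⟩

theorem get_map_eq {ι M : Type*} (p : ι → M) (s : List ι) (hs : s.Nodup) :
    (s.map p).get = p ∘ posEmb p s hs := by
  funext i
  simp [posEmb]

theorem univ_map_posEmb {ι M : Type*} [DecidableEq ι] (p : ι → M) (s : List ι) (hs : s.Nodup) :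
    Finset.univ.map (posEmb p s hs) = s.toFinset := by
  ext i
  simp only [Finset.mem_map, Finset.mem_univ, true_and, List.mem_toFinset, posEmb]
  constructor
  · rintro ⟨j, rfl⟩
    exact List.get_mem _ _
  · intro h
    obtain ⟨j, rfl⟩ := List.get_of_mem h
    exact ⟨j.cast (List.length_map p).symm, rfl⟩

theorem tupleMean_map (hη : Measurable η) (hmom : HasAllMoments P η) {ι : Type} [DecidableEq ι]
    (p : ι → TestFn d) (s : List ι) (hs : s.Nodup) :
    tupleMean P η (s.map p) = setMoment P η p s.toFinset := by
  rw [← setMoment_univ hη hmom, get_map_eq p s hs, ← setMoment_map hη hmom, univ_map_posEmb]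

theorem cumulantMean_map [IsProbabilityMeasure P] (hη : Measurable η) (hmom : HasAllMoments P η)
    {ι : Type} [DecidableEq ι] (p : ι → TestFn d) (s : List ι) (hs : s.Nodup) (hne : s ≠ []) :
    cumulantMean P η (s.map p) = cumulantSum (setMoment P η p) s.toFinset := by
  rw [cumulantMean_eq hη hmom _ (by simpa using hne), ← univ_map_posEmb p s hs]
  refine (cumulantSum_map (posEmb p s hs) _ _ (setMoment_empty hη hmom _) (fun T => ?_) _ ?_).symm
  · rw [setMoment_map hη hmom, get_map_eq p s hs]
  · rw [Finset.univ_nonempty_iff]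
    refine ⟨⟨0, ?_⟩⟩
    rw [List.length_map]
    exact List.length_pos_iff.2 hne

/-- This is `cumulantSum_recursion` with the distinguished element at the head of the list. It goes
through positions instead of functions because the list may contain the same function several times.
-/
theorem tupleMean_cons [IsProbabilityMeasure P] (hη : Measurable η) (hmom : HasAllMoments P η)
    (v : TestFn d) (l : List (TestFn d)) :
    tupleMean P η (v :: l) = conv l (fun t => cumulantMean P η (v :: t)) (tupleMean P η) := by
  set p : Fin (l.length + 1) → TestFn d := (v :: l).get with hp
  set t : List (Fin (l.length + 1)) := (List.finRange l.length).map Fin.succ with ht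
  have hnd : ((0 : Fin (l.length + 1)) :: t).Nodup := by
    rw [ht, ← List.finRange_succ]
    exact List.nodup_finRange _
  obtain ⟨h0, htn⟩ := List.nodup_cons.1 hnd
  have hl : l = t.map p := by
    rw [ht, List.map_map]
    exact (List.map_get_finRange l).symm
  have hv : v = p 0 := rfl
  have hU : (Finset.univ : Finset (Fin (l.length + 1))) = insert 0 t.toFinset := by
    ext i
    simp only [Finset.mem_univ, Finset.mem_insert, List.mem_toFinset, ht, List.mem_map,
      List.mem_finRange, true_and, true_iff]
    exact (Fin.eq_zero_or_eq_succ i).imp_right fun ⟨j, hj⟩ => ⟨j, hj.symm⟩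
  have e1 : tupleMean P η (v :: l) = setMoment P η p Finset.univ :=
    (setMoment_univ hη hmom (v :: l)).symm
  have h0' : (0 : Fin (l.length + 1)) ∉ t.toFinset := by simpa using h0
  rw [e1, cumulantSum_recursion _ (setMoment_empty hη hmom p)
    (Finset.mem_univ (0 : Fin (l.length + 1))), hU, Finset.sum_filter,
    Finset.sum_powerset_insert h0']
  have hz : ∑ T ∈ t.toFinset.powerset, (if 0 ∈ T then cumulantSum (setMoment P η p) T *
      setMoment P η p (insert 0 t.toFinset \ T) else 0) = 0 := by
    refine Finset.sum_eq_zero fun T hT => ?_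
    rw [if_neg]
    exact fun h => h0' (Finset.mem_powerset.1 hT h)
  rw [hz, zero_add]
  conv_rhs => rw [hl]
  rw [conv_map, conv_congr t
    (G' := fun s => cumulantSum (setMoment P η p) (insert 0 s.toFinset))
    (H' := fun s => setMoment P η p s.toFinset),
    conv_toFinset t htn (fun T => cumulantSum (setMoment P η p) (insert 0 T)) (setMoment P η p)]
  · refine Finset.sum_congr rfl fun T hT => ?_
    rw [if_pos (Finset.mem_insert_self _ _), Finset.insert_sdiff_insert,
      Finset.sdiff_insert_of_notMem h0']
  · intro s hs
    have := cumulantMean_map hη hmom p (0 :: s) (hnd.sublist (hs.cons_cons 0)) (by simp)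
    rw [List.toFinset_cons] at this
    exact this
  · intro s hs
    exact tupleMean_map hη hmom p s (htn.sublist hs)

end Cumulants
end PointProcess

namespace PointProcess

open TestFn

variable {d : ℕ}

/-! ### Integrals against reduced cumulant measures -/

section CumulantIntegral

variable {Ω : Type*} [MeasurableSpace Ω] {P : Measure Ω} {η : Ω → Configuration d}

/-- The total variation measures of the reduced factorial cumulant measures are finite. -/
def FiniteCumulants (P : Measure Ω) (η : Ω → Configuration d) : Prop :=
  ∀ n, IsFiniteMeasure (reducedCumulantVar P η n)

theorem finiteCumulants (hη : Measurable η) (hmom : HasAllMoments P η)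
    (hβ : ∀ n : ℕ, ∫⁻ x, ENNReal.ofReal (1 + ‖x 0‖) ∂(reducedCumulantVar P η (n + 1)) < ∞) :
    FiniteCumulants P η := by
  intro n
  rcases n with _ | n
  -- The case of order one is not among the assumptions. The reduced measure then lives on a
  -- one-point space, so local finiteness suffices.
  · have h1 : reducedCumulantVar P η 0 ≤
        reduce (cumulantPlus P η 1) + reduce (cumulantMinus P η 1) :=
      add_le_add Measure.sub_le Measure.sub_le
    refine ⟨(h1 Set.univ).trans_lt ?_⟩
    have h2 : (Set.univ : Set (Fin 0 → E d)) = Set.univ.pi fun _ => Metric.closedBall 0 0 := by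
      ext x; simp
    rw [Measure.add_apply, h2]
    exact ENNReal.add_lt_top.2 ⟨(cumulantPlus_boxFinite hη hmom 1).reduce 0,
      (cumulantMinus_boxFinite hη hmom 1).reduce 0⟩
  · refine ⟨lt_of_le_of_lt ?_ (hβ n)⟩
    rw [← setLIntegral_one, Measure.restrict_univ]
    refine lintegral_mono fun x => ?_
    rw [← ENNReal.ofReal_one]
    exact ENNReal.ofReal_le_ofReal (by linarith [norm_nonneg (x 0)])

theorem FiniteCumulants.pos (h : FiniteCumulants P η) (n : ℕ) :
    IsFiniteMeasure (reducedCumulantPos P η n) :=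
  have := h n
  isFiniteMeasure_of_le (reducedCumulantVar P η n) (Measure.le_add_right le_rfl)

theorem FiniteCumulants.neg (h : FiniteCumulants P η) (n : ℕ) :
    IsFiniteMeasure (reducedCumulantNeg P η n) :=
  have := h n
  isFiniteMeasure_of_le (reducedCumulantVar P η n) (Measure.le_add_left le_rfl)

/-- The integral of a tensor product over a diagonal line. -/
noncomputable def lineIntegral {n : ℕ} (u : Fin (n + 1) → TestFn d) (y : Fin n → E d) : ℂ :=
  ∫ x, u 0 x * ∏ i : Fin n, u i.succ (y i + x)

theorem tensor_unreduce {n : ℕ} (u : Fin (n + 1) → TestFn d) (x : E d) (y : Fin n → E d) :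
    tensor u (unreduce (x, y)) = u 0 x * ∏ i : Fin n, u i.succ (y i + x) := by
  rw [tensor, Fin.prod_univ_succ]
  simp [unreduce]

/-- Both cumulant terms are Lebesgue measure times their reductions. Adding the Jordan parts on
opposite sides gives two equal product measures, and each integral is finite since the Jordan parts
are dominated by the reductions. -/
theorem integral_cumulant (hη : Measurable η) (hmom : HasAllMoments P η)
    (hstat : IsStationary P η) (hfin : FiniteCumulants P η) {n : ℕ} (u : Fin (n + 1) → TestFn d) :
    ∫ x, tensor u x ∂(cumulantPlus P η (n + 1)) - ∫ x, tensor u x ∂(cumulantMinus P η (n + 1))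
      = ∫ y, lineIntegral u y ∂(reducedCumulantPos P η n)
        - ∫ y, lineIntegral u y ∂(reducedCumulantNeg P η n) := by
  have := hfin.pos n
  have := hfin.neg n
  have hσ₁ := (cumulantPlus_boxFinite hη hmom (n + 1)).sigmaFinite
  have hσ₂ := (cumulantMinus_boxFinite hη hmom (n + 1)).sigmaFinite
  have hp := map_unreduce _ (cumulantPlus_map_shift hη hmom hstat (n + 1))
  have hm := map_unreduce _ (cumulantMinus_map_shift hη hmom hstat (n + 1))
  have ip := integrable_tensor u (cumulantPlus_boxFinite hη hmom (n + 1))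
  have im := integrable_tensor u (cumulantMinus_boxFinite hη hmom (n + 1))
  have hmeas := measurable_tensor u
  set ρ₁ := reduce (cumulantPlus P η (n + 1)) with hρ₁
  set ρ₂ := reduce (cumulantMinus P η (n + 1)) with hρ₂
  rw [← hp] at ip
  rw [← hm] at im
  rw [integrable_map_measure hmeas.aestronglyMeasurable measurable_unreduce.aemeasurable] at ip im
  have ip' : Integrable (tensor u ∘ unreduce)
      ((volume : Measure (E d)).prod (reducedCumulantPos P η n)) :=
    ip.mono_measure (Measure.prod_mono le_rfl Measure.sub_le)
  have im' : Integrable (tensor u ∘ unreduce)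
      ((volume : Measure (E d)).prod (reducedCumulantNeg P η n)) :=
    im.mono_measure (Measure.prod_mono le_rfl Measure.sub_le)
  have key : ∫ p, (tensor u ∘ unreduce) p ∂((volume : Measure (E d)).prod ρ₁)
      + ∫ p, (tensor u ∘ unreduce) p ∂((volume : Measure (E d)).prod (reducedCumulantNeg P η n))
      = ∫ p, (tensor u ∘ unreduce) p ∂((volume : Measure (E d)).prod ρ₂)
      + ∫ p, (tensor u ∘ unreduce) p
        ∂((volume : Measure (E d)).prod (reducedCumulantPos P η n)) := by
    rw [← integral_add_measure ip im', ← integral_add_measure im ip', ← Measure.prod_add,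
      ← Measure.prod_add, reduce_add_reducedCumulantNeg hη hmom n]
  have e1 : ∫ x, tensor u x ∂(cumulantPlus P η (n + 1))
      = ∫ p, (tensor u ∘ unreduce) p ∂((volume : Measure (E d)).prod ρ₁) := by
    conv_lhs => rw [← hp]
    rw [integral_map measurable_unreduce.aemeasurable hmeas.aestronglyMeasurable]
    rfl
  have e2 : ∫ x, tensor u x ∂(cumulantMinus P η (n + 1))
      = ∫ p, (tensor u ∘ unreduce) p ∂((volume : Measure (E d)).prod ρ₂) := by
    conv_lhs => rw [← hm]
    rw [integral_map measurable_unreduce.aemeasurable hmeas.aestronglyMeasurable]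
    rfl
  have e3 : ∫ y, lineIntegral u y ∂(reducedCumulantPos P η n) = ∫ p, (tensor u ∘ unreduce) p
        ∂((volume : Measure (E d)).prod (reducedCumulantPos P η n)) := by
    rw [integral_prod_symm _ ip']
    simp only [Function.comp_apply, tensor_unreduce, lineIntegral]
  have e4 : ∫ y, lineIntegral u y ∂(reducedCumulantNeg P η n) = ∫ p, (tensor u ∘ unreduce) p
        ∂((volume : Measure (E d)).prod (reducedCumulantNeg P η n)) := by
    rw [integral_prod_symm _ im']
    simp only [Function.comp_apply, tensor_unreduce, lineIntegral]
  rw [e1, e2, e3, e4]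
  linear_combination key

theorem norm_lineIntegral_le {n : ℕ} (u : Fin (n + 1) → TestFn d) (C : Fin n → ℝ)
    (hC : ∀ i x, ‖u i.succ x‖ ≤ C i) (y : Fin n → E d) :
    ‖lineIntegral u y‖ ≤ (∫ x, ‖u 0 x‖) * ∏ i, C i := by
  rw [← integral_mul_const]
  refine norm_integral_le_of_norm_le ((u 0).integrable.norm.mul_const _)
    (Eventually.of_forall fun x => ?_)
  rw [norm_mul, norm_prod]
  exact mul_le_mul_of_nonneg_left
    (Finset.prod_le_prod (fun i _ => norm_nonneg _) fun i _ => hC i _) (norm_nonneg _)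

/-- The decisive estimate: only one of the `n + 1` functions costs an `L¹` norm, all others cost a
supremum norm. The price of the correlations is the total mass of `|β^!|`, independently of the size
of the supports. -/
theorem norm_cumulant_le (hη : Measurable η) (hmom : HasAllMoments P η)
    (hstat : IsStationary P η) (hfin : FiniteCumulants P η) {n : ℕ} (u : Fin (n + 1) → TestFn d)
    (C : Fin n → ℝ) (hC : ∀ i x, ‖u i.succ x‖ ≤ C i) :
    ‖∫ x, tensor u x ∂(cumulantPlus P η (n + 1)) - ∫ x, tensor u x ∂(cumulantMinus P η (n + 1))‖
      ≤ (∫ x, ‖u 0 x‖) * (∏ i, C i) * (reducedCumulantVar P η n).real Set.univ := by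
  have := hfin.pos n
  have := hfin.neg n
  rw [integral_cumulant hη hmom hstat hfin, reducedCumulantVar, measureReal_add_apply, mul_add]
  refine (norm_sub_le _ _).trans (add_le_add ?_ ?_)
  · exact norm_integral_le_of_norm_le_const (Eventually.of_forall (norm_lineIntegral_le u C hC))
  · exact norm_integral_le_of_norm_le_const (Eventually.of_forall (norm_lineIntegral_le u C hC))

theorem norm_cumulantMean_le (hη : Measurable η) (hmom : HasAllMoments P η)
    (hstat : IsStationary P η) (hfin : FiniteCumulants P η) (v : TestFn d) (l : List (TestFn d))
    (C : Fin l.length → ℝ) (hC : ∀ i x, ‖l.get i x‖ ≤ C i) :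
    ‖cumulantMean P η (v :: l)‖
      ≤ (∫ x, ‖v x‖) * (∏ i, C i) * (reducedCumulantVar P η l.length).real Set.univ :=
  norm_cumulant_le hη hmom hstat hfin (n := l.length) (v :: l).get C hC

theorem cumulantMean_pair (hη : Measurable η) (hmom : HasAllMoments P η)
    (hstat : IsStationary P η) (hfin : FiniteCumulants P η) (u v : TestFn d) :
    cumulantMean P η [u, v]
      = ∫ y, (∫ x, u x * v (y 0 + x)) ∂(reducedCumulantPos P η 1)
        - ∫ y, (∫ x, u x * v (y 0 + x)) ∂(reducedCumulantNeg P η 1) := by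
  have := integral_cumulant hη hmom hstat hfin (n := 1) [u, v].get
  rw [cumulantMean]
  refine this.trans ?_
  have h : ∀ y : Fin 1 → E d, lineIntegral [u, v].get y = ∫ x, u x * v (y 0 + x) := by
    intro y
    rw [lineIntegral]
    simp
  simp only [h]

theorem cumulantMean_singleton [IsProbabilityMeasure P] (hη : Measurable η)
    (hmom : HasAllMoments P η) (u : TestFn d) :
    cumulantMean P η [u] = tupleMean P η [u] := by
  rw [tupleMean_cons hη hmom u []]
  simp [conv, ← integral_tupleSum hη hmom [], tupleSum_nil]

/-- The case `n = 0` of `map_unreduce`: the reduced measure sits on a single point, with mass the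
expected number of points in the unit cube. -/
theorem factorialMoment_one (hη : Measurable η) (hmom : HasAllMoments P η)
    (hstat : IsStationary P η) :
    (factorialMoment P η (Fin 1)).map (fun x => x 0)
      = ENNReal.ofReal (intensity P η) • (volume : Measure (E d)) := by
  have hσ := factorialMoment_sigmaFinite hη hmom (Fin 1)
  have h1 := map_unreduce (n := 0) (factorialMoment P η (Fin 1))
    (factorialMoment_map_shift hη hstat (Fin 1))
  have hb := (factorialMoment_boxFinite hη hmom (Fin 1)).reduce (n := 0) 0
  have hQ : MeasurableSet {x : Fin 1 → E d | x 0 ∈ unitCube d} :=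
    measurable_pi_apply 0 (measurableSet_unitCube d)
  have hu : reduce (factorialMoment P η (Fin 1)) Set.univ
      = ∫⁻ ω, ((η ω).numPts (unitCube d) : ℝ≥0∞) ∂P := by
    rw [reduce, Measure.map_apply measurable_diff MeasurableSet.univ, Set.preimage_univ,
      Measure.restrict_apply_univ, factorialMoment_def, Measure.bind_apply hQ
        (measurable_tupleMeasure_comp hη _).aemeasurable]
    refine lintegral_congr fun ω => ?_
    rw [tupleMeasure, Measure.restrict_apply hQ, Measure.count_apply
      (hQ.inter (tupleSet_measurableSet _ _)), Configuration.numPts]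
    congr 1
    have hinj : Function.Injective fun (y : E d) (_ : Fin 1) => y := fun a b h => congrFun h 0
    rw [← hinj.encard_image]
    congr 1
    ext x
    constructor
    · rintro ⟨hx1, hx2, hx3⟩
      refine ⟨x 0, ⟨hx3 0, hx1⟩, ?_⟩
      funext i
      rw [Subsingleton.elim i 0]
    · rintro ⟨y, ⟨hy1, hy2⟩, rfl⟩
      exact ⟨hy2, fun i j _ => Subsingleton.elim i j, fun _ => hy1⟩
  have hfin : reduce (factorialMoment P η (Fin 1)) Set.univ ≠ ∞ := by
    have h2 : (Set.univ : Set (Fin 0 → E d)) = Set.univ.pi fun _ => Metric.closedBall 0 0 := by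
      ext x; simp
    rw [h2]
    exact hb.ne
  have hI : reduce (factorialMoment P η (Fin 1)) Set.univ
      = ENNReal.ofReal (intensity P η) := by
    rw [intensity, ENNReal.ofReal_toReal (by rwa [← hu]), hu]
  conv_lhs => rw [← h1]
  rw [Measure.map_map (measurable_pi_apply 0) measurable_unreduce]
  have h3 : (fun x : Fin 1 → E d => x 0) ∘ unreduce = Prod.fst := by
    funext p
    simp [unreduce]
  rw [h3, Measure.map_fst_prod, hI]

theorem tupleMean_singleton (hη : Measurable η) (hmom : HasAllMoments P η)
    (hstat : IsStationary P η) (u : TestFn d) :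
    tupleMean P η [u] = intensity P η * ∫ x, u x := by
  have h1 : tupleMean P η [u] = ∫ x, u (x 0) ∂(factorialMoment P η (Fin 1)) := by
    rw [tupleMean]
    refine integral_congr_ae (Eventually.of_forall fun x => ?_)
    simp [tensor]
  have h0 : 0 ≤ intensity P η := ENNReal.toReal_nonneg
  have h2 : ∫ x, u x ∂((factorialMoment P η (Fin 1)).map fun x => x 0)
      = ∫ x, u (x 0) ∂(factorialMoment P η (Fin 1)) :=
    integral_map (measurable_pi_apply 0).aemeasurable u.measurable.aestronglyMeasurable
  rw [h1, ← h2, factorialMoment_one hη hmom hstat, integral_smul_measure,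
    ENNReal.toReal_ofReal h0]
  simp

end CumulantIntegral
end PointProcess

/-! ### Plane waves and abstract tapers -/

namespace PointProcess

open TestFn

variable {d : ℕ}

/-- The plane wave `x ↦ e^{-i⟨k,x⟩}`. -/
noncomputable def wave (k x : E d) : ℂ := Complex.exp (-Complex.I * (inner ℝ k x : ℝ))

theorem measurable_wave (k : E d) : Measurable (wave k) := by
  unfold wave
  fun_prop

@[simp]
theorem norm_wave (k x : E d) : ‖wave k x‖ = 1 := by
  rw [wave, show -Complex.I * ((inner ℝ k x : ℝ) : ℂ) = ((-(inner ℝ k x : ℝ) : ℝ) : ℂ) * Complex.I by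
    push_cast; ring, Complex.norm_exp_ofReal_mul_I]

theorem wave_add_left (k l x : E d) : wave (k + l) x = wave k x * wave l x := by
  rw [wave, wave, wave, ← Complex.exp_add, inner_add_left]
  congr 1
  push_cast
  ring

theorem wave_add_right (k x y : E d) : wave k (x + y) = wave k x * wave k y := by
  rw [wave, wave, wave, ← Complex.exp_add, inner_add_right]
  congr 1
  push_cast
  ring

@[simp]
theorem wave_zero (x : E d) : wave 0 x = 1 := by simp [wave]

theorem conj_wave (k x : E d) : starRingEnd ℂ (wave k x) = wave (-k) x := by
  rw [wave, wave, ← Complex.exp_conj]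
  congr 1
  simp

/-- The product of a test function with a trigonometric polynomial. -/
noncomputable def TestFn.trig {J : Type*} [Fintype J] (u : TestFn d) (c : J → ℂ) (k : J → E d) :
    TestFn d where
  toFun x := u x * ∑ j, c j * wave (k j) x
  measurable' := u.measurable.mul
    (Finset.measurable_sum _ fun j _ => (measurable_wave (k j)).const_mul (c j))
  bounded' := by
    obtain ⟨C, hC0, hC⟩ := u.exists_bound
    refine ⟨C * ∑ j, ‖c j‖, fun x => ?_⟩
    rw [norm_mul]
    refine mul_le_mul (hC x) ((norm_sum_le _ _).trans (Finset.sum_le_sum fun j _ => ?_))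
      (norm_nonneg _) hC0
    simp
  support' := by
    obtain ⟨R, hR⟩ := u.support'
    exact ⟨R, fun x hx => by rw [hR x hx, zero_mul]⟩

theorem TestFn.trig_apply {J : Type*} [Fintype J] (u : TestFn d) (c : J → ℂ) (k : J → E d)
    (x : E d) : u.trig c k x = u x * ∑ j, c j * wave (k j) x := rfl

/-- The product of a test function with a plane wave. -/
noncomputable def TestFn.mod (u : TestFn d) (k : E d) : TestFn d :=
  u.trig (fun _ : Unit => 1) (fun _ => k)

@[simp]
theorem TestFn.mod_apply (u : TestFn d) (k x : E d) : u.mod k x = u x * wave k x := by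
  simp [TestFn.mod, TestFn.trig_apply]

theorem TestFn.trig_eq_sum {J : Type*} [Fintype J] (u : TestFn d) (c : J → ℂ) (k : J → E d)
    (x : E d) : u.trig c k x = ∑ j, c j * u.mod (k j) x := by
  rw [TestFn.trig_apply, Finset.mul_sum]
  refine Finset.sum_congr rfl fun j _ => ?_
  rw [TestFn.mod_apply]
  ring

theorem TestFn.norm_trig_le {J : Type*} [Fintype J] (u : TestFn d) (c : J → ℂ) (k : J → E d)
    (x : E d) : ‖u.trig c k x‖ ≤ (∑ j, ‖c j‖) * ‖u x‖ := by
  rw [TestFn.trig_apply, norm_mul, mul_comm]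
  refine mul_le_mul_of_nonneg_right ((norm_sum_le _ _).trans (Finset.sum_le_sum fun j _ => ?_))
    (norm_nonneg _)
  simp

/-- Families of test functions that behave like normalized tapers. -/
structure IsNormalizedTaper {α : Type*} (l : Filter α) (U : α → TestFn d) (M₂ : ℝ) : Prop where
  exists_bound : ∃ (ε : α → ℝ) (K : ℝ), Tendsto ε l (𝓝 0) ∧ (∀ r, 0 ≤ ε r) ∧
    (∀ r x, ‖U r x‖ ≤ ε r) ∧ (∀ r, ε r * ∫ x, ‖U r x‖ ≤ K) ∧
    ∀ y, Tendsto (fun r => ε r * ∫ x, ‖U r (y + x) - U r x‖) l (𝓝 0)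
  tendsto_sq : ∀ k : E d, Tendsto (fun r => ∫ x, U r x * U r x * wave k x) l
    (𝓝 (if k = 0 then (M₂ : ℂ) else 0))

/-! ### Asymptotic covariance and the structure factor -/

section Covariance

variable {Ω : Type*} [MeasurableSpace Ω] {P : Measure Ω} {η : Ω → Configuration d}

/-- The covariance of two linear statistics in terms of the factorial cumulant measures. -/
noncomputable def statCov (P : Measure Ω) (η : Ω → Configuration d) (u v : TestFn d) : ℂ :=
  cumulantMean P η [v * u] + cumulantMean P η [u, v]

/-- Pairs of equal points contribute the diagonal term in `v * u`, pairs of different points the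
term of order two. The covariance is bilinear, without conjugation. -/
theorem statCov_eq [IsProbabilityMeasure P] (hη : Measurable η) (hmom : HasAllMoments P η)
    (u v : TestFn d) :
    statCov P η u v = ∫ ω, tupleSum (η ω) [u] * tupleSum (η ω) [v] ∂P
      - (∫ ω, tupleSum (η ω) [u] ∂P) * ∫ ω, tupleSum (η ω) [v] ∂P := by
  have h1 := (integral_pow_tupleSum (P := P) hη hmom v 0 1 [u]).2
  simp only [sub_zero, pow_one, mulStatIter, mulStat, zero_mul] at h1
  have h2 : ∀ ω, tupleSum (η ω) [u] * tupleSum (η ω) [v]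
      = tupleSum (η ω) [v] * tupleSum (η ω) [u] := fun ω => mul_comm _ _
  have h0 : tupleMean P η [] = 1 := by simp [← integral_tupleSum hη hmom, tupleSum_nil]
  simp only [h2]
  rw [h1, integral_tupleSum hη hmom, integral_tupleSum hη hmom, statCov,
    cumulantMean_singleton hη hmom, tupleMean_cons hη hmom u [v]]
  simp only [conv, h0, cumulantMean_singleton hη hmom]
  ring

theorem statCov_comm [IsProbabilityMeasure P] (hη : Measurable η) (hmom : HasAllMoments P η)
    (u v : TestFn d) : statCov P η u v = statCov P η v u := by
  rw [statCov_eq hη hmom, statCov_eq hη hmom, mul_comm (∫ ω, tupleSum (η ω) [u] ∂P)]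
  simp only [mul_comm (tupleSum (η _) [u])]

/-- For conjugate functions the bilinear covariance is `𝔼 |X - 𝔼 X|²`. -/
theorem statCov_conj [IsProbabilityMeasure P] (hη : Measurable η) (hmom : HasAllMoments P η)
    (u v : TestFn d) (huv : ∀ x, u x = starRingEnd ℂ (v x)) :
    (statCov P η u v).im = 0 ∧ 0 ≤ (statCov P η u v).re := by
  have hc : ∀ ω, tupleSum (η ω) [u] = starRingEnd ℂ (tupleSum (η ω) [v]) := by
    intro ω
    rw [tupleSum, tupleSum, ← integral_conj]
    refine integral_congr_ae (Eventually.of_forall fun x => ?_)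
    simp [tensor, huv]
  have hi := integrable_tupleSum hη hmom [v]
  have h2 : Integrable (fun ω => tupleSum (η ω) [u] * tupleSum (η ω) [v]) P := by
    have := (integral_pow_tupleSum (P := P) hη hmom u 0 1 [v]).1
    simpa using this
  set X : Ω → ℂ := fun ω => tupleSum (η ω) [v] with hX
  set m : ℂ := ∫ ω, X ω ∂P with hm
  have key : statCov P η u v = ((∫ ω, ‖X ω - m‖ ^ 2 ∂P : ℝ) : ℂ) := by
    have e1 : ∀ ω, ((‖X ω - m‖ ^ 2 : ℝ) : ℂ) = tupleSum (η ω) [u] * tupleSum (η ω) [v]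
        - m * starRingEnd ℂ (X ω) - starRingEnd ℂ m * X ω + starRingEnd ℂ m * m := by
      intro ω
      rw [hc, ← Complex.normSq_eq_norm_sq, Complex.normSq_eq_conj_mul_self, map_sub]
      simp only [hX]
      ring
    have hic : Integrable (fun ω => starRingEnd ℂ (X ω)) P := by
      have := integrable_tupleSum (P := P) hη hmom [u]
      simpa only [hc] using this
    rw [← integral_complex_ofReal]
    simp only [e1]
    have i1 : Integrable (fun ω => tupleSum (η ω) [u] * tupleSum (η ω) [v]
        - m * starRingEnd ℂ (X ω)) P := h2.sub (hic.const_mul m)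
    have i2 : Integrable (fun ω => tupleSum (η ω) [u] * tupleSum (η ω) [v]
        - m * starRingEnd ℂ (X ω) - starRingEnd ℂ m * X ω) P := i1.sub (hi.const_mul _)
    rw [integral_add i2 (integrable_const _), integral_sub i1 (hi.const_mul _),
      integral_sub h2 (hic.const_mul m), integral_const_mul, integral_const_mul, integral_conj,
      statCov_eq hη hmom]
    simp only [hc, integral_conj, integral_const, probReal_univ, one_smul]
    simp only [hX]
    ring
  rw [key]
  refine ⟨Complex.ofReal_im _, ?_⟩
  rw [Complex.ofReal_re]
  exact integral_nonneg fun ω => by positivity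

theorem integral_double_sum {α J : Type*} [MeasurableSpace α] {μ : Measure α} [Fintype J]
    (f : α → ℂ) (a : J → J → ℂ) (F : J → J → α → ℂ) (hF : ∀ i j, Integrable (F i j) μ)
    (h : ∀ x, f x = ∑ i, ∑ j, a i j * F i j x) :
    ∫ x, f x ∂μ = ∑ i, ∑ j, a i j * ∫ x, F i j x ∂μ := by
  simp only [h]
  rw [integral_finsetSum]
  · refine Finset.sum_congr rfl fun i _ => ?_
    rw [integral_finsetSum _ fun j _ => (hF i j).const_mul _]
    simp only [integral_const_mul]
  · intro i _
    exact integrable_finsetSum _ fun j _ => (hF i j).const_mul _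

theorem statCov_trig (hη : Measurable η) (hmom : HasAllMoments P η) (u : TestFn d)
    {J : Type*} [Fintype J] (c : J → ℂ) (k : J → E d) :
    statCov P η (u.trig c k) (u.trig c k)
      = ∑ i, ∑ j, c i * c j * statCov P η (u.mod (k i)) (u.mod (k j)) := by
  have h1 : ∀ μ : Measure (Fin 1 → E d), BoxFinite μ →
      ∫ x, tensor [u.trig c k * u.trig c k].get x ∂μ
        = ∑ i, ∑ j, c i * c j * ∫ x, tensor [u.mod (k j) * u.mod (k i)].get x ∂μ := by
    intro μ hμ
    refine integral_double_sum _ _ _ (fun i j => integrable_tensor _ hμ) fun x => ?_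
    simp only [tensor, List.length_cons, List.length_nil, Nat.reduceAdd, List.get_eq_getElem,
      Finset.univ_unique, Finset.prod_singleton, Fin.default_eq_zero, Fin.val_zero,
      List.getElem_cons_zero, TestFn.mul_apply, TestFn.trig_eq_sum u c k, Finset.sum_mul_sum]
    refine Finset.sum_congr rfl fun i _ => Finset.sum_congr rfl fun j _ => ?_
    ring
  have h2 : ∀ μ : Measure (Fin 2 → E d), BoxFinite μ →
      ∫ x, tensor [u.trig c k, u.trig c k].get x ∂μ
        = ∑ i, ∑ j, c i * c j * ∫ x, tensor [u.mod (k i), u.mod (k j)].get x ∂μ := by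
    intro μ hμ
    refine integral_double_sum _ _ _ (fun i j => integrable_tensor _ hμ) fun x => ?_
    have ht : ∀ (v w : TestFn d) (x : Fin 2 → E d), tensor [v, w].get x = v (x 0) * w (x 1) :=
      fun v w x => Fin.prod_univ_two _
    rw [ht, TestFn.trig_eq_sum u c k, TestFn.trig_eq_sum u c k, Finset.sum_mul_sum]
    refine Finset.sum_congr rfl fun i _ => Finset.sum_congr rfl fun j _ => ?_
    rw [ht]
    ring
  simp only [statCov, cumulantMean, List.length_cons, List.length_nil, Nat.reduceAdd,
    h1 _ (cumulantPlus_boxFinite hη hmom 1), h1 _ (cumulantMinus_boxFinite hη hmom 1),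
    h2 _ (cumulantPlus_boxFinite hη hmom 2), h2 _ (cumulantMinus_boxFinite hη hmom 2)]
  simp only [mul_add, mul_sub, Finset.sum_add_distrib, Finset.sum_sub_distrib]

/-- Replacing `U r (y + x)` by `U r x` costs at most `ε r * ∫ ‖U r (y + x) - U r x‖`, which tends to
zero. What remains is the squared taper against a wave with vector `k + k'`, times the phase of the
displacement `y`. -/
theorem tendsto_lineIntegral {α : Type*} {l : Filter α} {U : α → TestFn d} {M₂ : ℝ}
    (hU : IsNormalizedTaper l U M₂) (k k' y : E d) :
    Tendsto (fun r => ∫ x, (U r).mod k x * (U r).mod k' (y + x)) l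
      (𝓝 (wave k' y * (if k + k' = 0 then (M₂ : ℂ) else 0))) := by
  obtain ⟨ε, K, hε, hε0, hb, hK, hs⟩ := hU.exists_bound
  have h1 := (hU.tendsto_sq (k + k')).const_mul (wave k' y)
  refine (tendsto_iff_of_dist ?_).1 h1
  refine squeeze_zero (fun _ => dist_nonneg) (fun r => ?_) (hs y)
  have iU := (U r).integrable
  have iV : Integrable (fun x => U r (y + x)) := iU.comp_add_left y
  have i0 : Integrable (fun x => wave k' y * (U r x * U r x * wave (k + k') x)) := by
    have := ((U r) * (U r)).integrable
    have h2 : Integrable fun x => (U r x * U r x) * wave (k + k') x := by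
      refine this.mul_bdd (c := 1) (measurable_wave _).aestronglyMeasurable ?_
      exact Eventually.of_forall fun x => by simp
    exact h2.const_mul _
  have i1 : Integrable (fun x => (U r).mod k x * (U r).mod k' (y + x)) := by
    refine ((U r).mod k).integrable.mul_bdd (c := ε r) ?_ ?_
    · exact (((U r).mod k').measurable.comp (measurable_const_add y)).aestronglyMeasurable
    · refine Eventually.of_forall fun x => ?_
      rw [TestFn.mod_apply, norm_mul, norm_wave, mul_one]
      exact hb r _
  rw [dist_eq_norm, ← integral_const_mul, ← integral_sub i0 i1, ← integral_const_mul]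
  refine norm_integral_le_of_norm_le ((iV.sub iU).norm.const_mul _)
    (Eventually.of_forall fun x => ?_)
  have e : wave k' y * (U r x * U r x * wave (k + k') x)
      - (U r).mod k x * (U r).mod k' (y + x)
      = wave k' y * wave (k + k') x * (U r x * (U r x - U r (y + x))) := by
    simp only [TestFn.mod_apply, wave_add_left, wave_add_right]
    ring
  rw [e, norm_mul, norm_mul, norm_wave, norm_wave, one_mul, one_mul, norm_mul, norm_sub_rev]
  exact mul_le_mul_of_nonneg_right (hb r x) (norm_nonneg _)

theorem norm_lineIntegral_mod_le {U : TestFn d} {ε K : ℝ}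
    (hb : ∀ x, ‖U x‖ ≤ ε) (hK : ε * ∫ x, ‖U x‖ ≤ K) (k k' y : E d) :
    ‖∫ x, U.mod k x * U.mod k' (y + x)‖ ≤ K := by
  refine le_trans ?_ hK
  rw [← integral_const_mul]
  refine norm_integral_le_of_norm_le (U.integrable.norm.const_mul _)
    (Eventually.of_forall fun x => ?_)
  rw [norm_mul, TestFn.mod_apply, TestFn.mod_apply, norm_mul, norm_mul, norm_wave, norm_wave,
    mul_one, mul_one, mul_comm]
  exact mul_le_mul_of_nonneg_right (hb _) (norm_nonneg _)

/-- The diagonal term gives the summand `1` of the structure factor. The term of order two gives the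
Fourier integral of `β^!_2`, by dominated convergence with the constant bound `K`, integrable
because the Jordan parts are finite. -/
theorem tendsto_statCov [IsProbabilityMeasure P] (hη : Measurable η) (hmom : HasAllMoments P η)
    (hstat : IsStationary P η) (hfin : FiniteCumulants P η) (hγ : 0 < intensity P η) {α : Type*}
    {l : Filter α} [l.IsCountablyGenerated] {U : α → TestFn d} {M₂ : ℝ}
    (hU : IsNormalizedTaper l U M₂) (k k' : E d) :
    Tendsto (fun r => statCov P η ((U r).mod k) ((U r).mod k')) l
      (𝓝 (if k + k' = 0 then (intensity P η : ℂ) * M₂ * structureFactor P η k' else 0)) := by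
  obtain ⟨ε, K, hε, hε0, hb, hK, hs⟩ := hU.exists_bound
  have hp := hfin.pos 1
  have hn := hfin.neg 1
  set L : ℂ := if k + k' = 0 then (M₂ : ℂ) else 0 with hL
  have h1 : Tendsto (fun r => cumulantMean P η [(U r).mod k' * (U r).mod k]) l
      (𝓝 ((intensity P η : ℂ) * L)) := by
    have : ∀ r, cumulantMean P η [(U r).mod k' * (U r).mod k]
        = (intensity P η : ℂ) * ∫ x, U r x * U r x * wave (k + k') x := by
      intro r
      rw [cumulantMean_singleton hη hmom, tupleMean_singleton hη hmom hstat]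
      congr 1
      refine integral_congr_ae (Eventually.of_forall fun x => ?_)
      simp only [TestFn.mul_apply, TestFn.mod_apply, wave_add_left]
      ring
    simp only [this]
    exact (hU.tendsto_sq _).const_mul _
  have h2 : ∀ μ : Measure (Fin 1 → E d), IsFiniteMeasure μ →
      Tendsto (fun r => ∫ y, (∫ x, (U r).mod k x * (U r).mod k' (y 0 + x)) ∂μ) l
        (𝓝 (∫ y, wave k' (y 0) * L ∂μ)) := by
    intro μ hμ
    refine tendsto_integral_filter_of_dominated_convergence (fun _ => K) ?_ ?_
      (integrable_const _) ?_
    · refine Eventually.of_forall fun r => ?_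
      refine StronglyMeasurable.aestronglyMeasurable ?_
      refine StronglyMeasurable.integral_prod_right
        (f := fun (y : Fin 1 → E d) x => (U r).mod k x * (U r).mod k' (y 0 + x)) ?_
      refine Measurable.stronglyMeasurable ?_
      exact (((U r).mod k).measurable.comp measurable_snd).mul
        (((U r).mod k').measurable.comp (by fun_prop))
    · exact Eventually.of_forall fun r => Eventually.of_forall fun y =>
        norm_lineIntegral_mod_le (hb r) (hK r) k k' (y 0)
    · exact Eventually.of_forall fun y => tendsto_lineIntegral hU k k' (y 0)
  have h3 := h1.add ((h2 _ hp).sub (h2 _ hn))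
  simp only [integral_mul_const, ← sub_mul] at h3
  have hγ' : (intensity P η : ℂ) ≠ 0 := by exact_mod_cast hγ.ne'
  have e : (if k + k' = 0 then (intensity P η : ℂ) * M₂ * structureFactor P η k' else 0)
      = (intensity P η : ℂ) * L + (∫ y, wave k' (y 0) ∂(reducedCumulantPos P η 1)
        - ∫ y, wave k' (y 0) ∂(reducedCumulantNeg P η 1)) * L := by
    rw [hL]
    split_ifs
    · rw [structureFactor]
      simp only [wave]
      field_simp
    · simp
  rw [e]
  simp only [statCov, cumulantMean_pair hη hmom hstat hfin]
  exact h3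

end Covariance
end PointProcess

namespace PointProcess

open TestFn

/-! ### Vanishing of the cumulants of order at least three -/

section Vanishing

variable {M : Type*} [Mul M]

/-- The powers `g, g * g, g * (g * g), …`. -/
def succPow (g : M) : ℕ → M
  | 0 => g
  | p + 1 => g * succPow g p

/-- Since the entry `p` stands for `g^(p+1)`, the number `s.sum + s.length` is the total degree in
`g`. Each term of `mulStat` with `c = 0` has degree one higher, whether `g` is merged or appended.
-/
theorem tendsto_mulStat_zero {α : Type*} {l : Filter α} {g : α → M} {F : α → List M → ℂ} {W : ℕ}
    (hF : ∀ s : List ℕ, W + 1 ≤ s.sum + s.length →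
      Tendsto (fun r => F r (s.map (succPow (g r)))) l (𝓝 0))
    (s : List ℕ) (hs : W ≤ s.sum + s.length) :
    Tendsto (fun r => mulStat (g r) 0 (s.map (succPow (g r))) (F r)) l (𝓝 0) := by
  induction s generalizing F W with
  | nil =>
    simpa [mulStat, succPow] using hF [0] (by simpa using hs)
  | cons x s ih =>
    simp only [List.sum_cons, List.length_cons] at hs
    have h1 := hF ((x + 1) :: s) (by simp only [List.sum_cons, List.length_cons]; omega)
    have h2 := ih (F := fun r t => F r (succPow (g r) x :: t)) (W := W - (x + 1))
      (fun t ht => hF (x :: t) (by simp only [List.sum_cons, List.length_cons]; omega)) (by omega)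
    simpa [mulStat, succPow] using h1.add h2

theorem tendsto_mulStatIter_zero {α : Type*} {l : Filter α} {g : α → M} {F : α → List M → ℂ}
    (j : ℕ) {W : ℕ} (hF : ∀ s : List ℕ, W + j ≤ s.sum + s.length →
      Tendsto (fun r => F r (s.map (succPow (g r)))) l (𝓝 0))
    (s : List ℕ) (hs : W ≤ s.sum + s.length) :
    Tendsto (fun r => mulStatIter (g r) 0 (F r) j (s.map (succPow (g r)))) l (𝓝 0) := by
  induction j generalizing W s with
  | zero => exact hF s hs
  | succ j ih =>
    refine tendsto_mulStat_zero (F := fun r => mulStatIter (g r) 0 (F r) j) (W := W)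
      (fun t ht => ih (fun v hv => hF v (by omega)) t ht) s hs

end Vanishing

variable {d : ℕ}

theorem TestFn.norm_succPow_le (g : TestFn d) {δ : ℝ} (hδ : ∀ x, ‖g x‖ ≤ δ) (p : ℕ) (x : E d) :
    ‖succPow g p x‖ ≤ δ ^ p * ‖g x‖ := by
  induction p with
  | zero => simp [succPow]
  | succ p ih =>
    rw [succPow, TestFn.mul_apply, norm_mul, pow_succ']
    have h0 : 0 ≤ δ := (norm_nonneg _).trans (hδ x)
    calc ‖g x‖ * ‖succPow g p x‖ ≤ δ * (δ ^ p * ‖g x‖) :=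
          mul_le_mul (hδ x) ih (norm_nonneg _) h0
      _ = δ * δ ^ p * ‖g x‖ := by ring

variable {Ω : Type*} [MeasurableSpace Ω] {P : Measure Ω} {η : Ω → Configuration d}

/-- In total degree `D`, one factor `g` is spent on the `L¹` norm and one `δ` on compensating it
through `δ * ‖g‖₁ ≤ K`. This leaves `δ^(D-2)`, which tends to zero once `D ≥ 3`. -/
theorem tendsto_cumulantMean_succPow (hη : Measurable η) (hmom : HasAllMoments P η)
    (hstat : IsStationary P η) (hfin : FiniteCumulants P η) {α : Type*} {l : Filter α}
    {g : α → TestFn d} {δ : α → ℝ} {K : ℝ} (hδ : Tendsto δ l (𝓝 0)) (hδ0 : ∀ r, 0 ≤ δ r)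
    (hb : ∀ r x, ‖g r x‖ ≤ δ r) (hK : ∀ r, δ r * ∫ x, ‖g r x‖ ≤ K) (s : List ℕ)
    (hs : 3 ≤ s.sum + s.length) :
    Tendsto (fun r => cumulantMean P η (s.map (succPow (g r)))) l (𝓝 0) := by
  rcases s with _ | ⟨x, s⟩
  · simp at hs
  simp only [List.sum_cons, List.length_cons] at hs
  set V : ℝ := (reducedCumulantVar P η s.length).real Set.univ with hV
  have hprod : ∀ r (s : List ℕ),
      ∏ i : Fin (s.map (succPow (g r))).length, δ r ^ (s.get (i.cast (by simp)) + 1)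
        = δ r ^ (s.sum + s.length) := by
    intro r s
    rw [Finset.prod_pow_eq_pow_sum]
    congr 1
    rw [Finset.sum_add_distrib]
    simp only [Finset.sum_const, Finset.card_univ, Fintype.card_fin, List.length_map, smul_eq_mul,
      mul_one]
    congr 1
    rw [← Fin.sum_univ_getElem s]
    exact Fintype.sum_equiv (finCongr (by simp)) _ _ fun i => rfl
  have h1 : ∀ r, ‖cumulantMean P η ((x :: s).map (succPow (g r)))‖
      ≤ δ r ^ (x + s.sum + s.length - 1) * (K * V) := by
    intro r
    have h2 := norm_cumulantMean_le hη hmom hstat hfin (succPow (g r) x) (s.map (succPow (g r)))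
      (fun i => δ r ^ (s.get (i.cast (by simp)) + 1)) (fun i y => by
        simp only [List.get_eq_getElem, List.getElem_map, Fin.val_cast]
        refine ((g r).norm_succPow_le (hb r) _ y).trans ?_
        rw [pow_succ]
        exact mul_le_mul_of_nonneg_left (hb r y) (pow_nonneg (hδ0 r) _))
    rw [hprod, List.length_map] at h2
    refine h2.trans ?_
    rw [← hV]
    have h3 : ∫ y, ‖succPow (g r) x y‖ ≤ δ r ^ x * ∫ y, ‖g r y‖ := by
      rw [← integral_const_mul]
      exact integral_mono (succPow (g r) x).integrable.norm ((g r).integrable.norm.const_mul _)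
        fun y => (g r).norm_succPow_le (hb r) x y
    have h4 : x + s.sum + s.length - 1 + 1 = x + (s.sum + s.length) := by omega
    calc (∫ y, ‖succPow (g r) x y‖) * δ r ^ (s.sum + s.length) * V
        ≤ (δ r ^ x * ∫ y, ‖g r y‖) * δ r ^ (s.sum + s.length) * V := by
          refine mul_le_mul_of_nonneg_right (mul_le_mul_of_nonneg_right h3 ?_) measureReal_nonneg
          exact pow_nonneg (hδ0 r) _
      _ = δ r ^ (x + (s.sum + s.length)) * (∫ y, ‖g r y‖) * V := by rw [pow_add]; ring
      _ = δ r ^ (x + s.sum + s.length - 1) * ((δ r * ∫ y, ‖g r y‖) * V) := by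
          rw [← h4, pow_succ]; ring
      _ ≤ _ := mul_le_mul_of_nonneg_left
          (mul_le_mul_of_nonneg_right (hK r) measureReal_nonneg) (pow_nonneg (hδ0 r) _)
  refine squeeze_zero_norm h1 ?_
  have := (hδ.pow (x + s.sum + s.length - 1)).mul_const (K * V)
  rwa [zero_pow (by omega), zero_mul] at this

theorem tupleSum_im_eq_zero (μ : Configuration d) (g : TestFn d) (hg : ∀ x, (g x).im = 0) :
    (tupleSum μ [g]).im = 0 := by
  rw [← Complex.conj_eq_iff_im, tupleSum, ← integral_conj]
  refine integral_congr_ae (Eventually.of_forall fun x => ?_)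
  simp [tensor, Complex.conj_eq_iff_im.2 (hg _)]

/-- The central limit theorem for one real linear statistic. The expectation may differ from the
centring `c r` by an error that tends to zero; this difference plays the role of the first cumulant.
-/
theorem tendsto_integral_exp_tupleSum [IsProbabilityMeasure P] (hη : Measurable η)
    (hmom : HasAllMoments P η) (hstat : IsStationary P η) (hfin : FiniteCumulants P η)
    {α : Type*} {l : Filter α} {g : α → TestFn d} {δ : α → ℝ} {K : ℝ}
    (hδ : Tendsto δ l (𝓝 0)) (hδ0 : ∀ r, 0 ≤ δ r)
    (hb : ∀ r x, ‖g r x‖ ≤ δ r) (hK : ∀ r, δ r * ∫ x, ‖g r x‖ ≤ K)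
    (hg : ∀ r x, (g r x).im = 0) (c : α → ℝ)
    (hc : Tendsto (fun r => (intensity P η : ℂ) * (∫ x, g r x) - c r) l (𝓝 0)) (s : ℝ)
    (hs : Tendsto (fun r => statCov P η (g r) (g r)) l (𝓝 (s : ℂ))) :
    Tendsto (fun r => ∫ ω, Complex.exp (Complex.I * ((tupleSum (η ω) [g r] - c r).re : ℝ)) ∂P) l
      (𝓝 (Complex.exp (-s / 2))) := by
  have hre : ∀ r ω, (((tupleSum (η ω) [g r] - c r).re : ℝ) : ℂ) = tupleSum (η ω) [g r] - c r := by
    intro r ω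
    apply Complex.ext <;> simp [tupleSum_im_eq_zero _ _ (hg r)]
  have h1 := fun r n => integral_pow_tupleSum (P := P) hη hmom (g r) (c r) n []
  simp only [tupleSum_nil, mul_one] at h1
  refine tendsto_integral_exp_of_moment _ s (fun r n => ?_) fun n => ?_
  · have := (h1 r n).1.re
    refine this.congr (Eventually.of_forall fun ω => ?_)
    change ((tupleSum (η ω) [g r] - c r) ^ n).re = _
    rw [← hre, ← Complex.ofReal_pow, Complex.ofReal_re]
  have h2 : ∀ r, ((∫ ω, (tupleSum (η ω) [g r] - c r).re ^ n ∂P : ℝ) : ℂ)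
      = mulStatIter (g r) (c r : ℂ) (tupleMean P η) n [] := by
    intro r
    rw [← (h1 r n).2, ← integral_complex_ofReal]
    simp only [Complex.ofReal_pow, hre]
  simp only [h2]
  refine tendsto_moment_of_cumulant (fun r n => mulStatIter (g r) (c r : ℂ) (tupleMean P η) n [])
    (fun r j => mulStatIter (g r) 0 (cumulantMean P η) j [g r] - if j = 0 then (c r : ℂ) else 0)
    s (fun r => ?_) (fun r n => ?_) (fun j => ?_) n
  · rw [← (h1 r 0).2]
    simp
  · rw [mulStatIter_succ_nil (g r) (c r : ℂ) (tupleMean_cons hη hmom) n]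
    simp only [sub_mul, mul_sub, Finset.sum_sub_distrib]
    congr 1
    -- The centring enters the recursion only through the first cumulant, which has the binomial
    -- coefficient `C(n,0) = 1`.
    rw [Finset.sum_eq_single (0, n)]
    · simp
    · rintro ⟨p, q⟩ hp hne
      have : p ≠ 0 := by
        rintro rfl
        simp only [Finset.HasAntidiagonal.mem_antidiagonal, zero_add] at hp
        exact hne (by rw [hp])
      simp [this]
    · intro h
      simp [Finset.HasAntidiagonal.mem_antidiagonal] at h
  -- Order one is the centred mean and order two the covariance. For order `j + 3`, starting from
  -- the degree one of `[g]`, `j + 2` multiplications reach total degree at least three.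
  · rcases j with _ | _ | j
    · simpa [mulStatIter, cumulantMean_singleton hη hmom, tupleMean_singleton hη hmom hstat] using hc
    · simpa [mulStatIter, mulStat, statCov] using hs
    · have := tendsto_mulStatIter_zero (l := l) (g := g) (F := fun _ => cumulantMean P η) (j + 2)
        (W := 1) (fun t ht => tendsto_cumulantMean_succPow hη hmom hstat hfin hδ hδ0 hb hK t
          (by omega)) [0] (by simp)
      simpa [succPow] using this

end PointProcess

/-! ### The rescaled taper and its truncation -/

namespace PointProcess

open TestFn

variable {d : ℕ} {h : E d → ℝ} {A : Set (E d)}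

/-- The rescaled taper `r^{-d/2} h(x/r)`. -/
noncomputable def scaledTaper (h : E d → ℝ) (r : ℝ) (x : E d) : ℝ :=
  (r ^ ((d : ℝ) / 2))⁻¹ * h (r⁻¹ • x)

theorem integral_comp_inv_smul_of_pos {r : ℝ} (hr : 0 < r) (F : E d → ℝ) :
    ∫ x, F (r⁻¹ • x) = r ^ d * ∫ x, F x := by
  rw [Measure.integral_comp_inv_smul, finrank_euclideanSpace_fin, abs_of_pos (pow_pos hr d),
    smul_eq_mul]

theorem rpow_half_mul_self {r : ℝ} (hr : 0 < r) :
    r ^ ((d : ℝ) / 2) * r ^ ((d : ℝ) / 2) = r ^ d := by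
  rw [← Real.rpow_add hr, add_halves, Real.rpow_natCast]

theorem rpow_half_inv_mul {r : ℝ} (hr : 0 < r) :
    (r ^ ((d : ℝ) / 2))⁻¹ * r ^ d = r ^ ((d : ℝ) / 2) := by
  rw [← rpow_half_mul_self hr, inv_mul_cancel_left₀ (Real.rpow_pos_of_pos hr _).ne']

theorem tendsto_rpow_half_inv (hd : 1 ≤ d) :
    Tendsto (fun r : ℝ => (r ^ ((d : ℝ) / 2))⁻¹) atTop (𝓝 0) := by
  refine (tendsto_rpow_atTop ?_).inv_tendsto_atTop
  have : (1 : ℝ) ≤ d := by exact_mod_cast hd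
  positivity

namespace IsTaper

theorem scaledTaper_nonneg (hA : IsTaper h A) {r : ℝ} (hr : 0 < r) (x : E d) :
    0 ≤ scaledTaper h r x :=
  mul_nonneg (inv_nonneg.2 (Real.rpow_nonneg hr.le _)) (hA.nonneg _)

theorem measurable_scaledTaper (hA : IsTaper h A) (r : ℝ) : Measurable (scaledTaper h r) :=
  (hA.measurable.comp (measurable_const_smul _)).const_mul _

theorem integrable_scaledTaper (hA : IsTaper h A) {r : ℝ} (hr : 0 < r) :
    Integrable (scaledTaper h r) :=
  (hA.integrable.comp_smul (inv_ne_zero hr.ne')).const_mul _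

theorem integral_scaledTaper {r : ℝ} (hr : 0 < r) (h : E d → ℝ) :
    ∫ x, scaledTaper h r x = r ^ ((d : ℝ) / 2) * ∫ x, h x := by
  simp only [scaledTaper]
  rw [integral_const_mul, integral_comp_inv_smul_of_pos hr, ← mul_assoc, rpow_half_inv_mul hr]

theorem exists_tail_le (hA : IsTaper h A) {δ : ℝ} (hδ : 0 < δ) :
    ∃ R : ℝ, ∫ x, {x | R < ‖x‖}.indicator h x ≤ δ := by
  have h1 : Tendsto (fun n : ℕ => ∫ x, {x : E d | (n : ℝ) < ‖x‖}.indicator h x) atTop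
      (𝓝 (∫ _, (0 : ℝ) ∂(volume : Measure (E d)))) := by
    refine tendsto_integral_of_dominated_convergence h (fun n => ?_) hA.integrable (fun n => ?_) ?_
    · exact (hA.measurable.indicator (measurableSet_lt measurable_const measurable_norm)).aestronglyMeasurable
    · refine Eventually.of_forall fun x => ?_
      rw [Real.norm_eq_abs, abs_of_nonneg (Set.indicator_nonneg (fun x _ => hA.nonneg x) x)]
      exact Set.indicator_le_self' (fun _ _ => hA.nonneg _) x
    · refine Eventually.of_forall fun x => tendsto_const_nhds.congr' ?_
      filter_upwards [eventually_ge_atTop ⌈‖x‖⌉₊] with n hn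
      rw [Set.indicator_of_notMem]
      simpa using Nat.ceil_le.1 hn
  rw [integral_zero] at h1
  obtain ⟨n, hn⟩ := (h1.eventually (eventually_le_nhds hδ)).exists
  exact ⟨n, hn⟩

/-- The taper `h` is only integrable, so it is cut off at a radius depending on `r`. Rescaling
multiplies `L¹` norms by `r^{d/2}`, hence the tail of `h` is made as small as `r^{-d/2} r⁻¹`. The
function is set to zero for `r ≤ 0`, so that the bounds needed later hold for every real `r`. -/
theorem exists_truncation (hA : IsTaper h A) : ∃ U : ℝ → TestFn d,
    (∀ r x, (U r x).im = 0) ∧ (∀ r, ¬ 0 < r → ∀ x, U r x = 0) ∧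
    (∀ r, 0 < r → ∀ x, ‖U r x‖ ≤ scaledTaper h r x) ∧
    ∀ r, 0 < r → ∫ x, ‖(scaledTaper h r x : ℂ) - U r x‖ ≤ r⁻¹ := by
  have h1 : ∀ r : ℝ, ∃ R : ℝ, 0 < r →
      ∫ x, {x | R < ‖x‖}.indicator h x ≤ (r ^ ((d : ℝ) / 2))⁻¹ * r⁻¹ := by
    intro r
    by_cases hr : 0 < r
    · obtain ⟨R, hR⟩ := hA.exists_tail_le (δ := (r ^ ((d : ℝ) / 2))⁻¹ * r⁻¹) (by positivity)
      exact ⟨R, fun _ => hR⟩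
    · exact ⟨0, fun h => absurd h hr⟩
  choose R hR using h1
  obtain ⟨C, hC⟩ := hA.bounded
  let S : ℝ → Set (E d) := fun r => {x | 0 < r ∧ ‖x‖ ≤ r * R r}
  have hS : ∀ r, MeasurableSet (S r) := fun r =>
    (MeasurableSet.const _).inter (measurableSet_le measurable_norm measurable_const)
  let U : ℝ → TestFn d := fun r =>
    { toFun := (S r).indicator fun x => (scaledTaper h r x : ℂ)
      measurable' := (Complex.measurable_ofReal.comp (hA.measurable_scaledTaper r)).indicator (hS r)
      bounded' := by
        refine ⟨|(r ^ ((d : ℝ) / 2))⁻¹| * C, fun x => ?_⟩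
        refine (norm_indicator_le_norm_self _ _).trans ?_
        rw [Complex.norm_real, scaledTaper, norm_mul, Real.norm_eq_abs, Real.norm_eq_abs,
          abs_of_nonneg (hA.nonneg _)]
        exact mul_le_mul_of_nonneg_left (hC _) (abs_nonneg _)
      support' := by
        refine ⟨r * R r, fun x hx => Set.indicator_of_notMem ?_ _⟩
        exact fun h => absurd h.2 (not_le.2 hx) }
  have hU : ∀ r x, U r x = (S r).indicator (fun x => (scaledTaper h r x : ℂ)) x := fun r x => rfl
  refine ⟨U, fun r x => ?_, fun r hr x => ?_, fun r hr x => ?_, fun r hr => ?_⟩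
  · rw [hU, Set.indicator]
    split_ifs <;> simp
  · rw [hU, Set.indicator_of_notMem]
    exact fun h => hr h.1
  · rw [hU]
    refine (norm_indicator_le_norm_self _ _).trans ?_
    rw [Complex.norm_real, Real.norm_eq_abs, abs_of_nonneg (hA.scaledTaper_nonneg hr x)]
  · have h2 : ∀ x, ‖(scaledTaper h r x : ℂ) - U r x‖
        = scaledTaper ({x | R r < ‖x‖}.indicator h) r x := by
      intro x
      have h3 : R r < ‖r⁻¹ • x‖ ↔ x ∉ S r := by
        simp only [S, Set.mem_ofPred_eq, hr, true_and, not_le]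
        rw [norm_smul, norm_inv, Real.norm_eq_abs, abs_of_pos hr, lt_inv_mul_iff₀ hr]
      by_cases hx : x ∈ S r
      · have h4 : r⁻¹ • x ∉ {x : E d | R r < ‖x‖} := fun h => h3.1 h hx
        rw [hU, Set.indicator_of_mem hx, sub_self, norm_zero, scaledTaper,
          Set.indicator_of_notMem h4, mul_zero]
      · have h4 : r⁻¹ • x ∈ {x : E d | R r < ‖x‖} := h3.2 hx
        rw [hU, Set.indicator_of_notMem hx, sub_zero, scaledTaper, scaledTaper,
          Set.indicator_of_mem h4, Complex.norm_real, Real.norm_eq_abs]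
        exact abs_of_nonneg (hA.scaledTaper_nonneg hr x)
    simp only [h2]
    rw [integral_scaledTaper hr]
    have h5 : 0 < r ^ ((d : ℝ) / 2) := Real.rpow_pos_of_pos hr _
    calc _ ≤ r ^ ((d : ℝ) / 2) * ((r ^ ((d : ℝ) / 2))⁻¹ * r⁻¹) :=
          mul_le_mul_of_nonneg_left (hR r hr) h5.le
      _ = r⁻¹ := mul_inv_cancel_left₀ h5.ne' _

theorem integral_scaledTaper_shift_le (hA : IsTaper h A) : ∃ a > 0, ∃ b > 0, ∀ r, 0 < r →
    ∀ y : E d, ‖y‖ ≤ b * r → ∫ x, |scaledTaper h r (y + x) - scaledTaper h r x|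
      ≤ r ^ ((d : ℝ) / 2) * (a * (‖y‖ * r⁻¹)) := by
  obtain ⟨a, ha, b, hb, hab⟩ := hA.integral_sub_le
  refine ⟨a, ha, b, hb, fun r hr y hy => ?_⟩
  have h1 := hab (r⁻¹ • y)
  have h2 : ‖r⁻¹ • y‖ = ‖y‖ * r⁻¹ := by
    rw [norm_smul, norm_inv, Real.norm_eq_abs, abs_of_pos hr, mul_comm]
  rw [h2, if_pos (by rwa [← div_eq_mul_inv, div_le_iff₀ hr])] at h1
  have h3 : ∀ x, |scaledTaper h r (y + x) - scaledTaper h r x|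
      = scaledTaper (fun x => |h (x + r⁻¹ • y) - h x|) r x := by
    intro x
    simp only [scaledTaper]
    rw [← mul_sub, abs_mul, abs_of_nonneg (inv_nonneg.2 (Real.rpow_nonneg hr.le _)), smul_add,
      add_comm]
  simp only [h3]
  rw [integral_scaledTaper hr]
  exact mul_le_mul_of_nonneg_left h1 (Real.rpow_nonneg hr.le _)

theorem tendsto_scaledTaper_sq (hA : IsTaper h A) (k : E d) :
    Tendsto (fun r => ∫ x, (scaledTaper h r x : ℂ) * scaledTaper h r x * wave k x) atTop
      (𝓝 (if k = 0 then (taperMoment h 2 : ℂ) else 0)) := by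
  have h1 : ∀ r : ℝ, 0 < r → ∀ x : E d, scaledTaper h r x * scaledTaper h r x
      = (r ^ d)⁻¹ * h (r⁻¹ • x) ^ 2 := by
    intro r hr x
    rw [← rpow_half_mul_self hr, scaledTaper, mul_inv]
    ring
  split_ifs with hk
  · refine tendsto_const_nhds.congr' ?_
    filter_upwards [eventually_gt_atTop 0] with r hr
    simp only [hk, wave_zero, mul_one, ← Complex.ofReal_mul, h1 r hr]
    rw [integral_complex_ofReal, integral_const_mul,
      integral_comp_inv_smul_of_pos hr (fun x => h x ^ 2),
      inv_mul_cancel_left₀ (pow_pos hr d).ne', taperMoment]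
  · refine (hA.tendsto_sq (-k) (neg_ne_zero.2 hk)).congr' ?_
    filter_upwards [eventually_gt_atTop 0] with r hr
    rw [← integral_const_mul]
    refine integral_congr_ae (Eventually.of_forall fun x => ?_)
    simp only [← Complex.ofReal_mul, h1 r hr, wave, inner_neg_left]
    push_cast
    rw [mul_assoc]
    congr 3
    ring

/-- With `|h| ≤ C`, the choice is `ε r = C r^{-d/2}` and `K = C ∫ h`. The truncation error `1/r` is
harmless in each condition because it is multiplied by `ε r`. -/
theorem isNormalizedTaper (hd : 1 ≤ d) (hA : IsTaper h A) {U : ℝ → TestFn d}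
    (hU0 : ∀ r, ¬ 0 < r → ∀ x, U r x = 0)
    (hU1 : ∀ r, 0 < r → ∀ x, ‖U r x‖ ≤ scaledTaper h r x)
    (hU2 : ∀ r, 0 < r → ∫ x, ‖(scaledTaper h r x : ℂ) - U r x‖ ≤ r⁻¹) :
    IsNormalizedTaper atTop U (taperMoment h 2) := by
  obtain ⟨C, hC⟩ := hA.bounded
  have hC0 : 0 ≤ C := (hA.nonneg 0).trans (hC 0)
  have hV : ∀ r, 0 < r → ∀ x, scaledTaper h r x ≤ C * (r ^ ((d : ℝ) / 2))⁻¹ := by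
    intro r hr x
    rw [scaledTaper, mul_comm]
    exact mul_le_mul_of_nonneg_right (hC _) (inv_nonneg.2 (Real.rpow_nonneg hr.le _))
  have hVi : ∀ r, 0 < r → Integrable fun x : E d => (scaledTaper h r x : ℂ) := fun r hr =>
    (hA.integrable_scaledTaper hr).ofReal
  have hε : Tendsto (fun r : ℝ => C * (r ^ ((d : ℝ) / 2))⁻¹) atTop (𝓝 0) := by
    simpa using (tendsto_rpow_half_inv hd).const_mul C
  constructor
  · refine ⟨fun r => if 0 < r then C * (r ^ ((d : ℝ) / 2))⁻¹ else 0, C * ∫ x, h x, ?_, ?_, ?_, ?_, ?_⟩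
    · refine hε.congr' ?_
      filter_upwards [eventually_gt_atTop 0] with r hr
      rw [if_pos hr]
    · intro r
      beta_reduce
      split_ifs
      · positivity
      · exact le_rfl
    · intro r x
      beta_reduce
      split_ifs with hr
      · exact (hU1 r hr x).trans (hV r hr x)
      · simp [hU0 r hr]
    · intro r
      have hI : 0 ≤ ∫ x, h x := integral_nonneg hA.nonneg
      beta_reduce
      split_ifs with hr
      · have hp : 0 < r ^ ((d : ℝ) / 2) := Real.rpow_pos_of_pos hr _
        calc C * (r ^ ((d : ℝ) / 2))⁻¹ * ∫ x, ‖U r x‖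
            ≤ C * (r ^ ((d : ℝ) / 2))⁻¹ * ∫ x, scaledTaper h r x := by
              refine mul_le_mul_of_nonneg_left ?_ (by positivity)
              exact integral_mono (U r).integrable.norm (hA.integrable_scaledTaper hr) (hU1 r hr)
          _ = C * ∫ x, h x := by
              rw [integral_scaledTaper hr]
              field_simp
      · rw [zero_mul]
        positivity
    · intro y
      obtain ⟨a, ha, b, hb, hab⟩ := hA.integral_scaledTaper_shift_le
      have hlim : Tendsto (fun r : ℝ => 2 * (C * (r ^ ((d : ℝ) / 2))⁻¹ * r⁻¹)
          + C * (a * (‖y‖ * r⁻¹))) atTop (𝓝 0) := by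
        have h1 := ((hε.mul tendsto_inv_atTop_zero).const_mul 2).add
          (((tendsto_inv_atTop_zero (𝕜 := ℝ)).const_mul ‖y‖).const_mul a |>.const_mul C)
        simpa using h1
      refine squeeze_zero' (Eventually.of_forall fun r => ?_) ?_ hlim
      · refine mul_nonneg ?_ (integral_nonneg fun _ => norm_nonneg _)
        beta_reduce
        split_ifs
        · positivity
        · exact le_rfl
      -- From `r ≥ ‖y‖ / b` on, the rescaled displacement has norm at most `b`, where the bound on
      -- the increments of `h` is linear.
      filter_upwards [eventually_gt_atTop 0, eventually_ge_atTop (‖y‖ / b)] with r hr hry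
      rw [if_pos hr]
      have hp : 0 < r ^ ((d : ℝ) / 2) := Real.rpow_pos_of_pos hr _
      have i1 : Integrable fun x => ‖(scaledTaper h r x : ℂ) - U r x‖ :=
        ((hVi r hr).sub (U r).integrable).norm
      have i2 : Integrable fun x => ‖(scaledTaper h r (y + x) : ℂ) - U r (y + x)‖ :=
        i1.comp_add_left y
      have i3 : Integrable fun x => |scaledTaper h r (y + x) - scaledTaper h r x| :=
        (((hA.integrable_scaledTaper hr).comp_add_left y).sub (hA.integrable_scaledTaper hr)).abs
      have i4 : Integrable fun x => ‖(scaledTaper h r (y + x) : ℂ) - U r (y + x)‖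
          + ‖(scaledTaper h r x : ℂ) - U r x‖ := i2.add i1
      have h3 : ∫ x, ‖U r (y + x) - U r x‖ ≤ r⁻¹ + r⁻¹ + r ^ ((d : ℝ) / 2) * (a * (‖y‖ * r⁻¹)) := by
        calc ∫ x, ‖U r (y + x) - U r x‖
            ≤ ∫ x, (‖(scaledTaper h r (y + x) : ℂ) - U r (y + x)‖
              + ‖(scaledTaper h r x : ℂ) - U r x‖
              + |scaledTaper h r (y + x) - scaledTaper h r x|) := by
              refine integral_mono (((U r).integrable.comp_add_left y).sub (U r).integrable).norm
                (i4.add i3) fun x => ?_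
              have e : U r (y + x) - U r x = -((scaledTaper h r (y + x) : ℂ) - U r (y + x))
                + ((scaledTaper h r x : ℂ) - U r x)
                + ((scaledTaper h r (y + x) - scaledTaper h r x : ℝ) : ℂ) := by
                push_cast
                ring
              change ‖U r (y + x) - U r x‖ ≤ _
              rw [e]
              refine norm_add₃_le.trans (le_of_eq ?_)
              rw [norm_neg, Complex.norm_real, Real.norm_eq_abs]
          _ ≤ _ := by
              rw [integral_add i4 i3, integral_add i2 i1,
                integral_add_left_eq_self (fun x => ‖(scaledTaper h r x : ℂ) - U r x‖) y]
              refine add_le_add (add_le_add (hU2 r hr) (hU2 r hr)) (hab r hr y ?_)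
              rwa [div_le_iff₀' hb] at hry
      calc C * (r ^ ((d : ℝ) / 2))⁻¹ * ∫ x, ‖U r (y + x) - U r x‖
          ≤ C * (r ^ ((d : ℝ) / 2))⁻¹ *
              (r⁻¹ + r⁻¹ + r ^ ((d : ℝ) / 2) * (a * (‖y‖ * r⁻¹))) :=
            mul_le_mul_of_nonneg_left h3 (by positivity)
        _ = _ := by
            field_simp
            ring
  · intro k
    refine (tendsto_iff_of_dist ?_).1 (hA.tendsto_scaledTaper_sq k)
    have hlim : Tendsto (fun r : ℝ => 2 * (C * (r ^ ((d : ℝ) / 2))⁻¹ * r⁻¹)) atTop (𝓝 0) := by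
      simpa using (hε.mul tendsto_inv_atTop_zero).const_mul 2
    refine squeeze_zero' (Eventually.of_forall fun _ => dist_nonneg) ?_ hlim
    filter_upwards [eventually_gt_atTop 0] with r hr
    have hbV : ∀ x, ‖(scaledTaper h r x : ℂ)‖ ≤ C * (r ^ ((d : ℝ) / 2))⁻¹ := fun x => by
      rw [Complex.norm_real, Real.norm_eq_abs, abs_of_nonneg (hA.scaledTaper_nonneg hr x)]
      exact hV r hr x
    have iw : ∀ f : E d → ℂ, Integrable f → Integrable fun x => f x * wave k x := fun f hf =>
      hf.mul_bdd (c := 1) (measurable_wave k).aestronglyMeasurable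
        (Eventually.of_forall fun x => by simp)
    have i1 := iw _ ((hVi r hr).mul_bdd (hVi r hr).aestronglyMeasurable (Eventually.of_forall hbV))
    have i2 := iw _ ((U r) * (U r)).integrable
    simp only [TestFn.mul_apply] at i2
    rw [dist_eq_norm, ← integral_sub i1 i2]
    have i3 : Integrable fun x => ‖(scaledTaper h r x : ℂ) - U r x‖ :=
      ((hVi r hr).sub (U r).integrable).norm
    calc _ ≤ ∫ x, 2 * (C * (r ^ ((d : ℝ) / 2))⁻¹) * ‖(scaledTaper h r x : ℂ) - U r x‖ := by
          refine norm_integral_le_of_norm_le (i3.const_mul _) (Eventually.of_forall fun x => ?_)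
          -- A difference of squares: the sum is at most `2 ε r` pointwise, the difference at most
          -- `1/r` in `L¹`.
          have e : (scaledTaper h r x : ℂ) * scaledTaper h r x * wave k x - U r x * U r x * wave k x
              = ((scaledTaper h r x : ℂ) + U r x) * ((scaledTaper h r x : ℂ) - U r x)
                * wave k x := by ring
          rw [e, norm_mul, norm_wave, mul_one, norm_mul]
          refine mul_le_mul_of_nonneg_right ((norm_add_le _ _).trans ?_) (norm_nonneg _)
          linarith [hbV x, (hU1 r hr x).trans (hV r hr x)]
      _ ≤ 2 * (C * (r ^ ((d : ℝ) / 2))⁻¹) * r⁻¹ := by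
          rw [integral_const_mul]
          exact mul_le_mul_of_nonneg_left (hU2 r hr) (by positivity)
      _ = _ := by ring

theorem norm_integral_wave_sub_le (hA : IsTaper h A) {U : TestFn d} {r : ℝ} (hr : 0 < r)
    (hU : ∫ x, ‖(scaledTaper h r x : ℂ) - U x‖ ≤ r⁻¹) (k : E d) :
    ‖(∫ x, U.mod k x) - ∫ x, (scaledTaper h r x : ℂ) * wave k x‖ ≤ r⁻¹ := by
  have i1 : Integrable fun x => (scaledTaper h r x : ℂ) * wave k x :=
    (hA.integrable_scaledTaper hr).ofReal.mul_bdd (c := 1) (measurable_wave k).aestronglyMeasurable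
      (Eventually.of_forall fun x => by simp)
  rw [← integral_sub (U.mod k).integrable i1]
  refine le_trans (norm_integral_le_of_norm_le
    ((hA.integrable_scaledTaper hr).ofReal.sub U.integrable).norm
    (Eventually.of_forall fun x => ?_)) hU
  rw [TestFn.mod_apply, ← sub_mul, norm_mul, norm_wave, mul_one, norm_sub_rev]
  rfl

/-- For wave vectors in `A` this is the decay assumption on `h`, applied at `-k` because of the sign
convention. For `k = 0` the integral of the rescaled taper equals the subtracted term exactly.
Truncation adds at most `1/r`. -/
theorem tendsto_integral_mod (hA : IsTaper h A) {U : ℝ → TestFn d}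
    (hU : ∀ r, 0 < r → ∫ x, ‖(scaledTaper h r x : ℂ) - U r x‖ ≤ r⁻¹) {k : E d}
    (hk : k ∈ A ∪ {0}) :
    Tendsto (fun r : ℝ => (∫ x, (U r).mod k x)
      - if k = 0 then ((taperMoment h 1 * r ^ ((d : ℝ) / 2) : ℝ) : ℂ) else 0) atTop (𝓝 0) := by
  have h1 : Tendsto (fun r : ℝ => (∫ x, (scaledTaper h r x : ℂ) * wave k x)
      - if k = 0 then ((taperMoment h 1 * r ^ ((d : ℝ) / 2) : ℝ) : ℂ) else 0) atTop (𝓝 0) := by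
    rcases hk with hk | hk
    · have hk0 : k ≠ 0 := fun h0 => hA.zero_notMem (h0 ▸ hk)
      refine (hA.tendsto_one (-k) ((hA.neg_eq k).1 hk)).congr fun r => ?_
      rw [if_neg hk0, sub_zero, ← integral_const_mul]
      refine integral_congr_ae (Eventually.of_forall fun x => ?_)
      simp only [scaledTaper, wave, inner_neg_left]
      push_cast
      rw [mul_assoc]
      congr 3
      ring
    · rw [Set.mem_singleton_iff] at hk
      refine tendsto_const_nhds.congr' ?_
      filter_upwards [eventually_gt_atTop 0] with r hr
      simp only [hk, wave_zero, mul_one, if_true]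
      rw [integral_complex_ofReal, integral_scaledTaper hr, taperMoment, mul_comm, sub_eq_zero.2]
      simp
  have h2 : Tendsto (fun r : ℝ => (∫ x, (U r).mod k x) - ∫ x, (scaledTaper h r x : ℂ) * wave k x)
      atTop (𝓝 0) := by
    refine squeeze_zero_norm' ?_ (tendsto_inv_atTop_zero (𝕜 := ℝ))
    filter_upwards [eventually_gt_atTop 0] with r hr
    exact hA.norm_integral_wave_sub_le hr (hU r hr) k
  have h3 := h2.add h1
  rw [add_zero] at h3
  refine h3.congr fun r => ?_
  ring

end IsTaper

end PointProcess

/-! ### Campbell's formula for integrable functions -/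

namespace PointProcess

open TestFn

variable {d : ℕ}

/-- The counting measure of a configuration. -/
noncomputable def Configuration.toMeasure (μ : Configuration d) : Measure (E d) :=
  Measure.count.restrict μ.carrier

theorem Configuration.map_tupleMeasure_one (μ : Configuration d) :
    (tupleMeasure (Fin 1) μ).map (fun x => x 0) = μ.toMeasure := by
  have hm : Measurable fun x : Fin 1 → E d => x 0 := measurable_pi_apply 0
  have hbij : Function.Bijective fun x : Fin 1 → E d => x 0 := (Equiv.funUnique (Fin 1) (E d)).bijective
  ext s hs
  rw [Measure.map_apply hm hs, tupleMeasure, Measure.restrict_apply (hm hs),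
    Configuration.toMeasure, Measure.restrict_apply hs]
  have h1 : (fun x : Fin 1 → E d => x 0) ⁻¹' s ∩ tupleSet (Fin 1) μ
      = (fun x : Fin 1 → E d => x 0) ⁻¹' (s ∩ μ.carrier) := by
    ext x
    simp [tupleSet, Function.injective_of_subsingleton]
  have h2 : MeasurableSet (s ∩ μ.carrier) := hs.inter μ.countable.measurableSet
  rw [h1, Measure.count_apply (hm h2), Measure.count_apply h2,
    Set.encard_preimage_of_bijective hbij]

theorem Configuration.integral_toMeasure (μ : Configuration d) {F : E d → ℂ}
    (hF : Integrable F μ.toMeasure) : ∫ x, F x ∂μ.toMeasure = ∑' x : μ.carrier, F x := by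
  rw [Configuration.toMeasure, setIntegral_countable F μ.countable hF]
  simp [measureReal_def]

theorem tupleSum_singleton_eq_integral (μ : Configuration d) (u : TestFn d) :
    tupleSum μ [u] = ∫ x, u x ∂μ.toMeasure := by
  rw [← μ.map_tupleMeasure_one, integral_map (measurable_pi_apply 0).aemeasurable
    u.measurable.aestronglyMeasurable]
  simp [tupleSum, tensor]

section Campbell

variable {Ω : Type*} [MeasurableSpace Ω] {P : Measure Ω} {η : Ω → Configuration d}

theorem measurable_toMeasure (hη : Measurable η) : Measurable fun ω => (η ω).toMeasure := by
  have h1 := measurable_count_restrict (Set.univ : Set (E d)) MeasurableSet.univ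
  simp only [Set.inter_univ] at h1
  exact h1.comp hη

theorem bind_toMeasure (hη : Measurable η) (hmom : HasAllMoments P η) (hstat : IsStationary P η) :
    P.bind (fun ω => (η ω).toMeasure)
      = ENNReal.ofReal (intensity P η) • (volume : Measure (E d)) := by
  rw [← factorialMoment_one hη hmom hstat]
  ext s hs
  have hm : Measurable fun x : Fin 1 → E d => x 0 := measurable_pi_apply 0
  rw [Measure.bind_apply hs (measurable_toMeasure hη).aemeasurable, Measure.map_apply hm hs,
    factorialMoment_def, Measure.bind_apply (hm hs) (measurable_tupleMeasure_comp hη _).aemeasurable]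
  refine lintegral_congr fun ω => ?_
  rw [← Configuration.map_tupleMeasure_one, Measure.map_apply hm hs]

/-- Campbell's formula for integrable functions. -/
theorem integrable_integral_toMeasure (hη : Measurable η) (hmom : HasAllMoments P η)
    (hstat : IsStationary P η) {F : E d → ℂ} (hF : Integrable F) :
    (∀ᵐ ω ∂P, Integrable F (η ω).toMeasure) ∧
    Integrable (fun ω => ∫ x, F x ∂(η ω).toMeasure) P ∧
    ∫ ω, ‖∫ x, F x ∂(η ω).toMeasure‖ ∂P ≤ intensity P η * ∫ x, ‖F x‖ := by
  let κ : Kernel Ω (E d) := ⟨_, measurable_toMeasure hη⟩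
  have h0 : 0 ≤ intensity P η := ENNReal.toReal_nonneg
  have h1 : (κ ∘ₖ Kernel.const Unit P) () = ENNReal.ofReal (intensity P η) • volume := by
    rw [Kernel.comp_apply, Kernel.const_apply, ← bind_toMeasure hη hmom hstat]
    rfl
  have h2 : Integrable F ((κ ∘ₖ Kernel.const Unit P) ()) := by
    rw [h1]
    exact hF.smul_measure ENNReal.ofReal_ne_top
  have h3 := h2.integral_comp
  have h4 := Kernel.integral_comp h2.norm
  have h5 := h2.norm.integral_comp
  -- Integrability under the mean measure `γ * volume` gives integrability under almost every
  -- realization; this covers functions with unbounded support.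
  have h6 := h2.ae_of_comp
  rw [Kernel.const_apply] at h3 h4 h5 h6
  rw [h1, integral_smul_measure, ENNReal.toReal_ofReal h0] at h4
  refine ⟨h6, h3, ?_⟩
  rw [← smul_eq_mul, h4]
  exact integral_mono h3.norm h5 fun ω => norm_integral_le_integral_norm _

end Campbell

end PointProcess

/-! ### Real trigonometric polynomials and their limiting variances -/

namespace PointProcess

open TestFn

variable {d : ℕ}

/-- The product of a test function with the real trigonometric polynomial
`x ↦ ∑ j, Re (conj (t j) * e^{-i⟨k j, x⟩})`. -/
noncomputable def TestFn.realTrig {J : Type*} [Fintype J] (u : TestFn d) (t : J → ℂ) (k : J → E d) :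
    TestFn d :=
  u.trig (fun p : J × Bool => if p.2 then starRingEnd ℂ (t p.1) / 2 else t p.1 / 2)
    (fun p => if p.2 then k p.1 else -k p.1)

theorem TestFn.realTrig_apply {J : Type*} [Fintype J] (u : TestFn d) (hu : ∀ x, (u x).im = 0)
    (t : J → ℂ) (k : J → E d) (x : E d) :
    u.realTrig t k x = ((∑ j, (starRingEnd ℂ (t j) * u.mod (k j) x).re : ℝ) : ℂ) := by
  rw [TestFn.realTrig, TestFn.trig_apply, Fintype.sum_prod_type, Complex.ofReal_sum,
    Finset.mul_sum]
  refine Finset.sum_congr rfl fun j _ => ?_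
  simp only [Fintype.sum_bool, if_true, Bool.false_eq_true, if_false, TestFn.mod_apply,
    ← conj_wave]
  apply Complex.ext
  · simp [hu x]
    ring
  · simp [hu x]
    right
    ring

theorem TestFn.integral_realTrig {J : Type*} [Fintype J] (u : TestFn d) (hu : ∀ x, (u x).im = 0)
    (t : J → ℂ) (k : J → E d) {μ : Measure (E d)} (hμ : ∀ v : TestFn d, Integrable v μ) :
    ∫ x, u.realTrig t k x ∂μ
      = ((∑ j, (starRingEnd ℂ (t j) * ∫ x, u.mod (k j) x ∂μ).re : ℝ) : ℂ) := by
  have hi : ∀ j, Integrable (fun x => (starRingEnd ℂ (t j) * u.mod (k j) x).re) μ := fun j =>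
    ((hμ (u.mod (k j))).const_mul _).re
  simp only [u.realTrig_apply hu]
  rw [integral_complex_ofReal, integral_finsetSum _ fun j _ => hi j]
  congr 1
  refine Finset.sum_congr rfl fun j _ => ?_
  rw [← integral_const_mul]
  exact integral_re ((hμ (u.mod (k j))).const_mul _)

theorem TestFn.integrable_toMeasure (μ : Configuration d) (v : TestFn d) :
    Integrable v μ.toMeasure := by
  obtain ⟨C, -, hC⟩ := v.exists_bound
  obtain ⟨R, hR⟩ := v.support'
  have h1 : μ.toMeasure (Metric.closedBall 0 R) ≠ ∞ := by
    rw [Configuration.toMeasure, Measure.restrict_apply Metric.isClosed_closedBall.measurableSet,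
      Set.inter_comm]
    exact (Measure.count_apply_lt_top.2 (μ.finite_inter _ Metric.isBounded_closedBall)).ne
  refine (integrableOn_iff_integrable_of_support_subset (s := Metric.closedBall 0 R) ?_).1
    (Measure.integrableOn_of_bounded (M := C) h1 v.measurable.aestronglyMeasurable
      (Eventually.of_forall hC))
  intro x hx
  by_contra h
  exact hx (hR x (by simpa using h))

variable {Ω : Type*} [MeasurableSpace Ω] {P : Measure Ω} {η : Ω → Configuration d}

section Variance

variable [IsProbabilityMeasure P] {h : E d → ℝ} {α : Type*} {l : Filter α}
  [l.IsCountablyGenerated] {U : α → TestFn d}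

theorem tendsto_statCov_asympVar (hη : Measurable η) (hmom : HasAllMoments P η)
    (hstat : IsStationary P η) (hfin : FiniteCumulants P η) (hγ : 0 < intensity P η)
    (hU : IsNormalizedTaper l U (taperMoment h 2)) {k k' : E d} (hk : k + k' = 0) :
    Tendsto (fun r => statCov P η ((U r).mod k) ((U r).mod k')) l (𝓝 (asympVar P η h k')) := by
  have := tendsto_statCov hη hmom hstat hfin hγ hU k k'
  rwa [if_pos hk] at this

/-- The two values are limits of the same covariance, which is symmetric in its arguments. No
symmetry of `β^!_2` has to be proved directly. -/
theorem asympVar_neg [l.NeBot] (hη : Measurable η) (hmom : HasAllMoments P η)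
    (hstat : IsStationary P η) (hfin : FiniteCumulants P η) (hγ : 0 < intensity P η)
    (hU : IsNormalizedTaper l U (taperMoment h 2)) (k : E d) :
    asympVar P η h (-k) = asympVar P η h k := by
  have h1 := tendsto_statCov_asympVar hη hmom hstat hfin hγ hU (add_neg_cancel k)
  have h2 := tendsto_statCov_asympVar hη hmom hstat hfin hγ hU (neg_add_cancel k)
  simp only [statCov_comm hη hmom ((U _).mod k)] at h1
  exact tendsto_nhds_unique h1 h2

/-- As `U r` is real, the functions modulated by `-k` and `k` are conjugate, so the value is a limit
of variances. -/
theorem asympVar_nonneg [l.NeBot] (hη : Measurable η) (hmom : HasAllMoments P η)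
    (hstat : IsStationary P η) (hfin : FiniteCumulants P η) (hγ : 0 < intensity P η)
    (hU : IsNormalizedTaper l U (taperMoment h 2)) (hU' : ∀ r x, (U r x).im = 0) (k : E d) :
    (asympVar P η h k).im = 0 ∧ 0 ≤ (asympVar P η h k).re := by
  have h1 := tendsto_statCov_asympVar hη hmom hstat hfin hγ hU (neg_add_cancel k)
  have h2 : ∀ r, (statCov P η ((U r).mod (-k)) ((U r).mod k)).im = 0
      ∧ 0 ≤ (statCov P η ((U r).mod (-k)) ((U r).mod k)).re := by
    intro r
    refine statCov_conj hη hmom _ _ fun x => ?_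
    rw [TestFn.mod_apply, TestFn.mod_apply, map_mul, conj_wave, Complex.conj_eq_iff_im.2 (hU' r x)]
  constructor
  · refine tendsto_nhds_unique ((Complex.continuous_im.tendsto _).comp h1) ?_
    exact tendsto_const_nhds.congr fun r => (h2 r).1.symm
  · exact ge_of_tendsto' ((Complex.continuous_re.tendsto _).comp h1) fun r => (h2 r).2

/-- Each real part splits into waves with vectors `±k i`, and a pair survives only if its vectors
add up to zero. For `k i = k j ≠ 0` the two mixed sign choices survive and give `(re re + im im) /
2` times the variance. At zero all four survive, the imaginary parts cancel and `re re` remains with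
full weight. The `k j` need not be distinct, hence the double sum. -/
theorem tendsto_statCov_realTrig [l.NeBot] (hη : Measurable η) (hmom : HasAllMoments P η)
    (hstat : IsStationary P η) (hfin : FiniteCumulants P η) (hγ : 0 < intensity P η)
    (hU : IsNormalizedTaper l U (taperMoment h 2)) (hU' : ∀ r x, (U r x).im = 0)
    {J : Type*} [Fintype J] (t : J → ℂ) (k : J → E d)
    (hk : ∀ i j, k i + k j = 0 → k i = 0 ∧ k j = 0) :
    Tendsto (fun r => statCov P η ((U r).realTrig t k) ((U r).realTrig t k)) l
      (𝓝 ((∑ i, ∑ j, if k i = k j then (t i).re * (t j).re * varRe P η h (k j)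
        + (t i).im * (t j).im * varIm P η h (k j) else 0 : ℝ) : ℂ)) := by
  simp only [TestFn.realTrig, statCov_trig hη hmom]
  have h1 : ∀ p q : J × Bool, _ := fun p q => tendsto_statCov hη hmom hstat hfin hγ hU
    (if p.2 then k p.1 else -k p.1) (if q.2 then k q.1 else -k q.1)
  have h2 := tendsto_finsetSum Finset.univ fun p _ => tendsto_finsetSum Finset.univ fun q _ =>
    (h1 p q).const_mul ((if p.2 then starRingEnd ℂ (t p.1) / 2 else t p.1 / 2)
      * (if q.2 then starRingEnd ℂ (t q.1) / 2 else t q.1 / 2))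
  convert! h2 using 2
  rw [Fintype.sum_prod_type, Complex.ofReal_sum]
  refine Finset.sum_congr rfl fun i _ => ?_
  rw [Fintype.sum_bool, Fintype.sum_prod_type, Fintype.sum_prod_type, ← Finset.sum_add_distrib,
    Complex.ofReal_sum]
  refine Finset.sum_congr rfl fun j _ => ?_
  simp only [Fintype.sum_bool, if_true, Bool.false_eq_true, if_false]
  change _ = _ * (if k i + k j = 0 then asympVar P η h (k j) else 0)
    + _ * (if k i + -k j = 0 then asympVar P η h (-k j) else 0)
    + (_ * (if -k i + k j = 0 then asympVar P η h (k j) else 0)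
    + _ * (if -k i + -k j = 0 then asympVar P η h (-k j) else 0))
  rw [asympVar_neg hη hmom hstat hfin hγ hU]
  obtain ⟨him, hre⟩ := asympVar_nonneg hη hmom hstat hfin hγ hU hU' (k j)
  have hv : asympVar P η h (k j) = ((asympVar P η h (k j)).re : ℂ) :=
    Complex.ext (by simp) (by simp [him])
  rw [varRe, varIm, hv, Complex.ofReal_re]
  generalize (asympVar P η h (k j)).re = s at hre
  have e1 : -k i + k j = 0 ↔ k i = k j := by rw [neg_add_eq_zero]
  have e2 : k i + -k j = 0 ↔ k i = k j := by rw [add_neg_eq_zero]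
  have e3 : -k i + -k j = 0 ↔ k i + k j = 0 := by rw [← neg_add, neg_eq_zero]
  simp only [e1, e2, e3]
  by_cases hij : k i = k j
  · by_cases h0 : k j = 0
    · rw [hij, h0]
      simp only [add_zero, if_true]
      rw [Real.coe_toNNReal s hre]
      apply Complex.ext <;> simp <;> ring
    · have h3 : k i + k j ≠ 0 := fun h => h0 (hk i j h).2
      rw [if_pos hij, if_neg h3, if_pos hij, if_neg h0, if_neg h0,
        Real.coe_toNNReal _ (by positivity)]
      apply Complex.ext <;> simp <;> ring
  · have h3 : k i + k j ≠ 0 := fun h => hij ((hk i j h).1.trans (hk i j h).2.symm)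
    simp [hij, h3]

end Variance

-- Transfer to the empirical Fourier transform

end PointProcess

namespace PointProcess

open TestFn

variable {d : ℕ} {Ω : Type*} [MeasurableSpace Ω] {P : Measure Ω} {η : Ω → Configuration d}
  {h : E d → ℝ} {A : Set (E d)}

/-- The centring of the tapered empirical Fourier transform. -/
noncomputable def fourierMean (P : Measure Ω) (η : Ω → Configuration d) (h : E d → ℝ) (r : ℝ)
    (k : E d) : ℂ :=
  if k = 0 then ((taperMoment h 1 * intensity P η * r ^ ((d : ℝ) / 2) : ℝ) : ℂ) else 0

/-- The linear combination is itself the statistic of one real test function, `realTrig`. That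
function inherits the two size bounds of `U r`, each up to powers of the sum `L` of the norms of its
coefficients. -/
theorem tendsto_integral_exp_mod [IsProbabilityMeasure P] (hη : Measurable η)
    (hmom : HasAllMoments P η) (hstat : IsStationary P η) (hfin : FiniteCumulants P η)
    (hγ : 0 < intensity P η) {U : ℝ → TestFn d}
    (hU : IsNormalizedTaper atTop U (taperMoment h 2)) (hU' : ∀ r x, (U r x).im = 0)
    {J : Type*} [Fintype J] (t : J → ℂ) (k : J → E d)
    (hk : ∀ i j, k i + k j = 0 → k i = 0 ∧ k j = 0)
    (hmean : ∀ j, Tendsto (fun r : ℝ => (∫ x, (U r).mod (k j) x)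
      - if k j = 0 then ((taperMoment h 1 * r ^ ((d : ℝ) / 2) : ℝ) : ℂ) else 0) atTop (𝓝 0)) :
    Tendsto (fun r => ∫ ω, Complex.exp (Complex.I * ((∑ j, (starRingEnd ℂ (t j) *
        (tupleSum (η ω) [(U r).mod (k j)] - fourierMean P η h r (k j))).re : ℝ) : ℂ)) ∂P) atTop
      (𝓝 (Complex.exp (-((∑ i, ∑ j, if k i = k j then (t i).re * (t j).re * varRe P η h (k j)
        + (t i).im * (t j).im * varIm P η h (k j) else 0 : ℝ) : ℂ) / 2))) := by
  obtain ⟨ε, K, hε, hε0, hb, hK, -⟩ := hU.exists_bound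
  set L : ℝ := ∑ p : J × Bool, ‖if p.2 then starRingEnd ℂ (t p.1) / 2 else t p.1 / 2‖ with hL
  have hL0 : 0 ≤ L := Finset.sum_nonneg fun _ _ => norm_nonneg _
  have hle : ∀ r x, ‖(U r).realTrig t k x‖ ≤ L * ‖U r x‖ := fun r x => (U r).norm_trig_le _ _ x
  have h1 := tendsto_integral_exp_tupleSum hη hmom hstat hfin
    (g := fun r => (U r).realTrig t k) (δ := fun r => L * ε r) (K := L * (L * K))
    (by simpa using hε.const_mul L) (fun r => mul_nonneg hL0 (hε0 r))
    (fun r x => (hle r x).trans (mul_le_mul_of_nonneg_left (hb r x) hL0))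
    (fun r => by
      have h2 : ∫ x, ‖(U r).realTrig t k x‖ ≤ L * ∫ x, ‖U r x‖ := by
        rw [← integral_const_mul]
        exact integral_mono ((U r).realTrig t k).integrable.norm
          ((U r).integrable.norm.const_mul _) (hle r)
      calc L * ε r * ∫ x, ‖(U r).realTrig t k x‖ ≤ L * ε r * (L * ∫ x, ‖U r x‖) :=
            mul_le_mul_of_nonneg_left h2 (mul_nonneg hL0 (hε0 r))
        _ = L * (L * (ε r * ∫ x, ‖U r x‖)) := by ring
        _ ≤ L * (L * K) := by gcongr; exact hK r)
    (fun r x => by rw [(U r).realTrig_apply (hU' r), Complex.ofReal_im])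
    (fun r => ∑ j, (starRingEnd ℂ (t j) * fourierMean P η h r (k j)).re)
    (by
      have h2 : Tendsto (fun r => ∑ j, (starRingEnd ℂ (t j) * ((intensity P η : ℂ) *
          ((∫ x, (U r).mod (k j) x) - if k j = 0 then
            ((taperMoment h 1 * r ^ ((d : ℝ) / 2) : ℝ) : ℂ) else 0))).re) atTop
          (𝓝 (∑ j : J, (starRingEnd ℂ (t j) * ((intensity P η : ℂ) * 0)).re)) :=
        tendsto_finsetSum _ fun j _ =>
          (Complex.continuous_re.tendsto _).comp (((hmean j).const_mul _).const_mul _)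
      have h3 := (Complex.continuous_ofReal.tendsto _).comp h2
      simp only [mul_zero, Complex.zero_re, Finset.sum_const_zero, Complex.ofReal_zero] at h3
      refine h3.congr fun r => ?_
      rw [(U r).integral_realTrig (hU' r) t k fun v => v.integrable, Function.comp_apply,
        ← Complex.ofReal_mul, ← Complex.ofReal_sub, Finset.mul_sum, ← Finset.sum_sub_distrib]
      congr 1
      refine Finset.sum_congr rfl fun j _ => ?_
      have e : fourierMean P η h r (k j) = (intensity P η : ℂ) *
          if k j = 0 then ((taperMoment h 1 * r ^ ((d : ℝ) / 2) : ℝ) : ℂ) else 0 := by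
        rw [fourierMean]
        split_ifs
        · push_cast
          ring
        · simp
      rw [e, ← Complex.re_ofReal_mul, ← Complex.sub_re]
      congr 1
      ring)
    _ (tendsto_statCov_realTrig hη hmom hstat hfin hγ hU hU' t k hk)
  refine h1.congr fun r => integral_congr_ae (Eventually.of_forall fun ω => ?_)
  have h2 : (tupleSum (η ω) [(U r).realTrig t k]
      - ((∑ j, (starRingEnd ℂ (t j) * fourierMean P η h r (k j)).re : ℝ) : ℂ)).re
      = ∑ j, (starRingEnd ℂ (t j) *
        (tupleSum (η ω) [(U r).mod (k j)] - fourierMean P η h r (k j))).re := by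
    rw [tupleSum_singleton_eq_integral, (U r).integral_realTrig (hU' r) t k
      fun v => v.integrable_toMeasure (η ω), ← Complex.ofReal_sub, Complex.ofReal_re,
      ← Finset.sum_sub_distrib]
    refine Finset.sum_congr rfl fun j _ => ?_
    rw [tupleSum_singleton_eq_integral, ← Complex.sub_re, mul_sub]
  simp only [h2]

theorem integrable_scaledTaper_wave (hA : IsTaper h A) {r : ℝ} (hr : r ≠ 0) (k : E d) :
    Integrable fun x => (scaledTaper h r x : ℂ) * wave k x :=
  ((hA.integrable.comp_smul (inv_ne_zero hr)).const_mul _).ofReal.mul_bdd (c := 1)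
    (measurable_wave k).aestronglyMeasurable (Eventually.of_forall fun x => by simp)

/-- The sum over `η` may be infinite, and `tsum` has its default value zero where summability fails.
By Campbell's formula the sum converges absolutely almost surely, and there it is an integral. -/
theorem empiricalFourier_ae_eq (hη : Measurable η) (hmom : HasAllMoments P η)
    (hstat : IsStationary P η) (hA : IsTaper h A) {r : ℝ} (hr : r ≠ 0) (k : E d) :
    ∀ᵐ ω ∂P, empiricalFourier P η h r k ω
      = (∫ x, (scaledTaper h r x : ℂ) * wave k x ∂(η ω).toMeasure) - fourierMean P η h r k := by
  filter_upwards [(integrable_integral_toMeasure hη hmom hstat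
    (integrable_scaledTaper_wave hA hr k)).1] with ω hω
  rw [(η ω).integral_toMeasure hω, empiricalFourier, ← tsum_mul_left, fourierMean]
  congr 1
  refine tsum_congr fun x => ?_
  rw [scaledTaper, wave]
  push_cast
  ring

theorem aemeasurable_empiricalFourier (hd : 1 ≤ d) (hη : Measurable η) (hmom : HasAllMoments P η)
    (hstat : IsStationary P η) (hA : IsTaper h A) (r : ℝ) (k : E d) :
    AEMeasurable (empiricalFourier P η h r k) P := by
  -- Convergence in distribution requires measurability for every real `r`. At `r = 0` the factor
  -- `(0 ^ (d/2))⁻¹` is zero and the transform is constant.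
  rcases eq_or_ne r 0 with rfl | hr
  · have hd' : (d : ℝ) / 2 ≠ 0 := by
      have : (1 : ℝ) ≤ d := by exact_mod_cast hd
      positivity
    have e : empiricalFourier P η h 0 k = fun _ => -fourierMean P η h 0 k := by
      funext ω
      rw [empiricalFourier, fourierMean, Real.zero_rpow hd']
      simp
    rw [e]
    exact aemeasurable_const
  · have h1 := (integrable_integral_toMeasure hη hmom hstat
      (integrable_scaledTaper_wave hA hr k)).2.1.aemeasurable.sub_const (fourierMean P η h r k)
    exact h1.congr ((empiricalFourier_ae_eq hη hmom hstat hA hr k).mono fun ω h => h.symm)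

theorem integral_norm_empiricalFourier_sub_le (hη : Measurable η) (hmom : HasAllMoments P η)
    (hstat : IsStationary P η) (hA : IsTaper h A) {U : ℝ → TestFn d}
    (hU : ∀ r, 0 < r → ∫ x, ‖(scaledTaper h r x : ℂ) - U r x‖ ≤ r⁻¹) {r : ℝ} (hr : 0 < r)
    (k : E d) :
    Integrable (fun ω => ‖empiricalFourier P η h r k ω
      - (tupleSum (η ω) [(U r).mod k] - fourierMean P η h r k)‖) P ∧
    ∫ ω, ‖empiricalFourier P η h r k ω
      - (tupleSum (η ω) [(U r).mod k] - fourierMean P η h r k)‖ ∂P ≤ intensity P η * r⁻¹ := by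
  have h0 : 0 ≤ intensity P η := ENNReal.toReal_nonneg
  have i1 := integrable_scaledTaper_wave hA hr.ne' k
  have i2 := i1.sub ((U r).mod k).integrable
  obtain ⟨-, i3, h3⟩ := integrable_integral_toMeasure hη hmom hstat i2
  have e : ∀ᵐ ω ∂P, ‖∫ x, ((fun x => (scaledTaper h r x : ℂ) * wave k x) - (U r).mod k) x
      ∂(η ω).toMeasure‖ = ‖empiricalFourier P η h r k ω
        - (tupleSum (η ω) [(U r).mod k] - fourierMean P η h r k)‖ := by
    filter_upwards [empiricalFourier_ae_eq hη hmom hstat hA hr.ne' k,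
      (integrable_integral_toMeasure hη hmom hstat i1).1] with ω h1 h2
    rw [h1, tupleSum_singleton_eq_integral, sub_sub_sub_cancel_right,
      ← integral_sub h2 (((U r).mod k).integrable_toMeasure (η ω))]
    rfl
  refine ⟨i3.norm.congr e, ?_⟩
  rw [← integral_congr_ae e]
  refine h3.trans (mul_le_mul_of_nonneg_left ?_ h0)
  refine le_trans (le_of_eq ?_) (hU r hr)
  refine integral_congr_ae (Eventually.of_forall fun x => ?_)
  simp only [Pi.sub_apply, TestFn.mod_apply]
  rw [← sub_mul, norm_mul, norm_wave, mul_one]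

theorem norm_exp_I_sub_exp_I_le (a b : ℝ) :
    ‖Complex.exp (Complex.I * a) - Complex.exp (Complex.I * b)‖ ≤ |a - b| := by
  have e : Complex.exp (Complex.I * a) - Complex.exp (Complex.I * b)
      = Complex.exp (Complex.I * b) * (Complex.exp (Complex.I * ((a - b : ℝ) : ℂ)) - 1) := by
    rw [mul_sub, ← Complex.exp_add, mul_one]
    congr 2
    push_cast
    ring
  rw [e, norm_mul, mul_comm Complex.I, Complex.norm_exp_ofReal_mul_I, one_mul]
  exact Real.norm_exp_I_mul_ofReal_sub_one_le

/-- The map `a ↦ e^{ia}` is Lipschitz with constant one, so closeness in `L¹` carries over to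
characteristic functions. -/
theorem tendsto_integral_exp_of_tendsto_integral_norm [IsProbabilityMeasure P] {α J : Type*}
    [Fintype J] {l : Filter α} (t : J → ℂ) {X Y : α → J → Ω → ℂ}
    (hX : ∀ r j, AEMeasurable (X r j) P) (hY : ∀ r j, AEMeasurable (Y r j) P)
    {δ : α → ℝ} (hδ : Tendsto δ l (𝓝 0))
    (hXY : ∀ᶠ r in l, ∀ j, Integrable (fun ω => ‖X r j ω - Y r j ω‖) P ∧
      ∫ ω, ‖X r j ω - Y r j ω‖ ∂P ≤ δ r) {c : ℂ}
    (hc : Tendsto (fun r => ∫ ω, Complex.exp (Complex.I *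
      ((∑ j, (starRingEnd ℂ (t j) * Y r j ω).re : ℝ) : ℂ)) ∂P) l (𝓝 c)) :
    Tendsto (fun r => ∫ ω, Complex.exp (Complex.I *
      ((∑ j, (starRingEnd ℂ (t j) * X r j ω).re : ℝ) : ℂ)) ∂P) l (𝓝 c) := by
  have hint : ∀ Z : J → Ω → ℂ, (∀ j, AEMeasurable (Z j) P) → Integrable (fun ω => Complex.exp
      (Complex.I * ((∑ j, (starRingEnd ℂ (t j) * Z j ω).re : ℝ) : ℂ))) P := by
    intro Z hZ
    refine Integrable.of_bound (C := 1) ?_ (Eventually.of_forall fun ω => ?_)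
    · refine AEMeasurable.aestronglyMeasurable ?_
      refine Complex.measurable_exp.comp_aemeasurable (AEMeasurable.const_mul ?_ _)
      refine Complex.measurable_ofReal.comp_aemeasurable ?_
      refine Finset.aemeasurable_fun_sum _ fun j _ => ?_
      exact Complex.measurable_re.comp_aemeasurable ((hZ j).const_mul _)
    · rw [mul_comm, Complex.norm_exp_ofReal_mul_I]
  refine (tendsto_iff_of_dist ?_).1 hc
  have hlim : Tendsto (fun r => (∑ j, ‖t j‖) * δ r) l (𝓝 0) := by
    simpa using hδ.const_mul (∑ j, ‖t j‖)
  refine squeeze_zero' (Eventually.of_forall fun _ => dist_nonneg) ?_ hlim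
  filter_upwards [hXY] with r hr
  rw [dist_comm, dist_eq_norm, ← integral_sub (hint _ (hX r)) (hint _ (hY r))]
  calc _ ≤ ∫ ω, ∑ j, ‖t j‖ * ‖X r j ω - Y r j ω‖ ∂P := by
        refine norm_integral_le_of_norm_le
          (integrable_finsetSum _ fun j _ => (hr j).1.const_mul _)
          (Eventually.of_forall fun ω => ?_)
        refine (norm_exp_I_sub_exp_I_le _ _).trans ?_
        rw [← Finset.sum_sub_distrib]
        refine (Finset.abs_sum_le_sum_abs _ _).trans (Finset.sum_le_sum fun j _ => ?_)
        rw [← Complex.sub_re, ← mul_sub]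
        refine (Complex.abs_re_le_norm _).trans (le_of_eq ?_)
        rw [norm_mul, RCLike.norm_conj]
    _ ≤ (∑ j, ‖t j‖) * δ r := by
        rw [integral_finsetSum _ fun j _ => (hr j).1.const_mul _, Finset.sum_mul]
        refine Finset.sum_le_sum fun j _ => ?_
        rw [integral_const_mul]
        exact mul_le_mul_of_nonneg_left (hr j).2 (norm_nonneg _)

end PointProcess

namespace PointProcess

open TestFn

/-! ### Characteristic function of the limit and Lévy continuity -/

section GaussianLimit

theorem integral_exp_I_of_hasLaw_gaussianReal {Ω : Type*} [MeasurableSpace Ω] {P : Measure Ω}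
    {X : Ω → ℝ} {v : ℝ≥0} (hX : HasLaw X (gaussianReal 0 v) P) (p : ℝ) :
    ∫ ω, Complex.exp (Complex.I * ((p * X ω : ℝ) : ℂ)) ∂P = Complex.exp (-(p ^ 2 * v : ℝ) / 2) := by
  have h1 := charFun_gaussianReal (μ := 0) (v := v) p
  rw [← hX.map_eq, charFun_apply_real, integral_map hX.aemeasurable
    (by fun_prop : Measurable fun x : ℝ => Complex.exp (p * x * Complex.I)).aestronglyMeasurable] at h1
  convert! h1 using 2
  · funext ω
    congr 1
    push_cast
    ring
  · push_cast
    ring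

/-- Indices with the same wave vector refer to the same limit variable, so their coefficients have
to be added before squaring. -/
theorem sum_sum_eq_sum_image {J I : Type*} [Fintype J] [DecidableEq I] (k : J → I) (a : J → ℝ)
    (v : I → ℝ) :
    ∑ i, ∑ j, (if k i = k j then a i * a j * v (k j) else 0)
      = ∑ κ ∈ Finset.univ.image k, (∑ j with k j = κ, a j) ^ 2 * v κ := by
  rw [Finset.sum_comm, ← Finset.sum_fiberwise_of_maps_to (g := k) (t := Finset.univ.image k)
    fun j _ => Finset.mem_image_of_mem k (Finset.mem_univ j)]
  refine Finset.sum_congr rfl fun κ _ => ?_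
  rw [sq, Finset.mul_sum, Finset.sum_mul]
  refine Finset.sum_congr rfl fun j hj => ?_
  rw [(Finset.mem_filter.1 hj).2, ← Finset.sum_filter, Finset.sum_mul, Finset.sum_mul]

theorem integral_exp_of_iIndepFun_gaussian {Ω I J : Type*} [MeasurableSpace Ω] {P : Measure Ω}
    [IsProbabilityMeasure P] [Fintype J] [DecidableEq I] {Z : I → Ω → ℂ} {vR vI : I → ℝ≥0}
    (hZ : iIndepFun Z P) (hZ' : ∀ κ, IndepFun (fun ω => (Z κ ω).re) (fun ω => (Z κ ω).im) P)
    (hre : ∀ κ, HasLaw (fun ω => (Z κ ω).re) (gaussianReal 0 (vR κ)) P)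
    (him : ∀ κ, HasLaw (fun ω => (Z κ ω).im) (gaussianReal 0 (vI κ)) P)
    (t : J → ℂ) (k : J → I) :
    ∫ ω, Complex.exp (Complex.I * ((∑ j, (starRingEnd ℂ (t j) * Z (k j) ω).re : ℝ) : ℂ)) ∂P
      = Complex.exp (-((∑ i, ∑ j, if k i = k j then (t i).re * (t j).re * vR (k j)
        + (t i).im * (t j).im * vI (k j) else 0 : ℝ) : ℂ) / 2) := by
  set s := Finset.univ.image k with hs
  set p : I → ℝ := fun κ => ∑ j with k j = κ, (t j).re with hp
  set q : I → ℝ := fun κ => ∑ j with k j = κ, (t j).im with hq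
  -- After grouping by wave vector the exponential is a product of functions of independent
  -- variables, and within each variable of its independent real and imaginary parts.
  have h1 : ∀ ω, Complex.exp (Complex.I * ((∑ j, (starRingEnd ℂ (t j) * Z (k j) ω).re : ℝ) : ℂ))
      = ∏ κ : s, (Complex.exp (Complex.I * ((p κ * (Z κ ω).re : ℝ) : ℂ))
        * Complex.exp (Complex.I * ((q κ * (Z κ ω).im : ℝ) : ℂ))) := by
    intro ω
    rw [Finset.prod_coe_sort s fun κ => Complex.exp (Complex.I * ((p κ * (Z κ ω).re : ℝ) : ℂ))
        * Complex.exp (Complex.I * ((q κ * (Z κ ω).im : ℝ) : ℂ))]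
    simp only [← Complex.exp_add, ← mul_add, ← Complex.ofReal_add]
    rw [← Complex.exp_sum, ← Finset.mul_sum, ← Complex.ofReal_sum,
      ← Finset.sum_fiberwise_of_maps_to (g := k) (t := s)
        fun j _ => Finset.mem_image_of_mem k (Finset.mem_univ j)]
    congr 3
    refine Finset.sum_congr rfl fun κ _ => ?_
    rw [hp, hq, Finset.sum_mul, Finset.sum_mul, ← Finset.sum_add_distrib]
    refine Finset.sum_congr rfl fun j hj => ?_
    rw [(Finset.mem_filter.1 hj).2]
    simp
  have hm : ∀ κ, AEMeasurable (Z κ) P := by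
    intro κ
    have h2 := (Complex.measurable_ofReal.comp_aemeasurable (hre κ).aemeasurable).add
      ((Complex.measurable_ofReal.comp_aemeasurable (him κ).aemeasurable).mul_const Complex.I)
    exact h2.congr (Eventually.of_forall fun ω => Complex.re_add_im _)
  let f : s → ℂ → ℂ := fun κ z => Complex.exp (Complex.I * ((p κ * z.re : ℝ) : ℂ))
    * Complex.exp (Complex.I * ((q κ * z.im : ℝ) : ℂ))
  have hf : ∀ κ, Measurable (f κ) := fun κ => by
    have := Complex.measurable_re
    have := Complex.measurable_im
    fun_prop
  have h2 : iIndepFun (fun κ : s => f κ ∘ Z κ) P :=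
    (hZ.precomp Subtype.val_injective).comp f hf
  have h3 := h2.integral_prod_eq_prod_integral
    fun κ => ((hf κ).comp_aemeasurable (hm κ)).aestronglyMeasurable
  simp only [Finset.prod_apply, Function.comp_apply, f] at h3
  simp only [h1]
  rw [h3]
  have h4 : ∀ κ, ∫ ω, Complex.exp (Complex.I * ((p κ * (Z κ ω).re : ℝ) : ℂ))
      * Complex.exp (Complex.I * ((q κ * (Z κ ω).im : ℝ) : ℂ)) ∂P
      = Complex.exp (-((p κ ^ 2 * vR κ + q κ ^ 2 * vI κ : ℝ) : ℂ) / 2) := by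
    intro κ
    have h5 := (hZ' κ).comp
      (by fun_prop : Measurable fun x : ℝ => Complex.exp (Complex.I * ((p κ * x : ℝ) : ℂ)))
      (by fun_prop : Measurable fun x : ℝ => Complex.exp (Complex.I * ((q κ * x : ℝ) : ℂ)))
    have h6 := h5.integral_fun_mul_eq_mul_integral
      ((by fun_prop : Measurable fun x : ℝ => Complex.exp
        (Complex.I * ((p κ * x : ℝ) : ℂ))).comp_aemeasurable (hre κ).aemeasurable).aestronglyMeasurable
      ((by fun_prop : Measurable fun x : ℝ => Complex.exp
        (Complex.I * ((q κ * x : ℝ) : ℂ))).comp_aemeasurable (him κ).aemeasurable).aestronglyMeasurable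
    simp only [Function.comp_apply] at h6
    rw [h6, integral_exp_I_of_hasLaw_gaussianReal (hre κ),
      integral_exp_I_of_hasLaw_gaussianReal (him κ), ← Complex.exp_add]
    congr 1
    push_cast
    ring
  simp only [h4]
  rw [Finset.prod_coe_sort s fun κ => Complex.exp (-((p κ ^ 2 * vR κ + q κ ^ 2 * vI κ : ℝ) : ℂ) / 2),
    ← Complex.exp_sum, ← Finset.sum_div, Finset.sum_neg_distrib, ← Complex.ofReal_sum]
  congr 4
  have h7 : ∀ i j, (if k i = k j then (t i).re * (t j).re * vR (k j)
        + (t i).im * (t j).im * vI (k j) else 0 : ℝ)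
      = (if k i = k j then (t i).re * (t j).re * vR (k j) else 0 : ℝ)
        + (if k i = k j then (t i).im * (t j).im * vI (k j) else 0 : ℝ) := by
    intro i j
    split_ifs <;> simp
  simp only [h7, Finset.sum_add_distrib]
  rw [sum_sum_eq_sum_image k (fun j => (t j).re) fun κ => (vR κ : ℝ),
    sum_sum_eq_sum_image k (fun j => (t j).im) fun κ => (vI κ : ℝ)]

end GaussianLimit

theorem charFun_map_toLp {Ω : Type*} [MeasurableSpace Ω] {P : Measure Ω} {n : ℕ}
    {X : Ω → Fin n → ℂ} (hX : ∀ j, AEMeasurable (fun ω => X ω j) P)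
    (t : EuclideanSpace ℂ (Fin n)) :
    charFun (P.map fun ω => WithLp.toLp 2 (X ω)) t
      = ∫ ω, Complex.exp (Complex.I * ((∑ j, (starRingEnd ℂ (t j) * X ω j).re : ℝ) : ℂ)) ∂P := by
  have h1 : AEMeasurable (fun ω => WithLp.toLp 2 (X ω)) P :=
    (WithLp.measurable_toLp 2 _).comp_aemeasurable (aemeasurable_pi_lambda _ hX)
  rw [charFun_apply, integral_map h1 (by fun_prop)]
  refine integral_congr_ae (Eventually.of_forall fun ω => ?_)
  simp only [mul_comm Complex.I]
  rw [real_inner_comm, PiLp.inner_apply]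
  simp [Complex.inner, mul_comm]

/-- The vectors are moved to `EuclideanSpace ℂ (Fin n)`, whose real inner product gives the
exponents `∑ Re (conj (t j) * z j)`. Lévy's theorem is applied along sequences, and the continuous
map back to the product space preserves the convergence. -/
theorem tendstoInDistribution_of_tendsto_integral_exp {Ω Ω' : Type*} [MeasurableSpace Ω]
    [MeasurableSpace Ω'] {P : Measure Ω} [IsProbabilityMeasure P] {P' : Measure Ω'}
    [IsProbabilityMeasure P'] {n : ℕ} {l : Filter ℝ} [l.IsCountablyGenerated]
    {X : ℝ → Ω → Fin n → ℂ} {Z : Ω' → Fin n → ℂ}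
    (hX : ∀ r j, AEMeasurable (fun ω => X r ω j) P) (hZ : ∀ j, AEMeasurable (fun ω => Z ω j) P')
    (h : ∀ t : Fin n → ℂ, Tendsto (fun r => ∫ ω, Complex.exp (Complex.I *
        ((∑ j, (starRingEnd ℂ (t j) * X r ω j).re : ℝ) : ℂ)) ∂P) l
      (𝓝 (∫ ω, Complex.exp (Complex.I *
        ((∑ j, (starRingEnd ℂ (t j) * Z ω j).re : ℝ) : ℂ)) ∂P'))) :
    TendstoInDistribution X l Z (fun _ => P) P' := by
  have h1 : ∀ r, AEMeasurable (fun ω => (WithLp.toLp 2 (X r ω) : EuclideanSpace ℂ (Fin n))) P :=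
    fun r => (WithLp.measurable_toLp 2 _).comp_aemeasurable (aemeasurable_pi_lambda _ (hX r))
  have h2 : AEMeasurable (fun ω => (WithLp.toLp 2 (Z ω) : EuclideanSpace ℂ (Fin n))) P' :=
    (WithLp.measurable_toLp 2 _).comp_aemeasurable (aemeasurable_pi_lambda _ hZ)
  have h3 : TendstoInDistribution
      (fun r ω => (WithLp.toLp 2 (X r ω) : EuclideanSpace ℂ (Fin n))) l
      (fun ω => WithLp.toLp 2 (Z ω)) (fun _ => P) P' := by
    refine ⟨h1, h2, tendsto_of_seq_tendsto fun u hu => ?_⟩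
    refine ProbabilityMeasure.tendsto_of_tendsto_charFun fun t => ?_
    have h4 := (h t).comp hu
    rw [← charFun_map_toLp hZ] at h4
    refine h4.congr fun m => ?_
    exact (charFun_map_toLp (hX (u m)) t).symm
  exact h3.continuous_comp (g := WithLp.ofLp) (PiLp.continuous_ofLp 2 _)

/-- If `k' = -k` lies in the half space together with `k`, both are its unique element in `{k, -k}`,
so `k = -k`. -/
theorem eq_zero_of_add_eq_zero {d : ℕ} {H : Set (E d)}
    (hH : ∀ k : E d, (H ∩ {k, -k}).ncard = 1) {k k' : E d} (hk : k ∈ H) (hk' : k' ∈ H)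
    (h : k + k' = 0) : k = 0 ∧ k' = 0 := by
  obtain ⟨a, ha⟩ := Set.ncard_eq_one.1 (hH k)
  have h1 : k' = -k := (neg_eq_of_add_eq_zero_right h).symm
  have h2 : k = a := by
    have : k ∈ H ∩ {k, -k} := ⟨hk, by simp⟩
    rwa [ha] at this
  have h3 : k' = a := by
    have : k' ∈ H ∩ {k, -k} := ⟨hk', by simp [h1]⟩
    rwa [ha] at this
  have h4 : k = 0 := by
    rw [← h2.trans h3.symm, ← two_smul ℝ] at h
    exact (smul_eq_zero.1 h).resolve_left two_ne_zero
  exact ⟨h4, by rw [h1, h4, neg_zero]⟩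

end PointProcess

/-! ### The central limit theorem -/

theorem mainTheorem1 {d : ℕ} (hd : 1 ≤ d)
    {Ω : Type*} [MeasurableSpace Ω] (P : Measure Ω) [IsProbabilityMeasure P]
    (η : Ω → PointProcess.Configuration d) (hη : Measurable η)
    (hstat : PointProcess.IsStationary P η)
    (hmom : PointProcess.HasAllMoments P η)
    (hγ : 0 < PointProcess.intensity P η)
    (hβ : ∀ n : ℕ, ∫⁻ x, ENNReal.ofReal (1 + ‖x 0‖)
      ∂(PointProcess.reducedCumulantVar P η (n + 1)) < ∞)
    (h : PointProcess.E d → ℝ) (A : Set (PointProcess.E d)) (hA : PointProcess.IsTaper h A)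
    (H : Set (PointProcess.E d)) (hH : ∀ k : PointProcess.E d, (H ∩ {k, -k}).ncard = 1) :
    (∀ k ∈ (A ∪ {0}) ∩ H,
      (PointProcess.asympVar P η h k).im = 0 ∧ 0 ≤ (PointProcess.asympVar P η h k).re) ∧
    ∀ {Ω' : Type*} [MeasurableSpace Ω'] (P' : Measure Ω') [IsProbabilityMeasure P']
      (Z : ↥((A ∪ {0}) ∩ H) → Ω' → ℂ),
      iIndepFun Z P' →
      (∀ k, IndepFun (fun ω => (Z k ω).re) (fun ω => (Z k ω).im) P') →
      (∀ k, HasLaw (fun ω => (Z k ω).re)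
        (gaussianReal 0 (PointProcess.varRe P η h k)) P') →
      (∀ k, HasLaw (fun ω => (Z k ω).im)
        (gaussianReal 0 (PointProcess.varIm P η h k)) P') →
      ∀ (n : ℕ) (k : Fin n → ↥((A ∪ {0}) ∩ H)),
        TendstoInDistribution
          (fun (r : ℝ) (ω : Ω) (j : Fin n) =>
            PointProcess.empiricalFourier P η h r (k j : PointProcess.E d) ω)
          atTop (fun ω' j => Z (k j) ω') (fun _ => P) P' := by
  have hfin := PointProcess.finiteCumulants hη hmom hβ
  obtain ⟨U, hU', hU0, hU1, hU2⟩ := hA.exists_truncation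
  have hU := hA.isNormalizedTaper hd hU0 hU1 hU2
  refine ⟨fun k _ => PointProcess.asympVar_nonneg hη hmom hstat hfin hγ hU hU' k, ?_⟩
  intro Ω' _ P' _ Z hZ hZ' hre him n k
  classical
  have hm : ∀ κ, AEMeasurable (Z κ) P' := by
    intro κ
    have h2 := (Complex.measurable_ofReal.comp_aemeasurable (hre κ).aemeasurable).add
      ((Complex.measurable_ofReal.comp_aemeasurable (him κ).aemeasurable).mul_const Complex.I)
    exact h2.congr (Eventually.of_forall fun ω => Complex.re_add_im _)
  refine PointProcess.tendstoInDistribution_of_tendsto_integral_exp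
    (fun r j => PointProcess.aemeasurable_empiricalFourier hd hη hmom hstat hA r _)
    (fun j => hm _) fun t => ?_
  rw [PointProcess.integral_exp_of_iIndepFun_gaussian hZ hZ' hre him t k]
  -- The transform is compared with the statistic of the truncated taper; the error `γ / r` in mean
  -- comes from Campbell's formula.
  refine PointProcess.tendsto_integral_exp_of_tendsto_integral_norm t
    (X := fun r j ω => PointProcess.empiricalFourier P η h r (k j) ω)
    (Y := fun r j ω => PointProcess.tupleSum (η ω) [(U r).mod (k j)]
      - PointProcess.fourierMean P η h r (k j))
    (fun r j => PointProcess.aemeasurable_empiricalFourier hd hη hmom hstat hA r _)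
    (fun r j => (PointProcess.integrable_tupleSum hη hmom _).aemeasurable.sub_const _)
    (δ := fun r => PointProcess.intensity P η * r⁻¹)
    (by simpa using tendsto_inv_atTop_zero.const_mul (PointProcess.intensity P η)) ?_ ?_
  · filter_upwards [eventually_gt_atTop 0] with r hr j
    exact PointProcess.integral_norm_empiricalFourier_sub_le hη hmom hstat hA hU2 hr _
  · have h1 := PointProcess.tendsto_integral_exp_mod hη hmom hstat hfin hγ hU hU' t
      (fun j => (k j : PointProcess.E d))
      (fun i j => PointProcess.eq_zero_of_add_eq_zero hH (k i).2.2 (k j).2.2)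
      fun j => hA.tendsto_integral_mod hU2 (k j).2.1
    simpa only [← Subtype.ext_iff] using h1
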